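/- Let $d\in\{2,3\}$, let $\Omega\subset\mathbb R^d$ be open and bounded, $\alpha\in(0,1)$, $\nu,\gamma,T>0$. Let $$\langle u,v\rangle_\alpha=\int_{\mathbb R^d}\int_{\mathbb R^d}\frac{(u(x)-u(y))\cdot(v(x)-v(y))}{|x-y|^{d+2\alpha}}\,dx\,dy,\qquad |u|_\alpha^2=\langle u,u\rangle_\alpha,\qquad C_{d,\alpha}=\frac{\alpha 2^{2\alpha}\Gamma(\frac{d+2\alpha}{2})}{\pi^{d/2}\Gamma(1-\alpha)} ,$$ let $H^\alpha_\Omega=\{v\in H^\alpha(\mathbb R^d)^d: v=0 \text{ off }\Omega\}$, $X=\{v\in H^\alpha_\Omega: v\in H^1(\mathbb R^d)^d\}$, and let $Q$ be the space of $q\in L^2(\Omega)$ with $\int_\Omega q=0$. For $u\in H^\alpha(\mathbb R^d)^d$ and an open set $U$, $g=(-\Delta)^\alpha u$ in $U$ means that $g\in L^2(U)$ and $\frac{C_{d,\alpha}}2\langle u,v\rangle_\alpha=\int_U g\cdot v\,dx$ for all $v\in H^\alpha_U$. $H^k(\Omega)$ is the space of restrictions to $\Omega$ of functions in $H^k(\mathbb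 R^d)$ (the usual space if $\partial\Omega$ is Lipschitz). Let $$b_\Omega(u,v,w)=\tfrac12\int_\Omega (u\cdot\nabla)v\cdot w\,dx-\tfrac12\int_\Omega (u\cdot\nabla)w\cdot v\,dx$$ be the usual skew-symmetric trilinear form (equal to $\int_\Omega(u\cdot\nabla)v\cdot w\,dx$ when $\nabla\cdot u=0$). Let $(u,p)$ solve, for every $t\in(0,T]$ and a.e. in $\Omega$, $$u_t+(u\cdot\nabla)u-\nu\Delta u+\gamma(-\Delta)^\alpha u+\nabla p=f,\qquad \nabla\cdot u=0,$$ with $u(t)\in X$ for $t\in[0,T]$ (so $u=0$ off $\Omega$) and $u(0)=u_0$. Assume $u\in L^\infty(0,T;H^2(\Omega))\cap H^2(0,T;L^2(\Omega))$, $(-\Delta)^\alpha u\in H^1(0,T;H^\alpha(\mathbb R^d))$, $p\in L^2(0,T;H^1(\Omega))$ and $f\in L^2(0,T;L^2(\Omega))$, the functions of class $H^1$ in time (in particular $u$, $u_t$ and $(-\Delta)^\alpha u$) being their continuous representatives, and $u(t)\in H^2(\Omega)$, $p(t)\in H^1(\Omega)$ for every $t\in(0,T]$. Modular IMEX Euler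 algorithm: let $u^0=w^0=u_0$, $t_n=n\Delta t$. Given $u^n\in H^\alpha_\Omega$, Stage 1 finds $w^{n+1}\in X$, $p^{n+1}\in Q$ with $\nabla\cdot w^{n+1}=0$ in $\Omega$ and, for all $v\in X$ (the integrals in $b_\Omega(u^n,w^{n+1},v)$ being absolutely convergent), $$\tfrac1{\Delta t}\int_\Omega(w^{n+1}-u^n)\cdot v\,dx+b_\Omega(u^n,w^{n+1},v)+\nu\int_\Omega\nabla w^{n+1}:\nabla v\,dx-\int_\Omega p^{n+1}\nabla\cdot v\,dx=\int_\Omega f(t_{n+1})\cdot v\,dx-\gamma\tfrac{C_{d,\alpha}}2\langle u^n,v\rangle_\alpha ;$$ Stage 2 finds $u^{n+1}\in H^\alpha_\Omega$ with, for all $v\in H^\alpha_\Omega$, $$2\Delta t\,\gamma\tfrac{C_{d,\alpha}}2\langle u^{n+1}-u^n,v\rangle_\alpha+\int_\Omega(u^{n+1}-w^{n+1})\cdot v\,dx=0 .$$ Let $e^n=u(t_n)-u^n$, $\bar e^n=u(t_n)-w^n$. Then there is a constant $C>0$, independent of $\Delta t$, of $N$ and of the discrete solution, such that for all $0<\Delta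 t\le1$, all $N\ge0$ with $N\Delta t\le T$, and every solution of $N$ steps of the algorithm, $(-\Delta)^\alpha e^N\in L^2(\Omega)$ exists in $\Omega$ and $$\begin{aligned}&\|e^N\|_{L^2(\Omega)}^2+\sum_{n=0}^{N-1}\|\bar e^{n+1}-e^n\|_{L^2(\Omega)}^2+\sum_{n=0}^{N-1}\|e^{n+1}-\bar e^n\|_{L^2(\Omega)}^2+\Delta t\sum_{n=0}^{N-1}\nu\|\nabla\bar e^{n+1}\|_{L^2(\Omega)}^2+\Delta t\,\gamma C_{d,\alpha}|e^N|_\alpha^2\\&+\Delta t\sum_{n=0}^{N-1}\gamma\tfrac{3C_{d,\alpha}}4|e^{n+1}-e^n|_\alpha^2+\Delta t\sum_{n=0}^{N-1}\gamma\tfrac{C_{d,\alpha}}4|e^{n+1}+e^n|_\alpha^2+2\Delta t^2\gamma^2\|(-\Delta)^\alpha e^N\|_{L^2(\Omega)}^2\le C\Delta t^2.\end{aligned}$$ -/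

import Mathlib

open MeasureTheory Set
open scoped ContDiff RealInnerProductSpace ENNReal

noncomputable section

namespace FracNS

/-- The space `ℝ^d` with the Euclidean norm. -/
abbrev Sp (d : ℕ) : Type := EuclideanSpace ℝ (Fin d)

/-- Vector fields in `L²(ℝ^d; ℝ^d)`. -/
abbrev L2V (d : ℕ) : Type := Lp (Sp d) 2 (volume : Measure (Sp d))

/-- Vector fields in `L²(Ω; ℝ^d)`. -/
abbrev L2VOn {d : ℕ} (Ω : Set (Sp d)) : Type := Lp (Sp d) 2 (volume.restrict Ω)

/-- Scalar functions in `L²(Ω)`. -/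
abbrev L2On {d : ℕ} (Ω : Set (Sp d)) : Type := Lp ℝ 2 (volume.restrict Ω)

/-! ### Weak derivatives and Sobolev spaces of integer order -/

/-- `g` is the weak partial derivative `∂ᵢ u` on the open set `Ω`
(tested against `C_c^∞(Ω)`). -/
def HasWeakPartial {d : ℕ} {F : Type*} [NormedAddCommGroup F] [NormedSpace ℝ F]
    (Ω : Set (Sp d)) (i : Fin d) (u g : Sp d → F) : Prop :=
  ∀ φ : Sp d → ℝ, ContDiff ℝ ∞ φ → HasCompactSupport φ → tsupport φ ⊆ Ω →
    ∫ x, (fderiv ℝ φ x (EuclideanSpace.single i (1 : ℝ))) • u x = - ∫ x, φ x • g x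

/-- The weak partial derivative `∂ᵢ u` on `Ω`, as a function in `L²(Ω)`. It is unique up to
null sets when it exists; it is only used for functions for which it exists. -/
def weakPartial {d : ℕ} {F : Type*} [NormedAddCommGroup F] [NormedSpace ℝ F]
    (Ω : Set (Sp d)) (i : Fin d) (u : Sp d → F) : Sp d → F :=
  Classical.epsilon fun g => MemLp g 2 (volume.restrict Ω) ∧ HasWeakPartial Ω i u g

/-- `v ∈ H¹(ℝ^d)` for a vector field `v ∈ L²(ℝ^d)`. -/
def MemH1 {d : ℕ} (v : L2V d) : Prop :=
  ∀ i : Fin d, ∃ g : L2V d, HasWeakPartial univ i v g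

/-- `‖u‖_{H²(Ω)} ≤ M`, where `H²(Ω)` is the space of restrictions to `Ω` of elements of
`H²(ℝ^d)` with the quotient norm (the usual `H²(Ω)`, with an equivalent norm, if `∂Ω` is
Lipschitz): there is an `H²(ℝ^d)` field `V` that equals `u` on `Ω`, with norm at most `M`. -/
def H2NormOnLE {d : ℕ} (Ω : Set (Sp d)) (u : L2V d) (M : ℝ) : Prop :=
  ∃ (V : L2V d) (D : Fin d → L2V d) (D2 : Fin d → Fin d → L2V d),
    (u =ᵐ[volume.restrict Ω] V) ∧
    (∀ i, HasWeakPartial univ i V (D i)) ∧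
    (∀ i j, HasWeakPartial univ j (D i) (D2 i j)) ∧
    ‖V‖ ^ 2 + ∑ i, ‖D i‖ ^ 2 + ∑ i, ∑ j, ‖D2 i j‖ ^ 2 ≤ M ^ 2

/-- `u|_Ω ∈ H²(Ω)`. -/
def MemH2On {d : ℕ} (Ω : Set (Sp d)) (u : L2V d) : Prop := ∃ M : ℝ, H2NormOnLE Ω u M

/-- `p ∈ H¹(Ω)` for a scalar function `p`: it is the restriction to `Ω` of an element of
`H¹(ℝ^d)`. -/
def MemH1On {d : ℕ} (Ω : Set (Sp d)) (p : L2On Ω) : Prop :=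
  ∃ (P : Lp ℝ 2 (volume : Measure (Sp d))) (D : Fin d → Lp ℝ 2 (volume : Measure (Sp d))),
    (p =ᵐ[volume.restrict Ω] P) ∧ ∀ i, HasWeakPartial univ i P (D i)

/-! ### Fractional Sobolev spaces and the fractional Laplacian -/

/-- The Gagliardo form
`∫∫ (u(x) - u(y)) · (v(x) - v(y)) / |x - y|^{d + 2α} dx dy` over `ℝ^d × ℝ^d`. -/
def gagliardoForm {d : ℕ} (α : ℝ) (u v : L2V d) : ℝ :=
  ∫ z : Sp d × Sp d,
    ⟪u z.1 - u z.2, v z.1 - v z.2⟫ / ‖z.1 - z.2‖ ^ ((d : ℝ) + 2 * α)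

/-- The square of the Gagliardo seminorm. -/
def gagliardoSq {d : ℕ} (α : ℝ) (u : L2V d) : ℝ := gagliardoForm α u u

/-- `v ∈ H^α(ℝ^d)`: the Gagliardo seminorm of `v ∈ L²(ℝ^d)` is finite. -/
def MemHalpha {d : ℕ} (α : ℝ) (v : L2V d) : Prop :=
  Integrable (fun z : Sp d × Sp d => ‖v z.1 - v z.2‖ ^ 2 / ‖z.1 - z.2‖ ^ ((d : ℝ) + 2 * α))

/-- `v = 0` (almost everywhere) in `ℝ^d \ Ω`. -/
def VanishesOff {d : ℕ} (Ω : Set (Sp d)) (v : L2V d) : Prop := ∀ᵐ x, x ∉ Ω → v x = 0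

/-- The space `H^α_Ω(ℝ^d)`. -/
def MemHalphaOff {d : ℕ} (α : ℝ) (Ω : Set (Sp d)) (v : L2V d) : Prop :=
  MemHalpha α v ∧ VanishesOff Ω v

/-- The velocity space `X = H^α_Ω(ℝ^d) ∩ H¹_Ω(ℝ^d)`. -/
def MemX {d : ℕ} (α : ℝ) (Ω : Set (Sp d)) (v : L2V d) : Prop :=
  MemHalpha α v ∧ MemH1 v ∧ VanishesOff Ω v

/-- The normalizing constant `C_{d,α}` for which the singular integral
`C_{d,α} PV∫ (u(x) - u(y)) / |x - y|^{d + 2α} dy` has the Fourier symbol `|ξ|^{2α}`. -/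
def fracConst (d : ℕ) (α : ℝ) : ℝ :=
  α * 2 ^ (2 * α) * Real.Gamma (((d : ℝ) + 2 * α) / 2) /
    (Real.pi ^ ((d : ℝ) / 2) * Real.Gamma (1 - α))

/-- `g = (-Δ)^α u` in `Ω`, with `u ∈ H^α(ℝ^d)` and `g ∈ L²(Ω)`, in the weak sense: the singular
integral operator is paired with all `v ∈ H^α_Ω(ℝ^d)`. For `Ω = univ` this is the identity
`g = (-Δ)^α u` on all of `ℝ^d`. -/
def IsFracLapOn {d : ℕ} (α : ℝ) (Ω : Set (Sp d)) (u : L2V d) (g : Sp d → Sp d) : Prop :=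
  MemHalpha α u ∧ MemLp g 2 (volume.restrict Ω) ∧
    ∀ v : L2V d, MemHalphaOff α Ω v →
      fracConst d α / 2 * gagliardoForm α u v = ∫ x in Ω, ⟪g x, v x⟫

/-! ### Forms on `Ω` -/

/-- `‖v‖²_{L²(Ω)}`. -/
def l2Sq {d : ℕ} (Ω : Set (Sp d)) (v : Sp d → Sp d) : ℝ := ∫ x in Ω, ‖v x‖ ^ 2

/-- `∫_Ω ∇v : ∇w dx` for `v, w ∈ H¹(ℝ^d)`. -/
def gradForm {d : ℕ} (Ω : Set (Sp d)) (v w : L2V d) : ℝ :=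
  ∫ x in Ω, ∑ i, ⟪weakPartial univ i v x, weakPartial univ i w x⟫

/-- The divergence of `v ∈ H¹(ℝ^d)`. -/
def divergence {d : ℕ} (v : L2V d) (x : Sp d) : ℝ := ∑ i, weakPartial univ i v x i

/-- The integrand `((u · ∇) v) · w`. -/
def convIntegrand {d : ℕ} (u v w : L2V d) (x : Sp d) : ℝ :=
  ⟪∑ j, (u x j) • weakPartial univ j v x, w x⟫

/-- The skew symmetric trilinear form
`½ ∫_Ω (u · ∇) v · w dx - ½ ∫_Ω (u · ∇) w · v dx`, which is `∫_Ω (u · ∇) v · w dx` for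
divergence free `u`. -/
def skewForm {d : ℕ} (Ω : Set (Sp d)) (u v w : L2V d) : ℝ :=
  1 / 2 * (∫ x in Ω, convIntegrand u v w x) - 1 / 2 * ∫ x in Ω, convIntegrand u w v x

/-! ### Functions of time -/

/-- `v` is the (weak) derivative in time of `u` on `[0, T]`, with `u` the absolutely continuous
representative: `u(t) = u(0) + ∫₀ᵗ v ds` for every `t ∈ [0, T]`. -/
def IsTimeDeriv {B : Type*} [NormedAddCommGroup B] [NormedSpace ℝ B] (T : ℝ) (u v : ℝ → B) :
    Prop :=
  IntervalIntegrable v volume 0 T ∧ ∀ t ∈ Icc 0 T, u t = u 0 + ∫ s in (0 : ℝ)..t, v s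

/-- `u ∈ H¹(0, T; B)`, with `u` its continuous representative. -/
def MemTimeH1 {B : Type*} [NormedAddCommGroup B] [NormedSpace ℝ B] (T : ℝ) (u : ℝ → B) : Prop :=
  ∃ v : ℝ → B, IsTimeDeriv T u v ∧ MemLp v 2 (volume.restrict (Ioc 0 T))

/-- `u ∈ H¹(0, T; H^α(ℝ^d))`, with `u` its continuous representative. -/
def MemTimeH1Halpha {d : ℕ} (α T : ℝ) (u : ℝ → L2V d) : Prop :=
  (∀ t ∈ Icc 0 T, MemHalpha α (u t)) ∧
  ∃ v : ℝ → L2V d, IsTimeDeriv T u v ∧ MemLp v 2 (volume.restrict (Ioc 0 T)) ∧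
    (∀ᵐ t ∂(volume.restrict (Ioc 0 T)), MemHalpha α (v t)) ∧
    Integrable (fun t => gagliardoSq α (v t)) (volume.restrict (Ioc 0 T))

/-- `u ∈ L^∞(0, T; H²(Ω))`. -/
def MemTimeLinftyH2 {d : ℕ} (Ω : Set (Sp d)) (T : ℝ) (u : ℝ → L2V d) : Prop :=
  ∃ M : ℝ, ∀ᵐ t ∂(volume.restrict (Ioc 0 T)), H2NormOnLE Ω (u t) M

/-- `p ∈ L²(0, T; H¹(Ω))`: `p` is the restriction to `Ω` of an element of
`L²(0, T; H¹(ℝ^d))`. -/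
def MemTimeL2H1 {d : ℕ} (Ω : Set (Sp d)) (T : ℝ) (p : ℝ → L2On Ω) : Prop :=
  ∃ (P : ℝ → Lp ℝ 2 (volume : Measure (Sp d)))
    (D : Fin d → ℝ → Lp ℝ 2 (volume : Measure (Sp d))),
    MemLp P 2 (volume.restrict (Ioc 0 T)) ∧
    (∀ i, MemLp (D i) 2 (volume.restrict (Ioc 0 T))) ∧
    ∀ᵐ t ∂(volume.restrict (Ioc 0 T)),
      (p t =ᵐ[volume.restrict Ω] P t) ∧ ∀ i, HasWeakPartial univ i (P t) (D i t)

/-! ### The continuous problem -/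

/-- `(u, p)` solves the fractional closure model
`u_t + (u·∇)u - νΔu + γ(-Δ)^α u + ∇p = f`, `∇·u = 0` in `(0, T] × Ω`, `u = 0` off `Ω`,
`u(0) = u₀`. Here `ut` is `u_t` and `Au` is `(-Δ)^α u`. -/
structure IsExactSolution {d : ℕ} (Ω : Set (Sp d)) (ν γ α T : ℝ) (f : ℝ → L2VOn Ω)
    (u₀ : L2V d) (u ut Au : ℝ → L2V d) (p : ℝ → L2On Ω) : Prop where
  mem_X : ∀ t ∈ Icc 0 T, MemX α Ω (u t)
  initial : u 0 = u₀
  time_deriv : IsTimeDeriv T u ut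
  frac_lap : ∀ t ∈ Icc 0 T, IsFracLapOn α univ (u t) (Au t)
  mem_H2 : ∀ t ∈ Ioc 0 T, MemH2On Ω (u t)
  mem_H1 : ∀ t ∈ Ioc 0 T, MemH1On Ω (p t)
  momentum : ∀ t ∈ Ioc 0 T, ∀ᵐ x ∂(volume.restrict Ω),
    ut t x + ∑ j, (u t x j) • weakPartial Ω j (u t) x
      - ν • ∑ j, weakPartial Ω j (weakPartial Ω j (u t)) x
      + γ • Au t x
      + ∑ j, weakPartial Ω j (p t) x • EuclideanSpace.single j (1 : ℝ) = f t x
  incompressible : ∀ t ∈ Ioc 0 T, ∀ᵐ x ∂(volume.restrict Ω), divergence (u t) x = 0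

/-- The regularity of the exact solution and of the body force:
`u ∈ L^∞(0,T;H²(Ω)) ∩ H²(0,T;L²(Ω))`, `(-Δ)^α u ∈ H¹(0,T;H^α(ℝ^d))`,
`p ∈ L²(0,T;H¹(Ω))`, `f ∈ L²(0,T;L²(Ω))`. As `ut` is the time derivative of `u`, membership of
`u` in `H²(0,T;L²(Ω))` is membership of `ut` in `H¹(0,T;L²(Ω))`. -/
structure HasRegularity {d : ℕ} (Ω : Set (Sp d)) (α T : ℝ) (f : ℝ → L2VOn Ω)
    (u ut Au : ℝ → L2V d) (p : ℝ → L2On Ω) : Prop where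
  u_Linfty_H2 : MemTimeLinftyH2 Ω T u
  u_H2_L2 : MemTimeH1 T ut
  fracLap_H1_Halpha : MemTimeH1Halpha α T Au
  p_L2_H1 : MemTimeL2H1 Ω T p
  f_L2_L2 : MemLp f 2 (volume.restrict (Ioc 0 T))

/-! ### The modular algorithm -/

/-- `u⁰ = w⁰ = u₀` and, for `n < N`, the fields `wⁿ⁺¹, pⁿ⁺¹, uⁿ⁺¹` are obtained from `uⁿ` by the
two stages of the modular IMEX Euler algorithm with time step `Δt`, in variational form. -/
structure IsModularSolution {d : ℕ} (Ω : Set (Sp d)) (ν γ α Δt : ℝ) (f : ℝ → L2VOn Ω)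
    (u₀ : L2V d) (N : ℕ) (u w : ℕ → L2V d) (p : ℕ → L2On Ω) : Prop where
  u_zero : u 0 = u₀
  w_zero : w 0 = u₀
  mem_u : ∀ n ≤ N, MemHalphaOff α Ω (u n)
  mem_w : ∀ n < N, MemX α Ω (w (n + 1))
  mem_p : ∀ n < N, ∫ x in Ω, p (n + 1) x = 0
  conv_integrable : ∀ n < N, ∀ v : L2V d, MemX α Ω v →
    IntegrableOn (convIntegrand (u n) (w (n + 1)) v) Ω ∧
    IntegrableOn (convIntegrand (u n) v (w (n + 1))) Ω
  stage1 : ∀ n < N, ∀ v : L2V d, MemX α Ω v →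
    1 / Δt * (∫ x in Ω, ⟪w (n + 1) x - u n x, v x⟫)
      + skewForm Ω (u n) (w (n + 1)) v
      + ν * gradForm Ω (w (n + 1)) v
      - (∫ x in Ω, p (n + 1) x * divergence v x)
    = (∫ x in Ω, ⟪f (((n + 1 : ℕ) : ℝ) * Δt) x, v x⟫)
      - γ * (fracConst d α / 2 * gagliardoForm α (u n) v)
  stage1_div : ∀ n < N, ∀ᵐ x ∂(volume.restrict Ω), divergence (w (n + 1)) x = 0
  stage2 : ∀ n < N, ∀ v : L2V d, MemHalphaOff α Ω v →
    2 * Δt * γ * (fracConst d α / 2 * gagliardoForm α (u (n + 1) - u n) v)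
      + (∫ x in Ω, ⟪u (n + 1) x - w (n + 1) x, v x⟫) = 0

end FracNS

end

open FracNS

/-!
The two stages of a step are discretizations of the momentum equation and of the fractional
diffusion, coupled through `uⁿ`. The estimate is an energy argument in `L²(ℝ^d)`, which becomes
elementary after one observation: by the second stage, the fractional Laplacian of the error
`eⁿ = u(tₙ) - uⁿ` is known explicitly. At time zero the error vanishes, and each step changes the
functional `a(eⁿ, ·)` (with `a` the bilinear form of `(-Δ)^α`) by the pairing with an element of
`L²`. Hence `a(eⁿ, ·)` is the pairing with a field `Bⁿ` on all of `H^α_Ω`, which gives the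
existence of `(-Δ)^α eⁿ`, and `ēⁿ⁺¹ = eⁿ⁺¹ + 2Δtγ (Bⁿ⁺¹ - Bⁿ - δⁿ)` holds in `L²`, where
`δⁿ = (-Δ)^α (u(tₙ₊₁) - u(tₙ))` is the time lag of the explicit fractional term
(`exists_representation`, `stage2_error`).

Testing the error equation of the first stage (`stage1_error`) with `ēⁿ⁺¹` and that of the second
stage with `eⁿ⁺¹`, and adding, the terms with `Bⁿ` telescope and one finds that the energy
`‖eⁿ‖² + 2Δtγ a(eⁿ, eⁿ) + 2Δt²γ² ‖Bⁿ‖²` grows in one step by the factor `1 + O(Δt)` and by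
`O(Δt)` times the squared norms of `δⁿ`, of the consistency error of the difference quotient in
time, and of `u(tₙ₊₁) - u(tₙ)` (`energy_step`). By the Cauchy–Schwarz inequality in time the sum
over `n` of these data is `O(Δt)` (`sq_norm_quotient_sub_deriv_le`), and the discrete Gronwall
inequality gives the bound `O(Δt²)` (`discrete_gronwall`, `error_bound_of_step`).

The test field `ēⁿ⁺¹` is divergence free on `Ω`, so the pressures drop out. By skew symmetry the
convection terms reduce to `b_Ω(u(tₙ₊₁) - uⁿ, u(tₙ₊₁), ēⁿ⁺¹)`, which is at most
`K ‖u(tₙ₊₁) - uⁿ‖ ‖∇ēⁿ⁺¹‖` (`exists_skewForm_bound`). This is where the dimension and the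
regularity enter: `H² ⊆ L^∞` (`exists_eLpNorm_top_le`) and `‖v‖_{L⁴} ≤ C ‖∇v‖_{L²}`
(`exists_eLpNorm_four_le`); a bound of `u(t)` in `H²(Ω)` at every time follows from the one at
almost every time by continuity in `L²` and weak compactness (`MemTimeLinftyH2.exists_bound`).

No boundary regularity of `Ω` is assumed, so fields that vanish off `Ω` need not be limits of test
functions on `Ω`. The variational form of the momentum equation (`variational_of_momentum`) is
obtained by integrating by parts on the whole space instead: the weak gradient of a field that
vanishes off `Ω` also vanishes there almost everywhere (`HasWeakPartial.ae_eq_zero_of_eq_zero`).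
-/

namespace FracNS

open Filter Topology


/-! ### Mollification -/

/-- A standard mollifier supported in the ball of radius `1 / (n + 1)`. -/
noncomputable def mollifierBump (d n : ℕ) : ContDiffBump (0 : Sp d) where
  rIn := 1 / (2 * ((n : ℝ) + 1))
  rOut := 1 / ((n : ℝ) + 1)
  rIn_pos := by positivity
  rIn_lt_rOut := by
    apply one_div_lt_one_div_of_lt <;> linarith [(Nat.cast_nonneg n : (0:ℝ) ≤ n)]

/-- The mollifier of integral one. -/
noncomputable def mollifier (d n : ℕ) : Sp d → ℝ := (mollifierBump d n).normed volume

/-- The mollification `ρₙ ∗ f`. -/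
noncomputable def mollify {d : ℕ} (n : ℕ) (f : Sp d → ℝ) : Sp d → ℝ :=
  convolution (mollifier d n) f (ContinuousLinearMap.lsmul ℝ ℝ) volume

variable {d : ℕ}

lemma mollifier_contDiff (n : ℕ) : ContDiff ℝ ∞ (mollifier d n) :=
  (mollifierBump d n).contDiff_normed

lemma mollifier_hasCompactSupport (n : ℕ) : HasCompactSupport (mollifier d n) :=
  (mollifierBump d n).hasCompactSupport_normed

lemma mollifier_nonneg (n : ℕ) (x : Sp d) : 0 ≤ mollifier d n x :=
  (mollifierBump d n).nonneg_normed x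

lemma integral_mollifier (n : ℕ) : ∫ x, mollifier d n x = 1 :=
  (mollifierBump d n).integral_normed

lemma mollifier_eq_zero (n : ℕ) {x : Sp d} (hx : 1 / ((n : ℝ) + 1) ≤ ‖x‖) :
    mollifier d n x = 0 := by
  have h : x ∉ Function.support (mollifier d n) := by
    unfold mollifier
    rw [ContDiffBump.support_normed_eq]
    simpa [mollifierBump] using hx
  simpa using h

lemma lintegral_mollifier (n : ℕ) : ∫⁻ x, ENNReal.ofReal (mollifier d n x) = 1 := by
  rw [← ofReal_integral_eq_lintegral_ofReal, integral_mollifier, ENNReal.ofReal_one]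
  · exact (mollifier_contDiff n).continuous.integrable_of_hasCompactSupport
      (mollifier_hasCompactSupport n)
  · exact Eventually.of_forall (mollifier_nonneg n)

lemma mollify_apply (n : ℕ) (f : Sp d → ℝ) (x : Sp d) :
    mollify n f x = ∫ t, mollifier d n t * f (x - t) := rfl

lemma mollify_congr (n : ℕ) {f g : Sp d → ℝ} (h : f =ᵐ[volume] g) : mollify n f = mollify n g :=
  convolution_congr _ (ae_eq_refl _) h

lemma mollify_contDiff (n : ℕ) {f : Sp d → ℝ} (hf : LocallyIntegrable f) :
    ContDiff ℝ ∞ (mollify n f) :=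
  (mollifier_hasCompactSupport n).contDiff_convolution_left _ (mollifier_contDiff n) hf

lemma memLp_comp_sub {f : Sp d → ℝ} {p : ℝ≥0∞} (hf : MemLp f p) (t : Sp d) :
    MemLp (fun x => f (x - t)) p :=
  hf.comp_measurePreserving (measurePreserving_sub_right volume t)

lemma integrable_mollifier_mul (n : ℕ) {f : Sp d → ℝ} (hf : LocallyIntegrable f) (x : Sp d) :
    Integrable fun t => mollifier d n t * f (x - t) :=
  ((mollifier_hasCompactSupport n).convolutionExists_left (ContinuousLinearMap.lsmul ℝ ℝ)
    (mollifier_contDiff n).continuous hf) x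

/-- Jensen's inequality for the average over translates that defines the mollification. -/
lemma lintegral_mollify_sub_sq_le (n : ℕ) {f : Sp d → ℝ} (hf : MemLp f 2) :
    ∫⁻ x, ‖mollify n f x - f x‖ₑ ^ 2 ≤
      ∫⁻ t, ENNReal.ofReal (mollifier d n t) * ∫⁻ x, ‖f (x - t) - f x‖ₑ ^ 2 := by
  wlog hm : StronglyMeasurable f generalizing f
  · obtain ⟨g, hg, hfg⟩ := hf.1
    have := this (hf.ae_eq hfg) hg
    rw [mollify_congr n hfg]
    calc ∫⁻ x, ‖mollify n g x - f x‖ₑ ^ 2 = ∫⁻ x, ‖mollify n g x - g x‖ₑ ^ 2 := by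
          apply lintegral_congr_ae
          filter_upwards [hfg] with x hx
          rw [hx]
      _ ≤ _ := this
      _ = _ := by
          congr 1
          ext t
          congr 1
          apply lintegral_congr_ae
          have h2 : ∀ᵐ x : Sp d, f (x - t) = g (x - t) :=
            (measurePreserving_sub_right volume t).quasiMeasurePreserving.ae hfg
          filter_upwards [hfg, h2] with x hx h2x
          rw [hx, h2x]
  have hfl : LocallyIntegrable f := hf.locallyIntegrable (by norm_num)
  have hφm : Measurable fun t => ENNReal.ofReal (mollifier d n t) :=
    (mollifier_contDiff n).continuous.measurable.ennreal_ofReal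
  have hF : Measurable fun z : Sp d × Sp d => ‖f (z.1 - z.2) - f z.1‖ₑ :=
    (((hm.measurable.comp (measurable_fst.sub measurable_snd))).sub
      (hm.measurable.comp measurable_fst)).enorm
  have key : ∀ x, ‖mollify n f x - f x‖ₑ ^ 2 ≤
      ∫⁻ t, ENNReal.ofReal (mollifier d n t) * ‖f (x - t) - f x‖ₑ ^ 2 := by
    intro x
    have e1 : mollify n f x - f x = ∫ t, mollifier d n t * (f (x - t) - f x) := by
      simp_rw [mul_sub]
      rw [integral_sub (integrable_mollifier_mul n hfl x), integral_mul_const,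
        integral_mollifier, one_mul, mollify_apply]
      exact ((mollifier_contDiff n).continuous.integrable_of_hasCompactSupport
        (mollifier_hasCompactSupport n)).mul_const _
    -- the mollifier is a probability density, so the `L¹` norm is at most the `L²` norm
    set ν : Measure (Sp d) := volume.withDensity fun t => ENNReal.ofReal (mollifier d n t)
    have hν : IsProbabilityMeasure ν :=
      ⟨by rw [withDensity_apply _ MeasurableSet.univ, Measure.restrict_univ,
        lintegral_mollifier]⟩
    have hFx : Measurable fun t => f (x - t) - f x :=
      (hm.measurable.comp (measurable_const.sub measurable_id)).sub measurable_const
    have e2 : ‖mollify n f x - f x‖ₑ ≤ eLpNorm (fun t => f (x - t) - f x) 1 ν := by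
      rw [e1, eLpNorm_one_eq_lintegral_enorm,
        lintegral_withDensity_eq_lintegral_mul _ hφm hFx.enorm]
      refine (enorm_integral_le_lintegral_enorm _).trans (le_of_eq ?_)
      congr 1
      ext t
      rw [enorm_mul, Pi.mul_apply, Real.enorm_of_nonneg (mollifier_nonneg n t)]
    have e3 := e2.trans (eLpNorm_le_eLpNorm_of_exponent_le (p := 1) (q := 2) (by norm_num)
      hFx.aestronglyMeasurable)
    calc ‖mollify n f x - f x‖ₑ ^ 2 ≤ (eLpNorm (fun t => f (x - t) - f x) 2 ν) ^ 2 := by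
          gcongr
      _ = ∫⁻ t, ‖f (x - t) - f x‖ₑ ^ 2 ∂ν := by
          have := eLpNorm_nnreal_pow_eq_lintegral (μ := ν) (f := fun t => f (x - t) - f x)
            (p := 2) (by norm_num)
          simpa using this
      _ = _ := by
          rw [lintegral_withDensity_eq_lintegral_mul _ hφm (hFx.enorm.pow_const 2)]
          rfl
  calc ∫⁻ x, ‖mollify n f x - f x‖ₑ ^ 2
      ≤ ∫⁻ x, ∫⁻ t, ENNReal.ofReal (mollifier d n t) * ‖f (x - t) - f x‖ₑ ^ 2 :=
        lintegral_mono key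
    _ = ∫⁻ t, ∫⁻ x, ENNReal.ofReal (mollifier d n t) * ‖f (x - t) - f x‖ₑ ^ 2 := by
        apply lintegral_lintegral_swap
        exact ((hφm.comp measurable_snd).mul (hF.pow_const 2)).aemeasurable
    _ = _ := by
        congr 1
        ext t
        refine lintegral_const_mul _ (Measurable.pow_const ?_ 2)
        exact hF.comp (measurable_id.prodMk measurable_const)

/-- Translations act continuously on `L²`, which is transferred here to functions. -/
lemma tendsto_eLpNorm_translate_sub {f : Sp d → ℝ} (hf : MemLp f 2) :
    Tendsto (fun t : Sp d => eLpNorm (fun x => f (x - t) - f x) 2) (𝓝 0) (𝓝 0) := by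
  let g : Sp d → C(Sp d, Sp d) := fun t => ⟨fun x => x - t, by fun_prop⟩
  have hg : Continuous g := by
    apply ContinuousMap.continuous_of_continuous_uncurry
    show Continuous fun z : Sp d × Sp d => z.2 - z.1
    fun_prop
  have hgm : ∀ t, MeasurePreserving (g t) (volume : Measure (Sp d)) volume := fun t =>
    measurePreserving_sub_right volume t
  have h := (continuous_const (y := hf.toLp f)).compMeasurePreservingLp hg hgm (by norm_num)
  have h0 := h.tendsto 0
  rw [tendsto_iff_edist_tendsto_0] at h0
  refine h0.congr fun t => ?_
  rw [Lp.edist_def]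
  apply eLpNorm_congr_ae
  have h1 := Lp.coeFn_compMeasurePreserving (hf.toLp f) (hgm t)
  have h2 := Lp.coeFn_compMeasurePreserving (hf.toLp f) (hgm 0)
  have h3 : ∀ᵐ x : Sp d, hf.toLp f (x - t) = f (x - t) :=
    (hgm t).quasiMeasurePreserving.ae hf.coeFn_toLp
  filter_upwards [h1, h2, h3, hf.coeFn_toLp] with x e1 e2 e3 e4
  simp only [Pi.sub_apply]
  rw [e1, e2]
  simp [g, Function.comp, e3, e4]

/-- The mollifications converge in `L²`: by Jensen's inequality the error is at most the average of
the `L²` errors of the translations by vectors in the support of the mollifier. -/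
lemma tendsto_mollify {f : Sp d → ℝ} (hf : MemLp f 2) :
    Tendsto (fun n => eLpNorm (mollify n f - f) 2) atTop (𝓝 0) := by
  rw [ENNReal.tendsto_nhds_zero]
  intro ε hε
  have h := (ENNReal.tendsto_nhds_zero.1 (tendsto_eLpNorm_translate_sub hf)) ε hε
  obtain ⟨r, hr, hball⟩ := Metric.eventually_nhds_iff.1 h
  filter_upwards [eventually_gt_atTop (Nat.ceil (1 / r))] with n hn
  have hn' : 1 / ((n : ℝ) + 1) < r := by
    have : 1 / r < n := (Nat.le_ceil _).trans_lt (by exact_mod_cast hn)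
    rw [div_lt_iff₀ (by positivity)]
    rw [div_lt_iff₀ hr] at this
    nlinarith
  have e : eLpNorm (mollify n f - f) 2 volume ^ 2 = ∫⁻ x, ‖mollify n f x - f x‖ₑ ^ 2 := by
    have := eLpNorm_nnreal_pow_eq_lintegral (μ := volume) (f := mollify n f - f)
            (p := 2) (by norm_num)
    simpa using this
  have : eLpNorm (mollify n f - f) 2 volume ^ 2 ≤ ε ^ 2 := by
    rw [e]
    refine (lintegral_mollify_sub_sq_le n hf).trans ?_
    calc ∫⁻ t, ENNReal.ofReal (mollifier d n t) * ∫⁻ x, ‖f (x - t) - f x‖ₑ ^ 2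
        ≤ ∫⁻ t, ENNReal.ofReal (mollifier d n t) * ε ^ 2 := by
          apply lintegral_mono
          intro t
          by_cases ht : 1 / ((n : ℝ) + 1) ≤ ‖t‖
          · simp [mollifier_eq_zero n ht]
          · push Not at ht
            dsimp only
            gcongr
            have h1 := eLpNorm_nnreal_pow_eq_lintegral (μ := volume)
              (f := fun x => f (x - t) - f x) (p := 2) (by norm_num)
            have h2 : ∫⁻ x, ‖f (x - t) - f x‖ₑ ^ 2
                = eLpNorm (fun x => f (x - t) - f x) 2 volume ^ 2 := by simpa using h1.symm
            rw [h2]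
            gcongr
            exact hball (by simpa using ht.trans hn')
      _ = ε ^ 2 := by
          rw [lintegral_mul_const _
            (mollifier_contDiff n).continuous.measurable.ennreal_ofReal, lintegral_mollifier,
            one_mul]
  exact (ENNReal.pow_right_strictMono two_ne_zero).le_iff_le.1 this

/-- The mollification of a function vanishing off a ball vanishes off a slightly larger ball. -/
lemma mollify_eq_zero (n : ℕ) {f : Sp d → ℝ} {R : ℝ}
    (hf : ∀ᵐ x, x ∉ Metric.ball (0 : Sp d) R → f x = 0) {x : Sp d}
    (hx : x ∉ Metric.ball (0 : Sp d) (R + 1)) : mollify n f x = 0 := by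
  rw [mollify_apply]
  apply integral_eq_zero_of_ae
  have h : ∀ᵐ t : Sp d, x - t ∉ Metric.ball (0 : Sp d) R → f (x - t) = 0 :=
    (quasiMeasurePreserving_sub_left volume x).ae hf
  filter_upwards [h] with t ht
  by_cases h1 : 1 / ((n : ℝ) + 1) ≤ ‖t‖
  · simp [mollifier_eq_zero n h1]
  · rw [ht, mul_zero, Pi.zero_apply]
    push Not at h1
    have h2 : 1 / ((n : ℝ) + 1) ≤ 1 := by
      rw [div_le_one (by positivity)]; linarith [(Nat.cast_nonneg n : (0:ℝ) ≤ n)]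
    simp only [Metric.mem_ball, dist_zero_right, not_lt] at hx ⊢
    have := norm_sub_norm_le x t
    linarith

lemma integrable_smul_of_memLp {F : Type*} [NormedAddCommGroup F] [NormedSpace ℝ F]
    {φ : Sp d → ℝ} (hφ : Continuous φ) (hc : HasCompactSupport φ)
    {f : Sp d → F} (hf : MemLp f 2) : Integrable fun x => φ x • f x :=
  (hf.locallyIntegrable (by norm_num)).integrable_smul_left_of_hasCompactSupport hφ hc

lemma continuous_partial {φ : Sp d → ℝ} (hφ : ContDiff ℝ ∞ φ) (i : Fin d) :
    Continuous fun x => fderiv ℝ φ x (EuclideanSpace.single i (1 : ℝ)) :=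
  (hφ.continuous_fderiv (by simp)).clm_apply continuous_const

lemma hasCompactSupport_partial {φ : Sp d → ℝ} (hc : HasCompactSupport φ) (i : Fin d) :
    HasCompactSupport fun x => fderiv ℝ φ x (EuclideanSpace.single i (1 : ℝ)) :=
  hc.fderiv_apply ℝ _

lemma tsupport_partial_subset {φ : Sp d → ℝ} (i : Fin d) :
    tsupport (fun x => fderiv ℝ φ x (EuclideanSpace.single i (1 : ℝ))) ⊆ tsupport φ :=
  tsupport_fderiv_apply_subset ℝ _

lemma contDiff_partial {φ : Sp d → ℝ} (hφ : ContDiff ℝ ∞ φ) (i : Fin d) :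
    ContDiff ℝ ∞ fun x => fderiv ℝ φ x (EuclideanSpace.single i (1 : ℝ)) :=
  (hφ.fderiv_right (m := ∞) (by simp)).clm_apply contDiff_const

/-- Mollification commutes with weak derivatives. -/
lemma partial_mollify (n : ℕ) {i : Fin d} {f g : Sp d → ℝ} (hf : MemLp f 2)
    (h : HasWeakPartial univ i f g) (x : Sp d) :
    fderiv ℝ (mollify n f) x (EuclideanSpace.single i (1 : ℝ)) = mollify n g x := by
  have hfl : LocallyIntegrable f := hf.locallyIntegrable (by norm_num)
  have hd := (mollifier_hasCompactSupport n).hasFDerivAt_convolution_left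
    (ContinuousLinearMap.lsmul ℝ ℝ) ((mollifier_contDiff (d := d) n).of_le (by simp)) hfl x
  have h1 := hd.fderiv
  unfold mollify
  rw [h1]
  have hex := ((mollifier_hasCompactSupport (d := d) n).fderiv (𝕜 := ℝ)).convolutionExists_left
    ((ContinuousLinearMap.lsmul ℝ ℝ).precompL (Sp d))
    ((mollifier_contDiff n).continuous_fderiv (by simp)) hfl x
  rw [convolution_def, ContinuousLinearMap.integral_apply hex, convolution_def]
  -- the substitution `t ↦ x - t` turns both convolutions into the two sides of the definition of
  -- the weak derivative, for the test function `y ↦ mollifier d n (x - y)`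
  have e1 := integral_sub_left_eq_self
    (fun t => fderiv ℝ (mollifier d n) t (EuclideanSpace.single i (1 : ℝ)) * f (x - t)) volume x
  have e2 := integral_sub_left_eq_self (fun t => mollifier d n t * g (x - t)) volume x
  have hφ : ContDiff ℝ ∞ fun y : Sp d => mollifier d n (x - y) :=
    (mollifier_contDiff n).comp (contDiff_const.sub contDiff_id)
  have hφc : HasCompactSupport fun y : Sp d => mollifier d n (x - y) :=
    (mollifier_hasCompactSupport n).comp_homeomorph (Homeomorph.subLeft x)
  have h2 := h _ hφ hφc (subset_univ _)
  have hfd : ∀ y, fderiv ℝ (fun y : Sp d => mollifier d n (x - y)) y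
        (EuclideanSpace.single i (1 : ℝ))
      = - fderiv ℝ (mollifier d n) (x - y) (EuclideanSpace.single i (1 : ℝ)) := by
    intro y
    have a := ((mollifier_contDiff (d := d) n).differentiable (by simp) (x - y)).hasFDerivAt
    have b := a.comp y ((hasFDerivAt_id y).const_sub x)
    have c := b.fderiv
    have c' : fderiv ℝ (fun y : Sp d => mollifier d n (x - y)) y = _ := c
    rw [c']
    simp
  simp only [hfd, smul_eq_mul, neg_mul] at h2
  rw [integral_neg, neg_inj] at h2
  simp only [sub_sub_cancel] at e1 e2
  simp only [ContinuousLinearMap.precompL_apply, ContinuousLinearMap.lsmul_apply, smul_eq_mul]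
  rw [← e1, ← e2, h2]

/-! ### Calculus in `H¹(ℝ^d)` and the embedding into `L⁴` -/

/-- `f ∈ H¹(ℝ^d)` for a scalar function `f`, with weak partial derivatives `g i`. -/
structure IsH1 (f : Sp d → ℝ) (g : Fin d → Sp d → ℝ) : Prop where
  memLp : MemLp f 2
  memLp_partial : ∀ i, MemLp (g i) 2
  weak : ∀ i, HasWeakPartial univ i f (g i)

lemma integrable_mul_of_memLp_two {f g : Sp d → ℝ} {μ : Measure (Sp d)}
    (hf : MemLp f 2 μ) (hg : MemLp g 2 μ) : Integrable (fun x => f x * g x) μ :=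
  hf.integrable_mul hg

/-- Convergence in `L²` gives convergence of the pairing with an `L²` function. -/
lemma tendsto_integral_mul_of_tendsto_eLpNorm {f h : Sp d → ℝ} {hn : ℕ → Sp d → ℝ}
    (hf : MemLp f 2) (hh : MemLp h 2) (hm : ∀ n, MemLp (hn n) 2)
    (hlim : Tendsto (fun n => eLpNorm (hn n - h) 2) atTop (𝓝 0)) :
    Tendsto (fun n => ∫ x, f x * hn n x) atTop (𝓝 (∫ x, f x * h x)) := by
  refine tendsto_integral_of_L1' (fun x => f x * h x) (hf.1.mul hh.1)
    (Eventually.of_forall fun n => integrable_mul_of_memLp_two hf (hm n)) ?_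
  refine tendsto_of_tendsto_of_tendsto_of_le_of_le tendsto_const_nhds
    (h := fun n => eLpNorm f 2 volume * eLpNorm (hn n - h) 2) ?_ (fun _ => zero_le) ?_
  · simpa using ENNReal.Tendsto.const_mul hlim (Or.inr hf.2.ne)
  · intro n
    have := eLpNorm_smul_le_mul_eLpNorm (p := 2) (q := 2) (r := 1) ((hm n).1.sub hh.1) hf.1
    refine (le_of_eq ?_).trans this
    apply eLpNorm_congr_ae
    filter_upwards with x
    simp [mul_sub]

lemma sq_eLpNorm_two {f : Sp d → ℝ} {μ : Measure (Sp d)} :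
    eLpNorm f 2 μ ^ 2 = ∫⁻ x, ‖f x‖ₑ ^ 2 ∂μ := by
  have := eLpNorm_nnreal_pow_eq_lintegral (μ := μ) (f := f) (p := 2) (by norm_num)
  simpa using this

/-- The difference `mollify n f - f` is in `L²` by the estimate for averages of translates. -/
lemma memLp_mollify (n : ℕ) {f : Sp d → ℝ} (hf : MemLp f 2) : MemLp (mollify n f) 2 := by
  have hm : AEStronglyMeasurable (mollify n f) volume :=
    (mollify_contDiff n (hf.locallyIntegrable (by norm_num))).continuous.aestronglyMeasurable
  have h1 : MemLp (fun x => mollify n f x - f x) 2 := by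
    refine ⟨hm.sub hf.1, ?_⟩
    have h2 : eLpNorm (fun x => mollify n f x - f x) 2 volume ^ 2 < ⊤ := by
      rw [sq_eLpNorm_two]
      refine (lintegral_mollify_sub_sq_le n hf).trans_lt ?_
      calc ∫⁻ t, ENNReal.ofReal (mollifier d n t) * ∫⁻ x, ‖f (x - t) - f x‖ₑ ^ 2
          ≤ ∫⁻ t, ENNReal.ofReal (mollifier d n t) *
              (eLpNorm f 2 volume + eLpNorm f 2 volume) ^ 2 := by
            apply lintegral_mono
            intro t
            dsimp only
            gcongr
            rw [← sq_eLpNorm_two (f := fun x => f (x - t) - f x)]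
            gcongr
            refine (eLpNorm_sub_le (memLp_comp_sub hf t).1 hf.1 (by norm_num)).trans ?_
            gcongr
            exact (eLpNorm_comp_measurePreserving hf.1
              (measurePreserving_sub_right volume t)).le
        _ = (eLpNorm f 2 volume + eLpNorm f 2 volume) ^ 2 := by
            rw [lintegral_mul_const _
              (mollifier_contDiff n).continuous.measurable.ennreal_ofReal, lintegral_mollifier,
              one_mul]
        _ < ⊤ := ENNReal.pow_lt_top (ENNReal.add_lt_top.2 ⟨hf.2, hf.2⟩)
    by_contra h
    rw [not_lt, top_le_iff] at h
    simp [h] at h2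
  have h3 := h1.add hf
  have e : (fun x => mollify n f x - f x) + f = mollify n f := by ext x; simp
  rwa [e] at h3

lemma hasCompactSupport_of_eq_zero_off_ball {F : Type*} [Zero F] {f : Sp d → F} {R : ℝ}
    (hf : ∀ x, x ∉ Metric.ball (0 : Sp d) R → f x = 0) : HasCompactSupport f :=
  HasCompactSupport.of_support_subset_isCompact (isCompact_closedBall (0 : Sp d) R) fun x hx => by
    by_contra h
    exact hx (hf x fun h' => h (Metric.ball_subset_closedBall h'))

/-- Integration by parts for two functions in `H¹(ℝ^d)`, the first of bounded support:
its mollifications are test functions for the weak derivative of the second. -/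
lemma IsH1.integral_mul_partial {f f' : Sp d → ℝ} {g g' : Fin d → Sp d → ℝ} (h : IsH1 f g)
    (h' : IsH1 f' g') {R : ℝ} (hR : ∀ᵐ x, x ∉ Metric.ball (0 : Sp d) R → f x = 0) (i : Fin d) :
    ∫ x, f x * g' i x = - ∫ x, g i x * f' x := by
  have e : ∀ n, ∫ x, f' x * mollify n (g i) x = - ∫ x, g' i x * mollify n f x := by
    intro n
    have := h'.weak i (mollify n f) (mollify_contDiff n (h.memLp.locallyIntegrable (by norm_num)))
      (hasCompactSupport_of_eq_zero_off_ball fun x => mollify_eq_zero n hR) (subset_univ _)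
    simp only [partial_mollify n h.memLp (h.weak i), smul_eq_mul] at this
    simp_rw [mul_comm (f' _), mul_comm (g' i _)]
    exact this
  have l1 := tendsto_integral_mul_of_tendsto_eLpNorm h'.memLp (h.memLp_partial i)
    (fun n => memLp_mollify n (h.memLp_partial i)) (tendsto_mollify (h.memLp_partial i))
  have l2 := tendsto_integral_mul_of_tendsto_eLpNorm (h'.memLp_partial i) h.memLp
    (fun n => memLp_mollify n h.memLp) (tendsto_mollify h.memLp)
  simp_rw [e] at l1
  have := tendsto_nhds_unique l1 l2.neg
  simp_rw [mul_comm (f _), mul_comm (g i _), this, neg_neg]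

lemma memLp_smooth_mul {φ : Sp d → ℝ} (hφ : Continuous φ) (hc : HasCompactSupport φ)
    {f : Sp d → ℝ} {p : ℝ≥0∞} {μ : Measure (Sp d)} (hf : MemLp f p μ) :
    MemLp (fun x => φ x * f x) p μ := by
  obtain ⟨C, hC⟩ := hc.exists_bound_of_continuous hφ
  exact MemLp.of_le_mul (c := C) hf (hφ.aestronglyMeasurable.mul hf.1)
    (Eventually.of_forall fun x => by
      rw [norm_mul]; gcongr; exact hC x)

lemma fderiv_mul_apply' {φ ψ : Sp d → ℝ} (hφ : ContDiff ℝ ∞ φ) (hψ : ContDiff ℝ ∞ ψ)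
    (x v : Sp d) : fderiv ℝ (fun y => φ y * ψ y) x v
      = φ x * fderiv ℝ ψ x v + ψ x * fderiv ℝ φ x v := by
  rw [fderiv_fun_mul (hφ.differentiable (by simp) x) (hψ.differentiable (by simp) x)]
  simp

/-- Multiplication by a test function preserves `H¹`. -/
lemma IsH1.smooth_mul {φ : Sp d → ℝ} (hφ : ContDiff ℝ ∞ φ) (hc : HasCompactSupport φ)
    {f : Sp d → ℝ} {g : Fin d → Sp d → ℝ} (h : IsH1 f g) :
    IsH1 (fun x => φ x * f x) (fun i x => φ x * g i x +
      fderiv ℝ φ x (EuclideanSpace.single i (1 : ℝ)) * f x) where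
  memLp := memLp_smooth_mul hφ.continuous hc h.memLp
  memLp_partial i := (memLp_smooth_mul hφ.continuous hc (h.memLp_partial i)).add
    (memLp_smooth_mul (continuous_partial hφ i) (hasCompactSupport_partial hc i) h.memLp)
  weak i ψ hψ hψc _ := by
    have := h.weak i (fun x => φ x * ψ x) (hφ.mul hψ) hc.mul_right (subset_univ _)
    simp only [fderiv_mul_apply' hφ hψ, smul_eq_mul] at this ⊢
    have i1 := integrable_smul_of_memLp (continuous_partial hψ i) (hasCompactSupport_partial hψc i)
      (memLp_smooth_mul hφ.continuous hc h.memLp)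
    have i2 := integrable_smul_of_memLp hψ.continuous hψc
      (memLp_smooth_mul (continuous_partial hφ i) (hasCompactSupport_partial hc i) h.memLp)
    have i3 := integrable_smul_of_memLp hψ.continuous hψc
      (memLp_smooth_mul hφ.continuous hc (h.memLp_partial i))
    simp only [smul_eq_mul] at i1 i2 i3
    have e1 : ∫ x, (φ x * fderiv ℝ ψ x (EuclideanSpace.single i (1 : ℝ))
        + ψ x * fderiv ℝ φ x (EuclideanSpace.single i (1 : ℝ))) * f x
        = (∫ x, fderiv ℝ ψ x (EuclideanSpace.single i (1 : ℝ)) * (φ x * f x))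
        + ∫ x, ψ x * (fderiv ℝ φ x (EuclideanSpace.single i (1 : ℝ)) * f x) := by
      rw [← integral_add i1 i2]
      congr 1; ext x; ring
    have e2 : ∫ x, ψ x * (φ x * g i x + fderiv ℝ φ x (EuclideanSpace.single i (1 : ℝ)) * f x)
        = (∫ x, ψ x * (φ x * g i x))
        + ∫ x, ψ x * (fderiv ℝ φ x (EuclideanSpace.single i (1 : ℝ)) * f x) := by
      rw [← integral_add i3 i2]
      congr 1; ext x; ring
    have e3 : ∫ x, φ x * ψ x * g i x = ∫ x, ψ x * (φ x * g i x) := by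
      congr 1; ext x; ring
    rw [e1, e3] at this
    rw [e2]
    linarith

/-- The product rule for two functions in `H¹(ℝ^d)` for which the product and the candidate for
its gradient are in `L²`. -/
lemma IsH1.mul {f f' : Sp d → ℝ} {g g' : Fin d → Sp d → ℝ} (h : IsH1 f g)
    (h' : IsH1 f' g') (hm : MemLp (fun x => f x * f' x) 2)
    (hm' : ∀ i, MemLp (fun x => f x * g' i x + g i x * f' x) 2) :
    IsH1 (fun x => f x * f' x) (fun i x => f x * g' i x + g i x * f' x) where
  memLp := hm
  memLp_partial := hm'
  weak i φ hφ hc _ := by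
    have hφf := h.smooth_mul hφ hc
    obtain ⟨R, hR⟩ := hc.isCompact.isBounded.subset_ball (0 : Sp d)
    have := hφf.integral_mul_partial h' (R := R) (Eventually.of_forall fun x hx => by
      rw [image_eq_zero_of_notMem_tsupport fun hx' => hx (hR hx'), zero_mul]) i
    have i1 : Integrable fun x => φ x * (f x * g' i x) := by
      simpa only [mul_assoc] using integrable_mul_of_memLp_two hφf.memLp (h'.memLp_partial i)
    have i2 : Integrable fun x => φ x * (g i x * f' x) := by
      simpa only [mul_assoc] using integrable_mul_of_memLp_two
        (memLp_smooth_mul hφ.continuous hc (h.memLp_partial i)) h'.memLp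
    have i3 : Integrable fun x =>
        fderiv ℝ φ x (EuclideanSpace.single i (1 : ℝ)) * (f x * f' x) := by
      simpa only [mul_assoc] using integrable_mul_of_memLp_two
        (memLp_smooth_mul (continuous_partial hφ i) (hasCompactSupport_partial hc i) h.memLp)
        h'.memLp
    simp only [smul_eq_mul, mul_add, add_mul, mul_assoc] at this ⊢
    rw [integral_add i2 i3] at this
    rw [integral_add i1 i2]
    linarith

/-- A bound on an `L^p` norm passes to `L²` limits, by Fatou's lemma along a subsequence that
converges almost everywhere. -/
lemma eLpNorm_le_of_tendsto {f : Sp d → ℝ} {fn : ℕ → Sp d → ℝ} (hf : MemLp f 2)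
    (hfn : ∀ n, MemLp (fn n) 2) (hlim : Tendsto (fun n => eLpNorm (fn n - f) 2) atTop (𝓝 0))
    {p : ℝ≥0∞} {b : ℕ → ℝ≥0∞} {c : ℝ≥0∞} (hb : ∀ n, eLpNorm (fn n) p ≤ b n)
    (hbc : Tendsto b atTop (𝓝 c)) : eLpNorm f p ≤ c := by
  obtain ⟨ns, hns, hae⟩ := (tendstoInMeasure_of_tendsto_eLpNorm two_ne_zero
    (fun n => (hfn n).1) hf.1 hlim).exists_seq_tendsto_ae
  refine (Lp.eLpNorm_lim_le_liminf_eLpNorm (fun n => (hfn (ns n)).1) f hae).trans ?_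
  rw [← (hbc.comp hns.tendsto_atTop).liminf_eq]
  exact liminf_le_liminf (Eventually.of_forall fun n => hb (ns n))

lemma tendsto_eLpNorm_of_tendsto {f : Sp d → ℝ} {fn : ℕ → Sp d → ℝ} (hf : MemLp f 2)
    (hfn : ∀ n, MemLp (fn n) 2) (hlim : Tendsto (fun n => eLpNorm (fn n - f) 2) atTop (𝓝 0)) :
    Tendsto (fun n => eLpNorm (fn n) 2) atTop (𝓝 (eLpNorm f 2)) := by
  have h := (Lp.tendsto_Lp_iff_tendsto_eLpNorm'' fn hfn f hf).2 hlim
  have h2 := ((continuous_enorm.tendsto _).comp h)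
  refine (h2.congr fun n => ?_).trans (le_of_eq ?_)
  · simp [Lp.enorm_def, eLpNorm_congr_ae (hfn n).coeFn_toLp]
  · simp [Lp.enorm_def, eLpNorm_congr_ae hf.coeFn_toLp]

lemma norm_fderiv_le_sum (φ : Sp d → ℝ) (x : Sp d) :
    ‖fderiv ℝ φ x‖ ≤ ∑ i, ‖fderiv ℝ φ x (EuclideanSpace.single i (1 : ℝ))‖ := by
  refine ContinuousLinearMap.opNorm_le_bound _ (by positivity) fun v => ?_
  have hv : v = ∑ i, v i • EuclideanSpace.single i (1 : ℝ) := by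
    ext j
    simp [Finset.sum_apply, Pi.single_apply]
  conv_lhs => rw [hv]
  rw [map_sum, Finset.sum_mul]
  refine (norm_sum_le _ _).trans (Finset.sum_le_sum fun i _ => ?_)
  rw [map_smul, norm_smul, mul_comm]
  gcongr
  exact PiLp.norm_apply_le v i

lemma eLpNorm_fderiv_le_sum {φ : Sp d → ℝ} (hφ : ContDiff ℝ ∞ φ) :
    eLpNorm (fderiv ℝ φ) 2 ≤
      ∑ i, eLpNorm (fun x => fderiv ℝ φ x (EuclideanSpace.single i (1 : ℝ))) 2 := by
  have h1 : eLpNorm (fderiv ℝ φ) 2 ≤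
      eLpNorm (fun x => ∑ i, ‖fderiv ℝ φ x (EuclideanSpace.single i (1 : ℝ))‖) 2 :=
    eLpNorm_mono_real (norm_fderiv_le_sum φ)
  have h2 := eLpNorm_sum_le (μ := (volume : Measure (Sp d))) (p := 2) (s := Finset.univ)
    (f := fun i x => ‖fderiv ℝ φ x (EuclideanSpace.single i (1 : ℝ))‖)
    (fun i _ => (continuous_partial hφ i).norm.aestronglyMeasurable) (by norm_num)
  have e : (∑ i, fun x => ‖fderiv ℝ φ x (EuclideanSpace.single i (1 : ℝ))‖)
      = fun x => ∑ i, ‖fderiv ℝ φ x (EuclideanSpace.single i (1 : ℝ))‖ := by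
    ext x; simp
  rw [e] at h2
  refine h1.trans (h2.trans (le_of_eq ?_))
  congr 1
  ext i
  exact eLpNorm_norm _

/-- The Gagliardo-Nirenberg-Sobolev inequality `‖φ‖_{L⁴} ≤ C ‖∇φ‖_{L²}` for smooth functions
supported in a ball. The inequality of Mathlib needs an exponent `p < d` with
`1 / p - 1 / d ≤ 1 / 4`, which excludes `p = 2` for `d = 2`. The choice `p = 12 / 7` serves for both
`d = 2` and `d = 3`, and is followed by Hölder's inequality on the ball. -/
lemma exists_eLpNorm_four_le_fderiv (hd : d = 2 ∨ d = 3) (R : ℝ) : ∃ C : ℝ≥0∞, C ≠ ⊤ ∧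
    ∀ φ : Sp d → ℝ, ContDiff ℝ ∞ φ → (∀ x, x ∉ Metric.ball (0 : Sp d) R → φ x = 0) →
    eLpNorm φ 4 ≤ C * eLpNorm (fderiv ℝ φ) 2 := by
  obtain ⟨p, hp⟩ : ∃ p : NNReal, p = 12 / 7 := ⟨_, rfl⟩
  have hp1 : 1 ≤ p := by rw [hp, le_div_iff₀ (by norm_num)]; norm_num
  have hfin : Module.finrank ℝ (Sp d) = d := by simp
  have hpd : p < Module.finrank ℝ (Sp d) := by
    rw [hfin, hp, div_lt_iff₀ (by norm_num)]
    rcases hd with rfl | rfl <;> norm_num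
  have hpq : (p : ℝ)⁻¹ - (Module.finrank ℝ (Sp d) : ℝ)⁻¹ ≤ ((4 : NNReal) : ℝ)⁻¹ := by
    rw [hfin, hp]
    rcases hd with rfl | rfl <;> norm_num
  have hp2 : (p : ℝ≥0∞) ≤ 2 := by
    have : p ≤ 2 := by rw [hp, div_le_iff₀ (by norm_num)]; norm_num
    exact_mod_cast this
  refine ⟨eLpNormLESNormFDerivOfLeConst ℝ (volume : Measure (Sp d)) (Metric.ball (0 : Sp d) R) p 4
    * (volume (Metric.closedBall (0 : Sp d) R)) ^
      (1 / (p : ℝ≥0∞).toReal - 1 / (2 : ℝ≥0∞).toReal), ?_, fun φ hφ hR => ?_⟩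
  · refine ENNReal.mul_ne_top ENNReal.coe_ne_top (ENNReal.rpow_ne_top_of_nonneg ?_
      measure_closedBall_lt_top.ne)
    rw [sub_nonneg]
    simp only [hp]
    norm_num
  · have h1 := eLpNorm_le_eLpNorm_fderiv_of_le (volume : Measure (Sp d)) (u := φ)
      (s := Metric.ball (0 : Sp d) R) (p := p) (q := 4) (hφ.of_le (by simp))
      (fun x hx => by by_contra h; exact hx (hR x h)) hp1 hpd hpq Metric.isBounded_ball
    have hfs : Function.support (fderiv ℝ φ) ⊆ Metric.closedBall (0 : Sp d) R := by
      refine (support_fderiv_subset ℝ).trans ?_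
      refine closure_minimal (fun x hx => ?_) Metric.isClosed_closedBall
      by_contra h
      exact hx (hR x fun h' => h (Metric.ball_subset_closedBall h'))
    have hfr : ∀ q, eLpNorm (fderiv ℝ φ) q (volume.restrict (Metric.closedBall (0 : Sp d) R))
        = eLpNorm (fderiv ℝ φ) q := fun q =>
      eLpNorm_restrict_eq_of_support_subset (f := fderiv ℝ φ) hfs
    have h2 := eLpNorm_le_eLpNorm_mul_rpow_measure_univ hp2
        (hφ.continuous_fderiv (by simp)).aestronglyMeasurable
        (μ := volume.restrict (Metric.closedBall (0 : Sp d) R))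
    rw [hfr, hfr, Measure.restrict_apply_univ] at h2
    rw [mul_assoc, mul_comm ((volume _) ^ (_ : ℝ))]
    exact h1.trans (mul_le_mul_right h2 _)

/-- The Gagliardo-Nirenberg-Sobolev inequality `‖f‖_{L⁴} ≤ C ‖∇f‖_{L²}` for functions in
`H¹(ℝ^d)` that vanish off a ball. -/
lemma exists_eLpNorm_four_le (hd : d = 2 ∨ d = 3) (R : ℝ) : ∃ C : ℝ≥0∞, C ≠ ⊤ ∧
    ∀ (f : Sp d → ℝ) (g : Fin d → Sp d → ℝ), IsH1 f g →
    (∀ᵐ x, x ∉ Metric.ball (0 : Sp d) R → f x = 0) →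
    eLpNorm f 4 ≤ C * ∑ i, eLpNorm (g i) 2 := by
  obtain ⟨C, hC, h⟩ := exists_eLpNorm_four_le_fderiv hd (R + 1)
  refine ⟨C, hC, fun f g hfg hR => ?_⟩
  have hfl := hfg.memLp.locallyIntegrable (by norm_num : (1 : ℝ≥0∞) ≤ 2)
  have key : ∀ n, eLpNorm (mollify n f) 4 ≤ C * ∑ i, eLpNorm (mollify n (g i)) 2 := by
    intro n
    have hcd := mollify_contDiff n hfl
    have h3 := eLpNorm_fderiv_le_sum hcd
    simp only [partial_mollify n hfg.memLp (hfg.weak _)] at h3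
    exact (h _ hcd fun x => mollify_eq_zero n hR).trans (mul_le_mul_right h3 _)
  refine eLpNorm_le_of_tendsto hfg.memLp (fun n => memLp_mollify n hfg.memLp)
    (tendsto_mollify hfg.memLp) key ?_
  refine ENNReal.Tendsto.const_mul ?_ (Or.inr hC)
  exact tendsto_finsetSum _ fun i _ => tendsto_eLpNorm_of_tendsto (hfg.memLp_partial i)
    (fun n => memLp_mollify n (hfg.memLp_partial i)) (tendsto_mollify (hfg.memLp_partial i))

/-! ### Rules for weak derivatives -/

section WeakPartial

variable {F : Type*} [NormedAddCommGroup F] [NormedSpace ℝ F]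

lemma integrable_smul_of_memLp_restrict {Ω : Set (Sp d)} (hΩ : IsOpen Ω) {φ : Sp d → ℝ}
    (hφ : Continuous φ) (hc : HasCompactSupport φ) (hs : tsupport φ ⊆ Ω) {f : Sp d → F}
    (hf : MemLp f 2 (volume.restrict Ω)) : Integrable fun x => φ x • f x := by
  have h0 : MemLp (Ω.indicator f) 2 volume := (memLp_indicator_iff_restrict hΩ.measurableSet).2 hf
  have h := integrable_smul_of_memLp hφ hc h0
  refine h.congr (Eventually.of_forall fun x => ?_)
  by_cases hx : x ∈ Ω
  · simp [hx]
  · simp [image_eq_zero_of_notMem_tsupport fun h => hx (hs h)]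

lemma HasWeakPartial.mono {Ω Ω' : Set (Sp d)} {i : Fin d} {u g : Sp d → F}
    (h : HasWeakPartial Ω' i u g) (hs : Ω ⊆ Ω') : HasWeakPartial Ω i u g :=
  fun φ h1 h2 h3 => h φ h1 h2 (h3.trans hs)

/-- Weak derivatives on `Ω` depend only on the values in `Ω`. -/
lemma HasWeakPartial.congr {Ω : Set (Sp d)} (hΩ : IsOpen Ω) {i : Fin d} {u g u' g' : Sp d → F}
    (h : HasWeakPartial Ω i u g) (hu : u =ᵐ[volume.restrict Ω] u')
    (hg : g =ᵐ[volume.restrict Ω] g') : HasWeakPartial Ω i u' g' := by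
  intro φ h1 h2 h3
  have aux : ∀ {ψ : Sp d → ℝ} {f f' : Sp d → F}, tsupport ψ ⊆ Ω → f =ᵐ[volume.restrict Ω] f' →
      ∫ x, ψ x • f' x = ∫ x, ψ x • f x := by
    intro ψ f f' hψ hf
    apply integral_congr_ae
    filter_upwards [(ae_restrict_iff' hΩ.measurableSet).1 hf] with x hx
    by_cases hxΩ : x ∈ Ω
    · rw [hx hxΩ]
    · simp [image_eq_zero_of_notMem_tsupport fun h => hxΩ (hψ h)]
  rw [aux ((tsupport_partial_subset i).trans h3) hu, aux h3 hg]
  exact h φ h1 h2 h3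

/-- Uniqueness of weak derivatives. -/
lemma HasWeakPartial.ae_unique [CompleteSpace F] {Ω : Set (Sp d)} (hΩ : IsOpen Ω) {i : Fin d}
    {u g g' : Sp d → F} (h : HasWeakPartial Ω i u g) (h' : HasWeakPartial Ω i u g')
    (hg : MemLp g 2 (volume.restrict Ω)) (hg' : MemLp g' 2 (volume.restrict Ω)) :
    g =ᵐ[volume.restrict Ω] g' := by
  have hl : LocallyIntegrableOn (fun x => g x - g' x) Ω :=
    locallyIntegrableOn_of_locallyIntegrable_restrict
      ((hg.sub hg').locallyIntegrable (by norm_num))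
  have := hΩ.ae_eq_zero_of_integral_contDiff_smul_eq_zero hl fun φ h1 h2 h3 => by
    simp_rw [smul_sub]
    rw [integral_sub (integrable_smul_of_memLp_restrict hΩ h1.continuous h2 h3 hg)
      (integrable_smul_of_memLp_restrict hΩ h1.continuous h2 h3 hg'), sub_eq_zero]
    have e := h φ h1 h2 h3
    rw [h' φ h1 h2 h3] at e
    exact neg_injective e.symm
  rw [Filter.EventuallyEq, ae_restrict_iff' hΩ.measurableSet]
  filter_upwards [this] with x hx hxΩ
  exact sub_eq_zero.1 (hx hxΩ)

lemma HasWeakPartial.add {Ω : Set (Sp d)} (hΩ : IsOpen Ω) {i : Fin d} {u g u' g' : Sp d → F}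
    (h : HasWeakPartial Ω i u g) (h' : HasWeakPartial Ω i u' g')
    (hu : MemLp u 2 (volume.restrict Ω)) (hu' : MemLp u' 2 (volume.restrict Ω))
    (hg : MemLp g 2 (volume.restrict Ω)) (hg' : MemLp g' 2 (volume.restrict Ω)) :
    HasWeakPartial Ω i (fun x => u x + u' x) (fun x => g x + g' x) := by
  intro φ h1 h2 h3
  have c := continuous_partial h1 i
  have k := hasCompactSupport_partial h2 i
  have s := (tsupport_partial_subset (φ := φ) i).trans h3
  simp_rw [smul_add]
  rw [integral_add (integrable_smul_of_memLp_restrict hΩ c k s hu)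
    (integrable_smul_of_memLp_restrict hΩ c k s hu'),
    integral_add (integrable_smul_of_memLp_restrict hΩ h1.continuous h2 h3 hg)
    (integrable_smul_of_memLp_restrict hΩ h1.continuous h2 h3 hg'),
    h φ h1 h2 h3, h' φ h1 h2 h3, neg_add]

lemma HasWeakPartial.const_smul {Ω : Set (Sp d)} {i : Fin d} {u g : Sp d → F}
    (h : HasWeakPartial Ω i u g) (c : ℝ) :
    HasWeakPartial Ω i (fun x => c • u x) (fun x => c • g x) := by
  intro φ h1 h2 h3
  have := h φ h1 h2 h3
  simp_rw [smul_comm _ c]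
  rw [integral_smul, integral_smul, this, smul_neg]

/-- The components of a weak derivative are the weak derivatives of the components. -/
lemma HasWeakPartial.comp {Ω : Set (Sp d)} (hΩ : IsOpen Ω) {i : Fin d} {u g : Sp d → Sp d}
    (h : HasWeakPartial Ω i u g) (hu : MemLp u 2 (volume.restrict Ω))
    (hg : MemLp g 2 (volume.restrict Ω)) (k : Fin d) :
    HasWeakPartial Ω i (fun x => u x k) (fun x => g x k) := by
  intro φ h1 h2 h3
  have c := continuous_partial h1 i
  have kk := hasCompactSupport_partial h2 i
  have s := (tsupport_partial_subset (φ := φ) i).trans h3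
  have e1 := ((EuclideanSpace.proj k : Sp d →L[ℝ] ℝ)).integral_comp_comm
    (integrable_smul_of_memLp_restrict hΩ c kk s hu)
  have e2 := ((EuclideanSpace.proj k : Sp d →L[ℝ] ℝ)).integral_comp_comm
    (integrable_smul_of_memLp_restrict hΩ h1.continuous h2 h3 hg)
  simp only [PiLp.proj_apply, PiLp.smul_apply] at e1 e2
  rw [e1, e2, h φ h1 h2 h3]
  simp

end WeakPartial

/-! ### Weak derivatives on level sets -/

lemma tendsto_integral_mul_of_tendsto {a b : Sp d → ℝ} {an bn : ℕ → Sp d → ℝ}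
    (ha : MemLp a 2) (hb : MemLp b 2) (han : ∀ n, MemLp (an n) 2) (hbn : ∀ n, MemLp (bn n) 2)
    (hla : Tendsto (fun n => eLpNorm (an n - a) 2) atTop (𝓝 0))
    (hlb : Tendsto (fun n => eLpNorm (bn n - b) 2) atTop (𝓝 0)) :
    Tendsto (fun n => ∫ x, an n x * bn n x) atTop (𝓝 (∫ x, a x * b x)) := by
  have h1 := (Lp.tendsto_Lp_iff_tendsto_eLpNorm'' an han a ha).2 hla
  have h2 := (Lp.tendsto_Lp_iff_tendsto_eLpNorm'' bn hbn b hb).2 hlb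
  have key : ∀ {f g : Sp d → ℝ} (hf : MemLp f 2) (hg : MemLp g 2),
      ⟪hf.toLp f, hg.toLp g⟫ = ∫ x, f x * g x := by
    intro f g hf hg
    rw [L2.inner_def]
    apply integral_congr_ae
    filter_upwards [hf.coeFn_toLp, hg.coeFn_toLp] with x e1 e2
    rw [e1, e2]
    simp [mul_comm]
  have h3 := h1.inner (𝕜 := ℝ) h2
  simp only [key] at h3
  exact h3

/-- The derivative of `s ↦ arctan (k s) / k`. -/
lemma hasDerivAt_arctan_scaled {k : ℝ} (hk : 0 < k) (s : ℝ) :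
    HasDerivAt (fun s => Real.arctan (k * s) / k) (1 / (1 + (k * s) ^ 2)) s := by
  have h := (((hasDerivAt_id s).const_mul k).arctan).div_const k
  refine h.congr_deriv ?_
  rw [div_eq_iff hk.ne']
  simp

lemma abs_arctan_scaled_sub_le {k : ℝ} (hk : 0 < k) (a b : ℝ) :
    |Real.arctan (k * a) / k - Real.arctan (k * b) / k| ≤ |a - b| := by
  have h := (convex_univ (𝕜 := ℝ) (E := ℝ)).norm_image_sub_le_of_norm_hasDerivWithin_le
    (f := fun s => Real.arctan (k * s) / k) (f' := fun s => 1 / (1 + (k * s) ^ 2)) (C := 1)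
    (fun s _ => (hasDerivAt_arctan_scaled hk s).hasDerivWithinAt)
    (fun s _ => by
      rw [Real.norm_of_nonneg (by positivity), div_le_one (by positivity)]
      nlinarith [sq_nonneg (k * s)]) (mem_univ b) (mem_univ a)
  simpa using h

/-- The derivative `1 / (1 + s²)` of the arctangent is Lipschitz. -/
lemma abs_one_div_one_add_sq_sub_le (a b : ℝ) :
    |1 / (1 + a ^ 2) - 1 / (1 + b ^ 2)| ≤ |a - b| := by
  have e : 1 / (1 + a ^ 2) - 1 / (1 + b ^ 2)
      = (a - b) * (-(a + b) / ((1 + a ^ 2) * (1 + b ^ 2))) := by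
    field_simp; ring
  rw [e, abs_mul]
  refine mul_le_of_le_one_right (abs_nonneg _) ?_
  rw [abs_div, abs_neg, abs_of_pos (by positivity : 0 < (1 + a ^ 2) * (1 + b ^ 2)),
    div_le_one (by positivity), abs_le]
  constructor <;> nlinarith [sq_nonneg (a - 1), sq_nonneg (b - 1), sq_nonneg (a + 1),
    sq_nonneg (b + 1), sq_nonneg (a * b)]

/-- The chain rule for `arctan (k f) / k`, tested against a smooth function: it holds for the
mollifications of `f`, and passes to the limit since the arctangent and its derivative are
Lipschitz. -/
lemma integral_partial_mul_arctan {i : Fin d} {f g : Sp d → ℝ} (hf : MemLp f 2) (hg : MemLp g 2)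
    (h : HasWeakPartial univ i f g) {k : ℝ} (hk : 0 < k) {φ : Sp d → ℝ} (hφ : ContDiff ℝ ∞ φ)
    (hc : HasCompactSupport φ) :
    ∫ x, fderiv ℝ φ x (EuclideanSpace.single i (1 : ℝ)) * (Real.arctan (k * f x) / k)
      = - ∫ x, φ x * (1 / (1 + (k * f x) ^ 2)) * g x := by
  set e := EuclideanSpace.single i (1 : ℝ) with he
  set fn : ℕ → Sp d → ℝ := fun n => mollify n f with hfn
  have hfs : ∀ n, ContDiff ℝ ∞ (fn n) := fun n =>
    mollify_contDiff n (hf.locallyIntegrable (by norm_num))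
  have hd1 : Continuous fun x => fderiv ℝ φ x e := continuous_partial hφ i
  have hd2 : HasCompactSupport fun x => fderiv ℝ φ x e := hasCompactSupport_partial hc i
  have hFc : Continuous fun s : ℝ => Real.arctan (k * s) / k := by fun_prop
  have hF'c : Continuous fun s : ℝ => 1 / (1 + (k * s) ^ 2) := by
    refine continuous_const.div (by fun_prop) fun s => by positivity
  have step : ∀ n, ∫ x, fderiv ℝ φ x e * (Real.arctan (k * fn n x) / k)
      = - ∫ x, φ x * (1 / (1 + (k * fn n x) ^ 2)) * mollify n g x := by
    intro n
    have hFd : ∀ x, HasFDerivAt (fun x => Real.arctan (k * fn n x) / k)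
        ((1 / (1 + (k * fn n x) ^ 2)) • fderiv ℝ (fn n) x) x := fun x =>
      (hasDerivAt_arctan_scaled hk (fn n x)).comp_hasFDerivAt x
        (((hfs n).differentiable (by simp)) x).hasFDerivAt
    have hFe : ∀ x, fderiv ℝ (fun x => Real.arctan (k * fn n x) / k) x e
        = 1 / (1 + (k * fn n x) ^ 2) * mollify n g x := by
      intro x
      rw [(hFd x).fderiv, smul_apply, smul_eq_mul,
        ← partial_mollify n hf h x]
    have c1 : Continuous fun x => 1 / (1 + (k * fn n x) ^ 2) * mollify n g x :=
      (hF'c.comp (hfs n).continuous).mul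
        (mollify_contDiff n (hg.locallyIntegrable (by norm_num))).continuous
    have c2 : Continuous fun x => Real.arctan (k * fn n x) / k := hFc.comp (hfs n).continuous
    have := integral_mul_fderiv_eq_neg_fderiv_mul_of_integrable (μ := (volume : Measure (Sp d)))
      (f := φ) (g := fun x => Real.arctan (k * fn n x) / k) (v := e)
      ((hd1.mul c2).integrable_of_hasCompactSupport hd2.mul_right)
      (by
        simp_rw [hFe]
        exact (hφ.continuous.mul c1).integrable_of_hasCompactSupport hc.mul_right)
      ((hφ.continuous.mul c2).integrable_of_hasCompactSupport hc.mul_right)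
      (fun x _ => hφ.differentiable (by simp) x) (fun x _ => (hFd x).differentiableAt)
    simp_rw [hFe] at this
    simp_rw [mul_assoc (φ _)]
    rw [this, neg_neg]
  obtain ⟨M, hM⟩ := hc.exists_bound_of_continuous hφ.continuous
  have hmφ : MemLp φ 2 := hφ.continuous.memLp_of_hasCompactSupport hc
  have hmd : MemLp (fun x => fderiv ℝ φ x e) 2 := hd1.memLp_of_hasCompactSupport hd2
  have hmF : ∀ {u : Sp d → ℝ}, MemLp u 2 → MemLp (fun x => Real.arctan (k * u x) / k) 2 := by
    intro u hu
    refine MemLp.of_le hu (hFc.comp_aestronglyMeasurable hu.1) (Eventually.of_forall fun x => ?_)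
    have := abs_arctan_scaled_sub_le hk (u x) 0
    rwa [mul_zero, Real.arctan_zero, zero_div, sub_zero, sub_zero] at this
  have hmF' : ∀ {u : Sp d → ℝ}, MemLp u 2 →
      MemLp (fun x => φ x * (1 / (1 + (k * u x) ^ 2))) 2 := by
    intro u hu
    refine MemLp.of_le hmφ (hφ.continuous.aestronglyMeasurable.mul
      (hF'c.comp_aestronglyMeasurable hu.1)) (Eventually.of_forall fun x => ?_)
    rw [norm_mul]
    refine mul_le_of_le_one_right (norm_nonneg _) ?_
    rw [Real.norm_of_nonneg (by positivity), div_le_one (by positivity)]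
    nlinarith [sq_nonneg (k * u x)]
  have hfm : ∀ n, MemLp (fn n) 2 := fun n => memLp_mollify n hf
  have lim1 := tendsto_integral_mul_of_tendsto_eLpNorm hmd (hmF hf) (fun n => hmF (hfm n)) (by
    refine tendsto_of_tendsto_of_tendsto_of_le_of_le tendsto_const_nhds (tendsto_mollify hf)
      (fun _ => zero_le) fun n => eLpNorm_mono fun x => ?_
    exact abs_arctan_scaled_sub_le hk _ _)
  have lim2 := tendsto_integral_mul_of_tendsto (hmF' hf) hg (fun n => hmF' (hfm n))
    (fun n => memLp_mollify n hg) (by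
      have h0 : Tendsto (fun n => ENNReal.ofReal (M * k) * eLpNorm (mollify n f - f) 2) atTop
          (𝓝 0) := by
        simpa using ENNReal.Tendsto.const_mul (tendsto_mollify hf) (Or.inr ENNReal.ofReal_ne_top)
      refine tendsto_of_tendsto_of_tendsto_of_le_of_le tendsto_const_nhds h0
        (fun _ => zero_le) fun n => eLpNorm_le_mul_eLpNorm_of_ae_le_mul
          (Eventually.of_forall fun x => ?_) 2
      simp only [Pi.sub_apply, ← mul_sub, norm_mul]
      rw [mul_assoc]
      refine mul_le_mul (hM x) ?_ (norm_nonneg _) ((norm_nonneg _).trans (hM x))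
      have := abs_one_div_one_add_sq_sub_le (k * fn n x) (k * f x)
      rw [← mul_sub, abs_mul, abs_of_pos hk] at this
      exact this) (tendsto_mollify hg)
  simp_rw [step] at lim1
  exact tendsto_nhds_unique lim1 lim2.neg

/-- The weak derivatives of a function vanish almost everywhere on its zero set. As `k → ∞`, the
functions `arctan (k f) / k` tend to zero uniformly, while their derivatives `g / (1 + (k f)²)` tend
to `g` on the zero set of `f` and to zero elsewhere; so this limit is zero. -/
lemma HasWeakPartial.ae_eq_zero_of_eq_zero {i : Fin d} {f g : Sp d → ℝ} (hf : MemLp f 2)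
    (hg : MemLp g 2) (h : HasWeakPartial univ i f g) : ∀ᵐ x, f x = 0 → g x = 0 := by
  classical
  have hlimpt : ∀ x, Tendsto (fun n : ℕ => 1 / (1 + (((n : ℝ) + 1) * f x) ^ 2) * g x) atTop
      (𝓝 (if f x = 0 then g x else 0)) := by
    intro x
    split_ifs with hx
    · simp [hx]
    · rw [← zero_mul (g x)]
      refine Tendsto.mul_const _ ?_
      have h1 : Tendsto (fun n : ℕ => ((n : ℝ) + 1)) atTop atTop :=
        tendsto_atTop_add_const_right _ _ tendsto_natCast_atTop_atTop
      have h2 : Tendsto (fun n : ℕ => 1 + (((n : ℝ) + 1) * f x) ^ 2) atTop atTop := by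
        refine tendsto_atTop_add_const_left _ _ ?_
        simp_rw [mul_pow]
        exact Tendsto.atTop_mul_const (by positivity)
          ((tendsto_pow_atTop two_ne_zero).comp h1)
      simpa using tendsto_const_nhds.div_atTop h2 (a := (1 : ℝ))
  have hb : ∀ (n : ℕ) x, |1 / (1 + (((n : ℝ) + 1) * f x) ^ 2)| ≤ 1 := by
    intro n x
    rw [abs_of_nonneg (by positivity), div_le_one (by positivity)]
    nlinarith [sq_nonneg (((n : ℝ) + 1) * f x)]
  have hmeas : ∀ n : ℕ, AEStronglyMeasurable
      (fun x => 1 / (1 + (((n : ℝ) + 1) * f x) ^ 2) * g x) volume := by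
    intro n
    refine AEStronglyMeasurable.mul ?_ hg.1
    have : Continuous fun s : ℝ => 1 / (1 + (((n : ℝ) + 1) * s) ^ 2) :=
      continuous_const.div (by fun_prop) fun s => by positivity
    exact this.comp_aestronglyMeasurable hf.1
  have hmem : MemLp (fun x => if f x = 0 then g x else 0) 2 := by
    refine MemLp.of_le hg (aestronglyMeasurable_of_tendsto_ae atTop hmeas
      (Eventually.of_forall hlimpt)) (Eventually.of_forall fun x => ?_)
    split_ifs <;> simp
  have := ae_eq_zero_of_integral_contDiff_smul_eq_zero
    (hmem.locallyIntegrable (by norm_num)) fun φ hφ hc => by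
    have hd1 := continuous_partial hφ i
    have hd2 := hasCompactSupport_partial hc i
    have hi := integrable_smul_of_memLp hφ.continuous hc hg
    have l1 : Tendsto (fun n : ℕ => ∫ x, φ x * (1 / (1 + (((n : ℝ) + 1) * f x) ^ 2)) * g x)
        atTop (𝓝 (∫ x, φ x • (if f x = 0 then g x else 0))) := by
      refine tendsto_integral_of_dominated_convergence (fun x => ‖φ x • g x‖) (fun n => ?_)
        hi.norm (fun n => Eventually.of_forall fun x => ?_) (Eventually.of_forall fun x => ?_)
      · simp_rw [mul_assoc (φ _)]
        exact hφ.continuous.aestronglyMeasurable.mul (hmeas n)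
      · rw [norm_mul, norm_mul, smul_eq_mul, norm_mul]
        gcongr
        exact mul_le_of_le_one_right (norm_nonneg _) (hb n x)
      · simp_rw [mul_assoc (φ x)]
        exact (hlimpt x).const_mul _
    have l2 : Tendsto (fun n : ℕ => ∫ x, fderiv ℝ φ x (EuclideanSpace.single i (1 : ℝ)) *
        (Real.arctan (((n : ℝ) + 1) * f x) / ((n : ℝ) + 1))) atTop (𝓝 0) := by
      have h0 : Tendsto (fun n : ℕ => (∫ x, ‖fderiv ℝ φ x (EuclideanSpace.single i (1 : ℝ))‖) *
          (2 / ((n : ℝ) + 1))) atTop (𝓝 0) := by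
        rw [← mul_zero (∫ x, ‖fderiv ℝ φ x (EuclideanSpace.single i (1 : ℝ))‖)]
        refine Tendsto.const_mul _ (tendsto_const_nhds.div_atTop ?_)
        exact tendsto_atTop_add_const_right _ _ tendsto_natCast_atTop_atTop
      refine squeeze_zero_norm (fun n => ?_) h0
      refine (norm_integral_le_integral_norm _).trans ?_
      rw [← integral_mul_const]
      refine integral_mono_of_nonneg (Eventually.of_forall fun _ => norm_nonneg _)
        ((hd1.norm.integrable_of_hasCompactSupport hd2.norm).mul_const _)
        (Eventually.of_forall fun x => ?_)
      simp only [norm_mul]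
      gcongr
      rw [norm_div, Real.norm_of_nonneg (by positivity : 0 ≤ (n : ℝ) + 1)]
      gcongr
      rw [Real.norm_eq_abs, abs_le]
      constructor <;> linarith [Real.arctan_lt_pi_div_two (((n : ℝ) + 1) * f x),
        Real.neg_pi_div_two_lt_arctan (((n : ℝ) + 1) * f x), Real.pi_lt_four]
    have e : ∀ n : ℕ, _ := fun n =>
      integral_partial_mul_arctan hf hg h (Nat.cast_add_one_pos n : (0 : ℝ) < n + 1) hφ hc
    simp_rw [e] at l2
    have := tendsto_nhds_unique l1 (by simpa using l2.neg)
    exact this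
  filter_upwards [this] with x hx hfx
  simpa [hfx] using hx

/-! ### The embedding of `H²` into `L^∞` -/

section SupBound
open SchwartzMap LineDeriv FourierTransform

/-- The Fourier symbol of `1 - Δ`. -/
lemma fourier_sub_laplacian_apply (S : 𝓢(Sp d, ℂ)) (ξ : Sp d) :
    𝓕 (S - ∑ i : Fin d, ∂_{EuclideanSpace.single i (1 : ℝ)}
        (∂_{EuclideanSpace.single i (1 : ℝ)} S)) ξ
      = ((1 + 4 * Real.pi ^ 2 * ‖ξ‖ ^ 2 : ℝ) : ℂ) * 𝓕 S ξ := by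
  have hl : ∀ (G : 𝓢(Sp d, ℂ)) (m : Sp d),
      𝓕 (∂_{m} G) ξ = (2 * Real.pi * Complex.I) * ((⟪ξ, m⟫ : ℝ) : ℂ) * 𝓕 G ξ := by
    intro G m
    have : (fun x : Sp d => ⟪x, m⟫).HasTemperateGrowth :=
      ((innerSL ℝ).flip m).hasTemperateGrowth
    rw [fourier_lineDerivOp_eq]
    simp [smulLeftCLM_apply_apply this, mul_assoc]
  have hsub : 𝓕 (S - ∑ i : Fin d, ∂_{EuclideanSpace.single i (1 : ℝ)}
        (∂_{EuclideanSpace.single i (1 : ℝ)} S))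
      = 𝓕 S - ∑ i : Fin d, 𝓕 (∂_{EuclideanSpace.single i (1 : ℝ)}
        (∂_{EuclideanSpace.single i (1 : ℝ)} S)) := by
    simp only [← fourierTransformCLM_apply (𝕜 := ℂ)]
    rw [map_sub, map_sum]
  rw [hsub, sub_apply, sum_apply]
  simp only [hl]
  simp only [EuclideanSpace.norm_sq_eq, Real.norm_eq_abs, sq_abs]
  simp only [EuclideanSpace.inner_single_right]
  push_cast
  rw [Finset.mul_sum, add_mul, Finset.sum_mul, one_mul, sub_eq_add_neg, ← Finset.sum_neg_distrib]
  congr 1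
  apply Finset.sum_congr rfl
  intro i _
  have : Complex.I ^ 2 = -1 := Complex.I_sq
  simp
  linear_combination (-4 * (Real.pi:ℂ)^2 * (ξ i : ℂ)^2 * 𝓕 S ξ) * this

/-- The symbol of `(1 - Δ)⁻¹` is square integrable for `d < 4`. -/
lemma memLp_bessel_symbol (hd : d = 2 ∨ d = 3) :
    MemLp (fun ξ : Sp d => (1 + 4 * Real.pi ^ 2 * ‖ξ‖ ^ 2)⁻¹) 2 := by
  have hc : Continuous fun ξ : Sp d => (1 + 4 * Real.pi ^ 2 * ‖ξ‖ ^ 2)⁻¹ :=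
    (by fun_prop : Continuous fun ξ : Sp d => 1 + 4 * Real.pi ^ 2 * ‖ξ‖ ^ 2).inv₀
      fun ξ => by positivity
  rw [memLp_two_iff_integrable_sq hc.aestronglyMeasurable]
  have h4 : ((Module.finrank ℝ (Sp d) : ℕ) : ℝ) < 4 := by
    rcases hd with rfl | rfl <;> norm_num
  have h := integrable_rpow_neg_one_add_norm_sq (E := Sp d) (μ := volume) h4
  refine h.mono' (hc.pow 2).aestronglyMeasurable (Eventually.of_forall fun ξ => ?_)
  rw [Real.norm_of_nonneg (by positivity)]
  have e : (1 + ‖ξ‖ ^ 2) ^ (-(4 : ℝ) / 2) = ((1 + ‖ξ‖ ^ 2)⁻¹) ^ 2 := by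
    rw [show (-(4 : ℝ) / 2) = -((2 : ℕ) : ℝ) by norm_num, Real.rpow_neg (by positivity),
      Real.rpow_natCast, inv_pow]
  rw [e]
  gcongr
  exact le_mul_of_one_le_left (sq_nonneg _) (by nlinarith [Real.pi_gt_three])

lemma eLpNorm_eq_ofReal_norm_toLp (G : 𝓢(Sp d, ℂ)) :
    eLpNorm G 2 (volume : Measure (Sp d)) = ENNReal.ofReal ‖G.toLp 2‖ := by
  rw [norm_toLp, ENNReal.ofReal_toReal (G.memLp 2 volume).2.ne]

/-- Plancherel's identity. -/
lemma eLpNorm_fourier_eq (G : 𝓢(Sp d, ℂ)) :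
    eLpNorm (𝓕 G : 𝓢(Sp d, ℂ)) 2 (volume : Measure (Sp d)) = eLpNorm G 2 := by
  rw [eLpNorm_eq_ofReal_norm_toLp, norm_fourier_toL2_eq, ← eLpNorm_eq_ofReal_norm_toLp]

/-- The Sobolev embedding `H² ⊆ L^∞` in dimensions two and three, for Schwartz functions: the
Fourier transform of `S` is the product of the square integrable symbol of `(1 - Δ)⁻¹` with the
transform of `S - ΔS`. -/
lemma enorm_schwartz_le (hd : d = 2 ∨ d = 3) (S : 𝓢(Sp d, ℂ)) (x : Sp d) :
    ‖S x‖ₑ ≤ eLpNorm (fun ξ : Sp d => (1 + 4 * Real.pi ^ 2 * ‖ξ‖ ^ 2)⁻¹) 2 *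
      eLpNorm (S - ∑ i : Fin d, ∂_{EuclideanSpace.single i (1 : ℝ)}
        (∂_{EuclideanSpace.single i (1 : ℝ)} S) : 𝓢(Sp d, ℂ)) 2 := by
  have hsym := fourier_sub_laplacian_apply S
  generalize (S - ∑ i : Fin d, ∂_{EuclideanSpace.single i (1 : ℝ)}
    (∂_{EuclideanSpace.single i (1 : ℝ)} S) : 𝓢(Sp d, ℂ)) = G at hsym ⊢
  have h1 : ‖S x‖ₑ ≤ eLpNorm (𝓕 S : 𝓢(Sp d, ℂ)) 1 := by
    have e1 : ‖S x‖ ≤ ‖(𝓕 S : 𝓢(Sp d, ℂ)).toLp 1‖ := by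
      have := norm_fourier_apply_le_toLp_one (𝓕 S) (-x)
      have e2 : 𝓕 (𝓕 S) (-x) = S x := by
        have e3 : 𝓕⁻ (𝓕 S) x = S x := by rw [FourierTransform.fourierInv_fourier_eq]
        rw [← e3, fourierInv_apply_eq]
        simp
      rwa [e2] at this
    rw [norm_toLp] at e1
    rw [← ofReal_norm]
    exact (ENNReal.ofReal_le_ofReal e1).trans ENNReal.ofReal_toReal_le
  have h2 : eLpNorm (𝓕 S : 𝓢(Sp d, ℂ)) 1 ≤
      eLpNorm (fun ξ : Sp d => (1 + 4 * Real.pi ^ 2 * ‖ξ‖ ^ 2)⁻¹) 2 *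
        eLpNorm (𝓕 G : 𝓢(Sp d, ℂ)) 2 := by
    have := eLpNorm_smul_le_mul_eLpNorm (p := 2) (q := 2) (r := 1) (μ := (volume : Measure (Sp d)))
      (𝓕 G : 𝓢(Sp d, ℂ)).continuous.aestronglyMeasurable (memLp_bessel_symbol hd).1
    refine (le_of_eq ?_).trans this
    refine eLpNorm_congr_ae (Eventually.of_forall fun ξ => ?_)
    rw [Pi.smul_apply', hsym, Complex.real_smul, ← mul_assoc,
      ← Complex.ofReal_mul, inv_mul_cancel₀ (by positivity), Complex.ofReal_one, one_mul]
  have h3 := eLpNorm_fourier_eq G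
  rw [← h3]
  exact h1.trans h2

lemma fderiv_ofReal_comp {W : Sp d → ℝ} (hW : ContDiff ℝ ∞ W) (y m : Sp d) :
    fderiv ℝ (fun x => (W x : ℂ)) y m = ((fderiv ℝ W y m : ℝ) : ℂ) := by
  have := (Complex.ofRealCLM.hasFDerivAt.comp y (hW.differentiable (by simp) y).hasFDerivAt).fderiv
  have e : fderiv ℝ (fun x => (W x : ℂ)) y = _ := this
  rw [e]
  simp

/-- The Sobolev embedding `H² ⊆ L^∞` in dimensions two and three, for test functions. -/
lemma exists_abs_le_eLpNorm_sub_laplacian (hd : d = 2 ∨ d = 3) : ∃ C : ℝ≥0∞, C ≠ ⊤ ∧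
    ∀ V : Sp d → ℝ, ContDiff ℝ ∞ V → HasCompactSupport V → ∀ x, ‖V x‖ₑ ≤ C *
      eLpNorm (fun y => V y - ∑ i, fderiv ℝ (fun z => fderiv ℝ V z
        (EuclideanSpace.single i (1 : ℝ))) y (EuclideanSpace.single i (1 : ℝ))) 2 := by
  refine ⟨_, (memLp_bessel_symbol hd).2.ne, fun V hV hVc x => ?_⟩
  have hcs : HasCompactSupport fun x => (V x : ℂ) := hVc.comp_left (g := fun r : ℝ => (r : ℂ)) rfl
  have hcd : ContDiff ℝ ∞ fun x => (V x : ℂ) := Complex.ofRealCLM.contDiff.comp hV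
  obtain ⟨S, hS⟩ : ∃ S : 𝓢(Sp d, ℂ), S = hcs.toSchwartzMap hcd := ⟨_, rfl⟩
  have hSa : ∀ x, S x = V x := fun x => by rw [hS]; rfl
  have hSf : (⇑S : Sp d → ℂ) = fun x => (V x : ℂ) := funext hSa
  have h := enorm_schwartz_le hd S x
  have e0 : ‖V x‖ₑ = ‖S x‖ₑ := by
    rw [hSa, ← ofReal_norm, ← ofReal_norm, Complex.norm_real]
  rw [e0]
  refine h.trans (le_of_eq ?_)
  congr 1
  refine eLpNorm_congr_norm_ae (Eventually.of_forall fun y => ?_)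
  have hGa : (S - ∑ i : Fin d, ∂_{EuclideanSpace.single i (1 : ℝ)}
      (∂_{EuclideanSpace.single i (1 : ℝ)} S) : 𝓢(Sp d, ℂ)) y
      = ((V y - ∑ i, fderiv ℝ (fun z => fderiv ℝ V z
        (EuclideanSpace.single i (1 : ℝ))) y (EuclideanSpace.single i (1 : ℝ)) : ℝ) : ℂ) := by
    rw [sub_apply, sum_apply, hSa]
    push_cast
    congr 1
    refine Finset.sum_congr rfl fun i _ => ?_
    rw [lineDerivOp_apply_eq_fderiv]
    have : (⇑(∂_{EuclideanSpace.single i (1 : ℝ)} S : 𝓢(Sp d, ℂ)) : Sp d → ℂ)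
        = fun z => ((fderiv ℝ V z (EuclideanSpace.single i (1 : ℝ)) : ℝ) : ℂ) := by
      ext z
      rw [lineDerivOp_apply_eq_fderiv, hSf]
      exact fderiv_ofReal_comp hV z _
    rw [this, fderiv_ofReal_comp (contDiff_partial hV i)]
  rw [hGa, Complex.norm_real]

end SupBound

/-- The Sobolev embedding `H² ⊆ L^∞` in dimensions two and three, for functions that vanish off
a ball. -/
lemma exists_eLpNorm_top_le (hd : d = 2 ∨ d = 3) : ∃ C : ℝ≥0∞, C ≠ ⊤ ∧
    ∀ (R : ℝ) (f : Sp d → ℝ) (g g2 : Fin d → Sp d → ℝ), IsH1 f g →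
    (∀ i, MemLp (g2 i) 2) → (∀ i, HasWeakPartial univ i (g i) (g2 i)) →
    (∀ᵐ x, x ∉ Metric.ball (0 : Sp d) R → f x = 0) →
    eLpNorm f ⊤ ≤ C * eLpNorm (fun x => f x - ∑ i, g2 i x) 2 := by
  obtain ⟨C, hC, h⟩ := exists_abs_le_eLpNorm_sub_laplacian hd
  refine ⟨C, hC, fun R f g g2 hfg hg2 hw hR => ?_⟩
  have hfl := hfg.memLp.locallyIntegrable (by norm_num : (1 : ℝ≥0∞) ≤ 2)
  have hg2s : MemLp (fun x => ∑ i, g2 i x) 2 := memLp_finsetSum _ fun i _ => hg2 i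
  have key : ∀ n, eLpNorm (mollify n f) ⊤ ≤
      C * eLpNorm (fun x => mollify n f x - ∑ i, mollify n (g2 i) x) 2 := by
    intro n
    rw [eLpNorm_exponent_top]
    refine eLpNormEssSup_le_of_ae_enorm_bound (Eventually.of_forall fun x => ?_)
    have := h _ (mollify_contDiff n hfl)
      (hasCompactSupport_of_eq_zero_off_ball fun x => mollify_eq_zero n hR) x
    simpa only [partial_mollify n hfg.memLp (hfg.weak _),
      partial_mollify n (hfg.memLp_partial _) (hw _)] using this
  have hmn : ∀ n, MemLp (fun x => ∑ i, mollify n (g2 i) x) 2 := fun n =>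
    memLp_finsetSum _ fun i _ => memLp_mollify n (hg2 i)
  refine eLpNorm_le_of_tendsto hfg.memLp (fun n => memLp_mollify n hfg.memLp)
    (tendsto_mollify hfg.memLp) key ?_
  refine ENNReal.Tendsto.const_mul ?_ (Or.inr hC)
  refine tendsto_eLpNorm_of_tendsto (hfg.memLp.sub hg2s)
    (fun n => (memLp_mollify n hfg.memLp).sub (hmn n)) ?_
  have h0 : Tendsto
      (fun n => eLpNorm (mollify n f - f) 2 + ∑ i, eLpNorm (mollify n (g2 i) - g2 i) 2) atTop
      (𝓝 0) := by
    have := (tendsto_mollify hfg.memLp).add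
      (tendsto_finsetSum Finset.univ fun i _ => tendsto_mollify (hg2 i))
    simpa using this
  refine tendsto_of_tendsto_of_tendsto_of_le_of_le tendsto_const_nhds h0 (fun _ => zero_le)
    fun n => ?_
  have e : ((fun x => mollify n f x - ∑ i, mollify n (g2 i) x) - fun x => f x - ∑ i, g2 i x)
      = (mollify n f - f) - ∑ i, (mollify n (g2 i) - g2 i) := by
    ext x
    simp only [Pi.sub_apply, Finset.sum_apply, Finset.sum_sub_distrib]
    ring
  dsimp only
  rw [e]
  have m1 : ∀ i, AEStronglyMeasurable (mollify n (g2 i) - g2 i) volume := fun i =>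
    ((memLp_mollify n (hg2 i)).sub (hg2 i)).1
  refine (eLpNorm_sub_le ((memLp_mollify n hfg.memLp).sub hfg.memLp).1
    (Finset.aestronglyMeasurable_sum _ fun i _ => m1 i) (by norm_num)).trans ?_
  gcongr
  exact eLpNorm_sum_le (fun i _ => m1 i) (by norm_num)

/-! ### Weak compactness and the uniform bound in `H²` -/

/-- Bounded families in a Hilbert space converge weakly along ultrafilters. -/
lemma exists_weak_limit {H ι : Type*} [NormedAddCommGroup H] [InnerProductSpace ℝ H]
    [CompleteSpace H] (U : Ultrafilter ι) (x : ι → H) (M : ℝ) (hx : ∀ᶠ i in U, ‖x i‖ ≤ M) :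
    ∃ y : H, ‖y‖ ≤ M ∧ ∀ z : H, Tendsto (fun i => ⟪x i, z⟫) U (𝓝 ⟪y, z⟫) := by
  let f : ι → WeakDual ℝ H := fun i => StrongDual.toWeakDual (InnerProductSpace.toDual ℝ H (x i))
  have hc := WeakDual.isCompact_closedBall (𝕜 := ℝ) (E := H) 0 M
  have hU : ((U.map f : Ultrafilter (WeakDual ℝ H)) : Filter (WeakDual ℝ H)) ≤
      𝓟 (WeakDual.toStrongDual ⁻¹' Metric.closedBall 0 M) := by
    rw [le_principal_iff]
    have : ∀ᶠ i in (U : Filter ι), f i ∈ WeakDual.toStrongDual ⁻¹' Metric.closedBall 0 M := by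
      filter_upwards [hx] with i hi
      simpa [f] using hi
    exact this
  obtain ⟨g, hg, hlim⟩ := hc.ultrafilter_le_nhds _ hU
  refine ⟨(InnerProductSpace.toDual ℝ H).symm (WeakDual.toStrongDual g), ?_, fun z => ?_⟩
  · simpa using hg
  · have h1 : Tendsto f U (𝓝 g) := hlim
    have h2 := ((WeakDual.eval_continuous z).tendsto g).comp h1
    have e : ⟪(InnerProductSpace.toDual ℝ H).symm (WeakDual.toStrongDual g), z⟫ = g z := by
      rw [InnerProductSpace.toDual_symm_apply]; rfl
    rw [e]
    exact h2

/-- Weak limits in `L²` preserve weak derivatives. -/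
lemma hasWeakPartial_of_weak_limit {ι : Type*} (U : Ultrafilter ι) {Vn Dn : ι → L2V d}
    {V D : L2V d} {i : Fin d} (hV : ∀ z, Tendsto (fun n => ⟪Vn n, z⟫) U (𝓝 ⟪V, z⟫))
    (hD : ∀ z, Tendsto (fun n => ⟪Dn n, z⟫) U (𝓝 ⟪D, z⟫))
    (h : ∀ᶠ n in U, HasWeakPartial univ i (Vn n) (Dn n)) : HasWeakPartial univ i V D := by
  intro φ hφ hc _
  -- the pairing of `W` with a test function is, in the direction `c`, an inner product in `L²`
  have key : ∀ {ψ : Sp d → ℝ} (hψ : Continuous ψ) (hψc : HasCompactSupport ψ) (c : Sp d),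
      ∃ z : L2V d, ∀ W : L2V d, ⟪∫ x, ψ x • W x, c⟫ = ⟪W, z⟫ := by
    intro ψ hψ hψc c
    have hm : MemLp (fun x => ψ x • c) 2 (volume : Measure (Sp d)) :=
      (hψ.smul continuous_const).memLp_of_hasCompactSupport hψc.smul_right
    refine ⟨hm.toLp _, fun W => ?_⟩
    rw [L2.inner_def, real_inner_comm,
      ← integral_inner (integrable_smul_of_memLp hψ hψc (Lp.memLp W))]
    apply integral_congr_ae
    filter_upwards [hm.coeFn_toLp] with x hx
    rw [hx, inner_smul_right, inner_smul_right, real_inner_comm]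
  apply ext_inner_right ℝ
  intro c
  obtain ⟨z1, h1⟩ := key (continuous_partial hφ i) (hasCompactSupport_partial hc i) c
  obtain ⟨z2, h2⟩ := key hφ.continuous hc c
  rw [h1, inner_neg_left, h2]
  refine tendsto_nhds_unique (hV z1) ((hD z2).neg.congr' ?_)
  filter_upwards [h] with n hn
  have := congrArg (fun w => ⟪w, c⟫) (hn φ hφ hc (subset_univ _))
  simp only [inner_neg_left] at this
  rw [h1, h2] at this
  exact this.symm

/-- Weak limits in `L²` preserve values on a measurable set. -/
lemma ae_eq_restrict_of_weak_limit {ι : Type*} (U : Ultrafilter ι) {Ω : Set (Sp d)}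
    (hΩ : MeasurableSet Ω) {un Vn : ι → L2V d} {u V : L2V d}
    (hu : ∀ z, Tendsto (fun n => ⟪un n, z⟫) U (𝓝 ⟪u, z⟫))
    (hV : ∀ z, Tendsto (fun n => ⟪Vn n, z⟫) U (𝓝 ⟪V, z⟫))
    (h : ∀ᶠ n in U, un n =ᵐ[volume.restrict Ω] Vn n) : u =ᵐ[volume.restrict Ω] V := by
  -- the test element is `u - V` itself, cut off to `Ω`
  have hm : MemLp (Ω.indicator (u - V : L2V d)) 2 (volume : Measure (Sp d)) :=
    (Lp.memLp _).indicator hΩ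
  have key : ∀ W : L2V d, ⟪W, hm.toLp _⟫ = ∫ x in Ω, ⟪W x, (u - V : L2V d) x⟫ := by
    intro W
    rw [L2.inner_def, ← integral_indicator hΩ]
    apply integral_congr_ae
    filter_upwards [hm.coeFn_toLp] with x hx
    rw [hx]
    by_cases hxΩ : x ∈ Ω <;> simp [hxΩ]
  have e : ⟪u, hm.toLp _⟫ = ⟪V, hm.toLp _⟫ := by
    refine tendsto_nhds_unique (hu _) ((hV _).congr' ?_)
    filter_upwards [h] with n hn
    rw [key, key]
    apply integral_congr_ae
    filter_upwards [hn] with x hx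
    rw [hx]
  rw [← sub_eq_zero, ← inner_sub_left, key] at e
  simp_rw [real_inner_self_eq_norm_sq] at e
  have hi : Integrable (fun x => ‖(u - V : L2V d) x‖ ^ 2) (volume.restrict Ω) :=
    ((memLp_two_iff_integrable_sq_norm (Lp.memLp _).1).1 (Lp.memLp (u - V))).restrict
  have h0 := (integral_eq_zero_iff_of_nonneg (fun x => by positivity) hi).1 e
  filter_upwards [h0, ae_restrict_of_ae (Lp.coeFn_sub u V)] with x h1 h2
  simp only [Pi.zero_apply, pow_eq_zero_iff, ne_eq, OfNat.ofNat_ne_zero, not_false_eq_true,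
    norm_eq_zero] at h1
  rw [h1] at h2
  exact (sub_eq_zero.1 h2.symm)

lemma norm_le_of_sum_sq_le {M : ℝ} {V : L2V d} {D : Fin d → L2V d} {D2 : Fin d → Fin d → L2V d}
    (h : ‖V‖ ^ 2 + ∑ i, ‖D i‖ ^ 2 + ∑ i, ∑ j, ‖D2 i j‖ ^ 2 ≤ M ^ 2) :
    ‖V‖ ≤ |M| ∧ (∀ i, ‖D i‖ ≤ |M|) ∧ ∀ i j, ‖D2 i j‖ ≤ |M| := by
  have n1 : 0 ≤ ∑ i, ‖D i‖ ^ 2 := Finset.sum_nonneg fun i _ => sq_nonneg _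
  have n2 : 0 ≤ ∑ i, ∑ j, ‖D2 i j‖ ^ 2 :=
    Finset.sum_nonneg fun i _ => Finset.sum_nonneg fun j _ => sq_nonneg _
  have n3 : 0 ≤ ‖V‖ ^ 2 := sq_nonneg _
  have aux : ∀ a : ℝ, a ^ 2 ≤ M ^ 2 → a ≤ |M| := fun a ha => (le_abs_self a).trans (sq_le_sq.1 ha)
  refine ⟨aux _ (by linarith), fun i => aux _ ?_, fun i j => aux _ ?_⟩
  · have := Finset.single_le_sum (f := fun i => ‖D i‖ ^ 2) (fun i _ => sq_nonneg _)
      (Finset.mem_univ i)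
    linarith
  · have h1 := Finset.single_le_sum (f := fun i => ∑ j, ‖D2 i j‖ ^ 2)
      (fun i _ => Finset.sum_nonneg fun j _ => sq_nonneg _) (Finset.mem_univ i)
    have h2 := Finset.single_le_sum (f := fun j => ‖D2 i j‖ ^ 2) (fun i _ => sq_nonneg _)
      (Finset.mem_univ j)
    linarith

/-- Bounds in `H²(Ω)` pass to `L²` limits, up to a factor depending on the dimension: the
extensions to `ℝ^d` and their derivatives converge weakly along an ultrafilter. The factor comes
from bounding every derivative of the limit separately. -/
lemma H2NormOnLE.of_mem_closure {Ω : Set (Sp d)} (hΩ : MeasurableSet Ω) {u : L2V d} {M : ℝ}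
    (hu : u ∈ closure {w : L2V d | H2NormOnLE Ω w M}) :
    H2NormOnLE Ω u (|M| * (1 + d + d ^ 2)) := by
  obtain ⟨U, hU, hlim⟩ := mem_closure_iff_ultrafilter.1 hu
  have hw : ∀ w : L2V d, ∃ (V : L2V d) (D : Fin d → L2V d) (D2 : Fin d → Fin d → L2V d),
      H2NormOnLE Ω w M → ((w =ᵐ[volume.restrict Ω] V) ∧
    (∀ i, HasWeakPartial univ i V (D i)) ∧
    (∀ i j, HasWeakPartial univ j (D i) (D2 i j)) ∧
    ‖V‖ ^ 2 + ∑ i, ‖D i‖ ^ 2 + ∑ i, ∑ j, ‖D2 i j‖ ^ 2 ≤ M ^ 2) := by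
    intro w
    by_cases h : H2NormOnLE Ω w M
    · obtain ⟨V, D, D2, h'⟩ := h
      exact ⟨V, D, D2, fun _ => h'⟩
    · exact ⟨0, 0, 0, fun h' => absurd h' h⟩
  choose V D D2 hw using hw
  have hev : ∀ᶠ w in (U : Filter (L2V d)), H2NormOnLE Ω w M := hU
  obtain ⟨V', hV', lV⟩ := exists_weak_limit U V |M| (by
    filter_upwards [hev] with w h using (norm_le_of_sum_sq_le (hw w h).2.2.2).1)
  have hD : ∀ i, ∃ y : L2V d, ‖y‖ ≤ |M| ∧
      ∀ z : L2V d, Tendsto (fun w => ⟪D w i, z⟫) U (𝓝 ⟪y, z⟫) :=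
    fun i => exists_weak_limit U (fun w => D w i) |M| (by
      filter_upwards [hev] with w h using (norm_le_of_sum_sq_le (hw w h).2.2.2).2.1 i)
  have hD2 : ∀ i j, ∃ y : L2V d, ‖y‖ ≤ |M| ∧
      ∀ z : L2V d, Tendsto (fun w => ⟪D2 w i j, z⟫) U (𝓝 ⟪y, z⟫) :=
    fun i j => exists_weak_limit U (fun w => D2 w i j) |M| (by
      filter_upwards [hev] with w h using (norm_le_of_sum_sq_le (hw w h).2.2.2).2.2 i j)
  choose D' hD' lD using hD
  choose D2' hD2' lD2 using hD2
  refine ⟨V', D', D2', ?_, fun i => ?_, fun i j => ?_, ?_⟩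
  · refine ae_eq_restrict_of_weak_limit U hΩ (un := id) (fun z => ?_) lV ?_
    · exact ((continuous_id.inner continuous_const).tendsto u).mono_left hlim
    · filter_upwards [hev] with w h using (hw w h).1
  · exact hasWeakPartial_of_weak_limit U lV (lD i) (by
      filter_upwards [hev] with w h using (hw w h).2.1 i)
  · exact hasWeakPartial_of_weak_limit U (lD i) (lD2 i j) (by
      filter_upwards [hev] with w h using (hw w h).2.2.1 i j)
  · have aux : ∀ y : L2V d, ‖y‖ ≤ |M| → ‖y‖ ^ 2 ≤ M ^ 2 := fun y hy => by
      rw [← sq_abs M]; exact pow_le_pow_left₀ (norm_nonneg _) hy 2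
    have s1 : ∑ i, ‖D' i‖ ^ 2 ≤ d * M ^ 2 := by
      refine (Finset.sum_le_sum fun i _ => aux _ (hD' i)).trans (le_of_eq ?_)
      simp
    have s2 : ∑ i, ∑ j, ‖D2' i j‖ ^ 2 ≤ d ^ 2 * M ^ 2 := by
      refine (Finset.sum_le_sum fun i _ => Finset.sum_le_sum fun j _ =>
        aux _ (hD2' i j)).trans (le_of_eq ?_)
      simp
      ring
    rw [mul_pow, sq_abs]
    have hd0 : (0 : ℝ) ≤ d := Nat.cast_nonneg d
    have h1 : (1 + (d : ℝ) + d ^ 2) ≤ (1 + (d : ℝ) + d ^ 2) ^ 2 := by nlinarith [sq_nonneg (d : ℝ)]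
    nlinarith [aux _ hV', mul_le_mul_of_nonneg_left h1 (sq_nonneg M)]

/-- A function with an integrable time derivative is continuous in time. -/
lemma IsTimeDeriv.continuousOn {B : Type*} [NormedAddCommGroup B] [NormedSpace ℝ B] {T : ℝ}
    (hT : 0 ≤ T) {u v : ℝ → B} (h : IsTimeDeriv T u v) : ContinuousOn u (Icc 0 T) := by
  have h1 : ContinuousOn (fun t => u 0 + ∫ s in (0 : ℝ)..t, v s) (Icc 0 T) := by
    refine continuousOn_const.add ?_
    have := intervalIntegral.continuousOn_primitive_interval' h.1 left_mem_uIcc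
    rwa [uIcc_of_le hT] at this
  exact h1.congr fun t ht => h.2 t ht

/-- If a continuous function lies in `S` at almost every time, it lies in the closure of `S` at
every time, since a set of full measure is dense. -/
lemma mem_closure_of_ae {B : Type*} [TopologicalSpace B] {T : ℝ} (hT : 0 < T) {u : ℝ → B}
    (hu : ContinuousOn u (Icc 0 T)) {S : Set B}
    (h : ∀ᵐ t ∂(volume.restrict (Ioc 0 T)), u t ∈ S) {t : ℝ} (ht : t ∈ Icc 0 T) :
    u t ∈ closure S := by
  rw [mem_closure_iff_nhds]
  intro W hW
  have h1 := hu t ht hW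
  rw [mem_map, mem_nhdsWithin_iff_exists_mem_nhds_inter] at h1
  obtain ⟨A, hA, hAs⟩ := h1
  obtain ⟨ε, hε, hball⟩ := Metric.mem_nhds_iff.1 hA
  have hlt : max (t - ε) 0 < min (t + ε) T := by
    rw [max_lt_iff, lt_min_iff, lt_min_iff]
    exact ⟨⟨by linarith, by linarith [ht.2]⟩, by linarith [ht.1], hT⟩
  have hpos : volume (Ioo (max (t - ε) 0) (min (t + ε) T)) ≠ 0 := by
    rw [Real.volume_Ioo, ne_eq, ENNReal.ofReal_eq_zero, not_le, sub_pos]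
    exact hlt
  rw [ae_restrict_iff' measurableSet_Ioc] at h
  obtain ⟨s, hs, hsS⟩ : ∃ s ∈ Ioo (max (t - ε) 0) (min (t + ε) T), s ∈ Ioc 0 T → u s ∈ S := by
    by_contra hcon
    push Not at hcon
    apply hpos
    refine measure_mono_null (fun s hs => ?_) h
    have := hcon s hs
    simp only [mem_compl_iff, mem_ofPred_eq, Classical.not_imp]
    exact this
  have hs1 := max_lt_iff.1 hs.1
  have hs2 := lt_min_iff.1 hs.2
  refine ⟨u s, hAs ⟨hball ?_, hs1.2.le, hs2.2.le⟩, hsS ⟨hs1.2, hs2.2.le⟩⟩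
  rw [Metric.mem_ball, Real.dist_eq, abs_lt]
  constructor <;> linarith [hs1.1, hs2.1]

/-- The `H²(Ω)` bound of a function in `L^∞(0, T; H²(Ω))` that is continuous in time with values
in `L²` holds at every time. -/
lemma MemTimeLinftyH2.exists_bound {Ω : Set (Sp d)} (hΩ : MeasurableSet Ω) {T : ℝ} (hT : 0 < T)
    {u : ℝ → L2V d} (h : MemTimeLinftyH2 Ω T u) (hu : ContinuousOn u (Icc 0 T)) :
    ∃ M : ℝ, ∀ t ∈ Icc 0 T, H2NormOnLE Ω (u t) M := by
  obtain ⟨M, hM⟩ := h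
  exact ⟨_, fun t ht => H2NormOnLE.of_mem_closure hΩ (mem_closure_of_ae hT hu hM ht)⟩

/-! ### The velocity space -/

/-- The choice in the definition of `weakPartial` is meaningful when a weak derivative in `L²`
exists. -/
lemma weakPartial_spec {F : Type*} [NormedAddCommGroup F] [NormedSpace ℝ F] {Ω : Set (Sp d)}
    {i : Fin d} {u g : Sp d → F} (hg : MemLp g 2 (volume.restrict Ω))
    (h : HasWeakPartial Ω i u g) :
    MemLp (weakPartial Ω i u) 2 (volume.restrict Ω) ∧
      HasWeakPartial Ω i u (weakPartial Ω i u) :=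
  Classical.epsilon_spec (p := fun g => MemLp g 2 (volume.restrict Ω) ∧ HasWeakPartial Ω i u g)
    ⟨g, hg, h⟩

lemma weakPartial_ae_eq {F : Type*} [NormedAddCommGroup F] [NormedSpace ℝ F] [CompleteSpace F]
    {Ω : Set (Sp d)} (hΩ : IsOpen Ω) {i : Fin d} {u g : Sp d → F}
    (hg : MemLp g 2 (volume.restrict Ω)) (h : HasWeakPartial Ω i u g) :
    weakPartial Ω i u =ᵐ[volume.restrict Ω] g :=
  (weakPartial_spec hg h).2.ae_unique hΩ h (weakPartial_spec hg h).1 hg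

lemma weakPartial_univ_ae_eq {F : Type*} [NormedAddCommGroup F] [NormedSpace ℝ F]
    [CompleteSpace F] {i : Fin d} {u g : Sp d → F} (hg : MemLp g 2)
    (h : HasWeakPartial univ i u g) : weakPartial univ i u =ᵐ[volume] g := by
  have := weakPartial_ae_eq isOpen_univ (by rwa [Measure.restrict_univ]) h
  rwa [Measure.restrict_univ] at this

lemma MemH1.memLp_weakPartial {v : L2V d} (h : MemH1 v) (i : Fin d) :
    MemLp (weakPartial univ i v) 2 := by
  obtain ⟨g, hg⟩ := h i
  have := (weakPartial_spec (by rw [Measure.restrict_univ]; exact Lp.memLp g) hg).1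
  rwa [Measure.restrict_univ] at this

lemma MemH1.hasWeakPartial {v : L2V d} (h : MemH1 v) (i : Fin d) :
    HasWeakPartial univ i v (weakPartial univ i v) := by
  obtain ⟨g, hg⟩ := h i
  exact (weakPartial_spec (by rw [Measure.restrict_univ]; exact Lp.memLp g) hg).2

lemma memLp_comp {f : Sp d → Sp d} {p : ℝ≥0∞} {μ : Measure (Sp d)} (hf : MemLp f p μ)
    (k : Fin d) : MemLp (fun x => f x k) p μ :=
  (EuclideanSpace.proj k : Sp d →L[ℝ] ℝ).comp_memLp' hf

lemma eLpNorm_comp_le (f : Sp d → Sp d) (p : ℝ≥0∞) (μ : Measure (Sp d)) (k : Fin d) :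
    eLpNorm (fun x => f x k) p μ ≤ eLpNorm f p μ :=
  eLpNorm_mono fun x => PiLp.norm_apply_le (f x) k

/-- The components of the weak gradient of a field of `H¹(ℝ^d)`. -/
lemma isH1_comp {V : Sp d → Sp d} {D : Fin d → Sp d → Sp d} (hV : MemLp V 2)
    (hD : ∀ i, MemLp (D i) 2) (h : ∀ i, HasWeakPartial univ i V (D i)) (k : Fin d) :
    IsH1 (fun x => V x k) (fun i x => D i x k) where
  memLp := memLp_comp hV k
  memLp_partial i := memLp_comp (hD i) k
  weak i := (h i).comp isOpen_univ (by rwa [Measure.restrict_univ])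
    (by rw [Measure.restrict_univ]; exact hD i) k

lemma MemH1.isH1 {v : L2V d} (h : MemH1 v) (k : Fin d) :
    IsH1 (fun x => v x k) (fun i x => weakPartial univ i v x k) :=
  isH1_comp (Lp.memLp v) h.memLp_weakPartial h.hasWeakPartial k

lemma MemH1.sub {u v : L2V d} (hu : MemH1 u) (hv : MemH1 v) :
    MemH1 (u - v) ∧ ∀ i, weakPartial univ i (u - v : L2V d) =ᵐ[volume]
      fun x => weakPartial univ i u x - weakPartial univ i v x := by
  have key : ∀ i, HasWeakPartial univ i (u - v : L2V d)
      (fun x => weakPartial univ i u x + (-1 : ℝ) • weakPartial univ i v x) := by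
    intro i
    have h1 := (hu.hasWeakPartial i).add isOpen_univ ((hv.hasWeakPartial i).const_smul (-1))
      (by rw [Measure.restrict_univ]; exact Lp.memLp u)
      (by rw [Measure.restrict_univ]; exact (Lp.memLp v).const_smul (-1 : ℝ))
      (by rw [Measure.restrict_univ]; exact hu.memLp_weakPartial i)
      (by rw [Measure.restrict_univ]; exact (hv.memLp_weakPartial i).const_smul (-1 : ℝ))
    refine h1.congr isOpen_univ ?_ (ae_eq_refl _)
    rw [Measure.restrict_univ]
    filter_upwards [Lp.coeFn_sub u v] with x hx
    rw [hx]
    simp [sub_eq_add_neg]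
  have hm : ∀ i, MemLp (fun x => weakPartial univ i u x + (-1 : ℝ) • weakPartial univ i v x) 2
      (volume : Measure (Sp d)) :=
    fun i => (hu.memLp_weakPartial i).add ((hv.memLp_weakPartial i).const_smul (-1 : ℝ))
  refine ⟨fun i => ⟨(hm i).toLp _, ?_⟩, fun i => ?_⟩
  · refine (key i).congr isOpen_univ (ae_eq_refl _) ?_
    rw [Measure.restrict_univ]
    exact (hm i).coeFn_toLp.symm
  · filter_upwards [weakPartial_univ_ae_eq (hm i) (key i)] with x hx
    rw [hx]
    simp [sub_eq_add_neg]

/-- A field of the velocity space and its weak gradient vanish almost everywhere off `Ω`. This needs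
no regularity of `∂Ω`, as the weak gradient vanishes on the zero set of the field. -/
lemma MemX.ae_eq_zero {α : ℝ} {Ω : Set (Sp d)} {v : L2V d} (h : MemX α Ω v) :
    ∀ᵐ x, x ∉ Ω → v x = 0 ∧ ∀ i, weakPartial univ i v x = 0 := by
  have h1 : ∀ i k, ∀ᵐ x, v x k = 0 → weakPartial univ i v x k = 0 := fun i k =>
    ((h.2.1.isH1 k).weak i).ae_eq_zero_of_eq_zero (h.2.1.isH1 k).memLp
      ((h.2.1.isH1 k).memLp_partial i)
  simp_rw [← ae_all_iff] at h1
  filter_upwards [h1, h.2.2] with x hx hv hxΩ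
  refine ⟨hv hxΩ, fun i => ?_⟩
  ext k
  exact hx i k (by rw [hv hxΩ]; rfl)

lemma eLpNorm_restrict_eq_of_ae_eq_zero {F : Type*} [NormedAddCommGroup F] {Ω : Set (Sp d)}
    (hΩ : MeasurableSet Ω) {f : Sp d → F} (hf : ∀ᵐ x, x ∉ Ω → f x = 0) (p : ℝ≥0∞) :
    eLpNorm f p (volume.restrict Ω) = eLpNorm f p volume := by
  rw [← eLpNorm_indicator_eq_eLpNorm_restrict hΩ]
  apply eLpNorm_congr_ae
  filter_upwards [hf] with x hx
  by_cases h : x ∈ Ω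
  · simp [h]
  · simp [h, hx h]

lemma eLpNorm_two_eq {F : Type*} [NormedAddCommGroup F] {f : Sp d → F} {μ : Measure (Sp d)}
    (hf : MemLp f 2 μ) : eLpNorm f 2 μ = ENNReal.ofReal (√(∫ x, ‖f x‖ ^ 2 ∂μ)) := by
  rw [hf.eLpNorm_eq_integral_rpow_norm two_ne_zero ENNReal.ofNat_ne_top, Real.sqrt_eq_rpow]
  simp

lemma integrable_inner_of_memLp_two {f g : Sp d → Sp d} {μ : Measure (Sp d)}
    (hf : MemLp f 2 μ) (hg : MemLp g 2 μ) : Integrable (fun x => ⟪f x, g x⟫) μ :=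
  (hf.norm.integrable_mul hg.norm).mono' (hf.1.inner hg.1)
    (Eventually.of_forall fun x => norm_inner_le_norm (f x) (g x))

lemma gradForm_integrable {Ω : Set (Sp d)} {v w : L2V d} (hv : MemH1 v) (hw : MemH1 w) :
    IntegrableOn (fun x => ∑ i, ⟪weakPartial univ i v x, weakPartial univ i w x⟫) Ω :=
  (integrable_finsetSum _ fun i _ =>
    integrable_inner_of_memLp_two (hv.memLp_weakPartial i) (hw.memLp_weakPartial i)).integrableOn

lemma gradForm_self_nonneg (Ω : Set (Sp d)) (v : L2V d) : 0 ≤ gradForm Ω v v :=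
  integral_nonneg fun _ => Finset.sum_nonneg fun _ _ => real_inner_self_nonneg

/-- The weak gradient of a field in the velocity space is controlled by `gradForm`. -/
lemma MemX.eLpNorm_weakPartial_le {α : ℝ} {Ω : Set (Sp d)} (hΩ : MeasurableSet Ω) {v : L2V d}
    (h : MemX α Ω v) (i k : Fin d) : eLpNorm (fun x => weakPartial univ i v x k) 2 ≤
      ENNReal.ofReal (√(gradForm Ω v v)) := by
  refine (eLpNorm_comp_le _ _ _ k).trans ?_
  have hm := h.2.1.memLp_weakPartial i
  rw [← eLpNorm_restrict_eq_of_ae_eq_zero hΩ (by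
      filter_upwards [h.ae_eq_zero] with x hx hxΩ using (hx hxΩ).2 i),
    eLpNorm_two_eq (hm.restrict Ω)]
  apply ENNReal.ofReal_le_ofReal
  apply Real.sqrt_le_sqrt
  refine integral_mono_of_nonneg (Eventually.of_forall fun x => by positivity)
    (gradForm_integrable h.2.1 h.2.1) (Eventually.of_forall fun x => ?_)
  simp only [← real_inner_self_eq_norm_sq]
  exact Finset.single_le_sum (f := fun i => ⟪weakPartial univ i v x, weakPartial univ i v x⟫)
    (fun i _ => real_inner_self_nonneg) (Finset.mem_univ i)

/-! ### Bounds on a field in `H²(Ω)` -/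

lemma exists_eLpNorm_smooth_mul_le {ψ : Sp d → ℝ} (hψ : Continuous ψ) (hc : HasCompactSupport ψ) :
    ∃ c : ℝ≥0∞, c ≠ ⊤ ∧ ∀ f : Sp d → ℝ, eLpNorm (fun x => ψ x * f x) 2 ≤ c * eLpNorm f 2 := by
  obtain ⟨C, hC⟩ := hc.exists_bound_of_continuous hψ
  refine ⟨ENNReal.ofReal C, ENNReal.ofReal_ne_top, fun f => ?_⟩
  refine eLpNorm_le_mul_eLpNorm_of_ae_le_mul (Eventually.of_forall fun x => ?_) 2
  rw [norm_mul]
  gcongr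
  exact hC x

lemma eLpNorm_comp_Lp_le {M : ℝ} (V : L2V d) (hV : ‖V‖ ≤ |M|) (k : Fin d) :
    eLpNorm (fun x => V x k) 2 ≤ ENNReal.ofReal |M| := by
  refine (eLpNorm_comp_le V _ _ k).trans ?_
  rw [← Lp.enorm_def, ← ofReal_norm]
  exact ENNReal.ofReal_le_ofReal hV

/-- A smooth cutoff function that equals one on a ball and vanishes off a larger ball. -/
lemma exists_cutoff (d : ℕ) (R : ℝ) : ∃ χ : Sp d → ℝ, ContDiff ℝ ∞ χ ∧ HasCompactSupport χ ∧
    (∀ x ∈ Metric.ball (0 : Sp d) R, χ x = 1) ∧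
    ∀ x, x ∉ Metric.ball (0 : Sp d) (|R| + 2) → χ x = 0 := by
  let b : ContDiffBump (0 : Sp d) := ⟨|R| + 1, |R| + 2, by positivity, by linarith⟩
  refine ⟨b, b.contDiff, b.hasCompactSupport, fun x hx => b.one_of_mem_closedBall ?_,
    fun x hx => ?_⟩
  · refine Metric.closedBall_subset_closedBall ?_ (Metric.ball_subset_closedBall hx)
    show R ≤ |R| + 1
    linarith [le_abs_self R]
  · by_contra h
    have : x ∈ Function.support b := h
    rw [b.support_eq] at this
    exact hx this

/-- Fields of bounded norm in `H²(Ω)` are bounded, and their gradients are bounded in `L⁴`. The two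
Sobolev embeddings are applied on the whole space, to the extension and to its gradient, multiplied
by a cutoff function `χ` that equals one on `Ω`. -/
lemma exists_bound_of_H2NormOnLE (hd : d = 2 ∨ d = 3) {Ω : Set (Sp d)} (hΩ : IsOpen Ω)
    (hb : Bornology.IsBounded Ω) (M : ℝ) : ∃ K : ℝ≥0∞, K ≠ ⊤ ∧ ∀ U : L2V d, H2NormOnLE Ω U M →
      (∀ k, eLpNorm (fun x => U x k) ⊤ (volume.restrict Ω) ≤ K) ∧
      ∀ j (g : Sp d → Sp d), MemLp g 2 (volume.restrict Ω) → HasWeakPartial Ω j U g →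
        ∀ k, eLpNorm (fun x => g x k) 4 (volume.restrict Ω) ≤ K := by
  obtain ⟨R, hR⟩ := hb.subset_ball (0 : Sp d)
  obtain ⟨χ, hχ, hχc, hχ1, hχ0⟩ := exists_cutoff d R
  obtain ⟨C4, hC4, h4⟩ := exists_eLpNorm_four_le hd (|R| + 2)
  obtain ⟨CI, hCI, hI⟩ := exists_eLpNorm_top_le hd
  have e1 := contDiff_partial hχ
  have k1 := fun i => hasCompactSupport_partial hχc i
  have e2 := fun i => contDiff_partial (e1 i) i
  have k2 := fun i => hasCompactSupport_partial (k1 i) i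
  obtain ⟨c0, hc0, b0⟩ := exists_eLpNorm_smooth_mul_le hχ.continuous hχc
  choose c1 hc1 b1 using fun i => exists_eLpNorm_smooth_mul_le (e1 i).continuous (k1 i)
  choose c2 hc2 b2 using fun i => exists_eLpNorm_smooth_mul_le (e2 i).continuous (k2 i)
  set m := ENNReal.ofReal |M|
  have hm : m ≠ ⊤ := ENNReal.ofReal_ne_top
  refine ⟨CI * (c0 * m + ∑ i, ((c0 * m + c1 i * m) + (c1 i * m + c2 i * m)))
    + C4 * ∑ i, (c0 * m + c1 i * m), ?_, fun U hU => ?_⟩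
  · have t0 := ENNReal.mul_ne_top hc0 hm
    have t1 := fun i => ENNReal.mul_ne_top (hc1 i) hm
    have t2 := fun i => ENNReal.mul_ne_top (hc2 i) hm
    refine ENNReal.add_ne_top.2 ⟨ENNReal.mul_ne_top hCI (ENNReal.add_ne_top.2 ⟨t0, ?_⟩),
      ENNReal.mul_ne_top hC4 ?_⟩
    · exact ENNReal.sum_ne_top.2 fun i _ => ENNReal.add_ne_top.2
        ⟨ENNReal.add_ne_top.2 ⟨t0, t1 i⟩, ENNReal.add_ne_top.2 ⟨t1 i, t2 i⟩⟩
    · exact ENNReal.sum_ne_top.2 fun i _ => ENNReal.add_ne_top.2 ⟨t0, t1 i⟩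
  · obtain ⟨V, D, D2, hUV, hVD, hDD, hn⟩ := hU
    obtain ⟨nV, nD, nD2⟩ := norm_le_of_sum_sq_le hn
    have hV1 := isH1_comp (Lp.memLp V) (fun i => Lp.memLp (D i)) hVD
    have hD1 := fun j => isH1_comp (Lp.memLp (D j)) (fun i => Lp.memLp (D2 j i)) (hDD j)
    have hχ1' : ∀ᵐ x ∂(volume.restrict Ω), χ x = 1 := by
      rw [ae_restrict_iff' hΩ.measurableSet]
      exact Eventually.of_forall fun x hx => hχ1 x (hR hx)
    constructor
    · intro k
      -- `∂ᵢ(χ V) = χ Dᵢ + (∂ᵢχ) V`, and both summands are products of the same kind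
      have hf := (hV1 k).smooth_mul hχ hχc
      have hg := fun i => ((hD1 i k).smooth_mul hχ hχc)
      have hg' := fun i => ((hV1 k).smooth_mul (e1 i) (k1 i))
      have hw := fun i => ((hg i).weak i).add isOpen_univ ((hg' i).weak i)
        (by rw [Measure.restrict_univ]; exact (hg i).memLp)
        (by rw [Measure.restrict_univ]; exact (hg' i).memLp)
        (by rw [Measure.restrict_univ]; exact (hg i).memLp_partial i)
        (by rw [Measure.restrict_univ]; exact (hg' i).memLp_partial i)
      have hmg := fun i => ((hg i).memLp_partial i).add ((hg' i).memLp_partial i)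
      have := hI (|R| + 2) _ _ _ hf hmg hw (Eventually.of_forall fun x hx => by
        rw [hχ0 x hx, zero_mul])
      refine le_trans ?_ le_self_add
      calc eLpNorm (fun x => U x k) ⊤ (volume.restrict Ω)
          = eLpNorm (fun x => χ x * V x k) ⊤ (volume.restrict Ω) := by
            apply eLpNorm_congr_ae
            filter_upwards [hUV, hχ1'] with x h1 h2
            rw [h1, h2, one_mul]
        _ ≤ eLpNorm (fun x => χ x * V x k) ⊤ volume := eLpNorm_restrict_le _ _ _ _
        _ ≤ _ := this
        _ ≤ _ := by
          gcongr
          refine (eLpNorm_sub_le hf.memLp.1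
            (memLp_finsetSum _ fun i _ => hmg i).1 (by norm_num)).trans ?_
          refine add_le_add ((b0 _).trans (by gcongr; exact eLpNorm_comp_Lp_le V nV k)) ?_
          have es : (fun x => ∑ i, (((fun x => χ x * D2 i i x k + fderiv ℝ χ x
              (EuclideanSpace.single i (1 : ℝ)) * D i x k) + fun x => fderiv ℝ χ x
              (EuclideanSpace.single i (1 : ℝ)) * D i x k + fderiv ℝ (fun x => fderiv ℝ χ x
              (EuclideanSpace.single i (1 : ℝ))) x (EuclideanSpace.single i (1 : ℝ)) *
              V x k) : Sp d → ℝ) x)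
              = ∑ i, ((fun x => χ x * D2 i i x k + fderiv ℝ χ x
              (EuclideanSpace.single i (1 : ℝ)) * D i x k) + fun x => fderiv ℝ χ x
              (EuclideanSpace.single i (1 : ℝ)) * D i x k + fderiv ℝ (fun x => fderiv ℝ χ x
              (EuclideanSpace.single i (1 : ℝ))) x (EuclideanSpace.single i (1 : ℝ)) * V x k) := by
            ext x; simp
          refine (le_of_eq (congrArg (fun f => eLpNorm f 2 volume) es)).trans ?_
          refine (eLpNorm_sum_le (fun i _ => (hmg i).1) (by norm_num)).trans ?_
          refine Finset.sum_le_sum fun i _ => ?_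
          refine (eLpNorm_add_le ((hg i).memLp_partial i).1 ((hg' i).memLp_partial i).1
            (by norm_num)).trans (add_le_add ?_ ?_)
          · refine (eLpNorm_add_le
              (memLp_smooth_mul hχ.continuous hχc ((hD1 i k).memLp_partial i)).1
              (memLp_smooth_mul (e1 i).continuous (k1 i) (hD1 i k).memLp).1
              (by norm_num)).trans (add_le_add ?_ ?_)
            · exact (b0 _).trans (by gcongr; exact eLpNorm_comp_Lp_le _ (nD2 i i) k)
            · exact (b1 i _).trans (by gcongr; exact eLpNorm_comp_Lp_le _ (nD i) k)
          · refine (eLpNorm_add_le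
              (memLp_smooth_mul (e1 i).continuous (k1 i) ((hV1 k).memLp_partial i)).1
              (memLp_smooth_mul (e2 i).continuous (k2 i) (hV1 k).memLp).1
              (by norm_num)).trans (add_le_add ?_ ?_)
            · exact (b1 i _).trans (by gcongr; exact eLpNorm_comp_Lp_le _ (nD i) k)
            · exact (b2 i _).trans (by gcongr; exact eLpNorm_comp_Lp_le _ nV k)
    · intro j g hg hUg k
      have hgD : g =ᵐ[volume.restrict Ω] D j :=
        hUg.ae_unique hΩ (((hVD j).mono (subset_univ Ω)).congr hΩ hUV.symm (ae_eq_refl _)) hg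
          ((Lp.memLp (D j)).restrict Ω)
      have hf := (hD1 j k).smooth_mul hχ hχc
      have := h4 _ _ hf (Eventually.of_forall fun x hx => by rw [hχ0 x hx, zero_mul])
      refine le_trans ?_ le_add_self
      calc eLpNorm (fun x => g x k) 4 (volume.restrict Ω)
          = eLpNorm (fun x => χ x * D j x k) 4 (volume.restrict Ω) := by
            apply eLpNorm_congr_ae
            filter_upwards [hgD, hχ1'] with x h1 h2
            rw [h1, h2, one_mul]
        _ ≤ eLpNorm (fun x => χ x * D j x k) 4 volume := eLpNorm_restrict_le _ _ _ _
        _ ≤ _ := this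
        _ ≤ _ := by
          gcongr with i
          refine (eLpNorm_add_le
            (memLp_smooth_mul hχ.continuous hχc ((hD1 j k).memLp_partial i)).1
            (memLp_smooth_mul (e1 i).continuous (k1 i) (hD1 j k).memLp).1
            (by norm_num)).trans (add_le_add ?_ ?_)
          · exact (b0 _).trans (by gcongr; exact eLpNorm_comp_Lp_le _ (nD2 j i) k)
          · exact (b1 i _).trans (by gcongr; exact eLpNorm_comp_Lp_le _ (nD j) k)

/-! ### The trilinear form -/

lemma convIntegrand_eq_sum (u v w : L2V d) (x : Sp d) :
    convIntegrand u v w x = ∑ j, ∑ k, u x j * (weakPartial univ j v x k * w x k) := by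
  unfold convIntegrand
  rw [sum_inner]
  refine Finset.sum_congr rfl fun j _ => ?_
  rw [real_inner_smul_left, PiLp.inner_apply, Finset.mul_sum]
  refine Finset.sum_congr rfl fun k _ => ?_
  simp [mul_comm]

instance holderTriple_four_four_two : ENNReal.HolderTriple 4 4 2 where
  inv_add_inv_eq_inv := by
    rw [← two_mul, show (4 : ℝ≥0∞) = 2 * 2 by norm_num, ENNReal.mul_inv (by simp) (by simp),
      ← mul_assoc, ENNReal.mul_inv_cancel (by simp) (by simp), one_mul]

lemma eLpNorm_mul_mul_le {p q : ℝ≥0∞} [ENNReal.HolderTriple p q 2] {a b c : Sp d → ℝ}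
    (ha : AEStronglyMeasurable a volume) (hb : AEStronglyMeasurable b volume)
    (hc : AEStronglyMeasurable c volume) :
    eLpNorm (fun x => a x * (b x * c x)) 1 volume ≤
      eLpNorm a 2 volume * (eLpNorm b p volume * eLpNorm c q volume) := by
  have h1 := eLpNorm_smul_le_mul_eLpNorm (p := 2) (q := 2) (r := 1) (hb.mul hc) ha
  have h2 := eLpNorm_smul_le_mul_eLpNorm (p := p) (q := q) (r := 2) hc hb
  exact h1.trans (mul_le_mul_right h2 _)

/-- Fields of the velocity space are in `L⁴`, with norm controlled by the weak gradient. -/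
lemma exists_MemX_eLpNorm_four_le (hd : d = 2 ∨ d = 3) {Ω : Set (Sp d)} (hΩ : IsOpen Ω)
    (hb : Bornology.IsBounded Ω) (α : ℝ) : ∃ C : ℝ≥0∞, C ≠ ⊤ ∧ ∀ v : L2V d, MemX α Ω v →
      ∀ k, eLpNorm (fun x => v x k) 4 ≤ C * ENNReal.ofReal (√(gradForm Ω v v)) := by
  obtain ⟨R, hR⟩ := hb.subset_ball (0 : Sp d)
  obtain ⟨C, hC, h⟩ := exists_eLpNorm_four_le hd R
  refine ⟨C * d, ENNReal.mul_ne_top hC (ENNReal.natCast_ne_top d), fun v hv k => ?_⟩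
  refine (h _ _ (hv.2.1.isH1 k) ?_).trans ?_
  · filter_upwards [hv.2.2] with x hx hxR
    rw [hx fun hxΩ => hxR (hR hxΩ)]
    rfl
  · rw [mul_assoc]
    gcongr
    refine (Finset.sum_le_sum fun i _ => hv.eLpNorm_weakPartial_le hΩ.measurableSet i k).trans ?_
    simp

/-- The bounds in `H²(Ω)` hold on the whole space for a field that vanishes off `Ω`. -/
lemma exists_MemX_bound (hd : d = 2 ∨ d = 3) {Ω : Set (Sp d)} (hΩ : IsOpen Ω)
    (hb : Bornology.IsBounded Ω) (α M : ℝ) : ∃ K : ℝ≥0∞, K ≠ ⊤ ∧ ∀ U : L2V d, MemX α Ω U →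
      H2NormOnLE Ω U M → (∀ k, eLpNorm (fun x => U x k) ⊤ ≤ K) ∧
      ∀ j k, eLpNorm (fun x => weakPartial univ j U x k) 4 ≤ K := by
  obtain ⟨K, hK, h⟩ := exists_bound_of_H2NormOnLE hd hΩ hb M
  refine ⟨K, hK, fun U hU hUM => ⟨fun k => ?_, fun j k => ?_⟩⟩
  · rw [← eLpNorm_restrict_eq_of_ae_eq_zero hΩ.measurableSet (by
      filter_upwards [hU.ae_eq_zero] with x hx hxΩ
      rw [(hx hxΩ).1]; rfl)]
    exact (h U hUM).1 k
  · rw [← eLpNorm_restrict_eq_of_ae_eq_zero hΩ.measurableSet (by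
      filter_upwards [hU.ae_eq_zero] with x hx hxΩ
      rw [(hx hxΩ).2]; rfl)]
    exact (h U hUM).2 j _ ((hU.2.1.memLp_weakPartial j).restrict Ω)
      ((hU.2.1.hasWeakPartial j).mono (subset_univ Ω)) k

/-- The two convective integrands with a second or third argument `U` of bounded norm in `H²(Ω)`,
by Hölder's inequality: `(z · ∇)U · v` is estimated in `L² · L⁴ · L⁴`, and `(z · ∇)v · U` in
`L² · L² · L^∞`. -/
lemma exists_eLpNorm_convIntegrand_le (hd : d = 2 ∨ d = 3) {Ω : Set (Sp d)} (hΩ : IsOpen Ω)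
    (hb : Bornology.IsBounded Ω) (α M : ℝ) : ∃ K : ℝ≥0∞, K ≠ ⊤ ∧ ∀ U : L2V d, MemX α Ω U →
      H2NormOnLE Ω U M → ∀ z v : L2V d, MemX α Ω v →
      eLpNorm (convIntegrand z U v) 1 ≤ K * (‖z‖ₑ * ENNReal.ofReal (√(gradForm Ω v v))) ∧
      eLpNorm (convIntegrand z v U) 1 ≤ K * (‖z‖ₑ * ENNReal.ofReal (√(gradForm Ω v v))) := by
  obtain ⟨K, hK, h⟩ := exists_MemX_bound hd hΩ hb α M
  obtain ⟨C, hC, hv4⟩ := exists_MemX_eLpNorm_four_le hd hΩ hb α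
  have sum_le : ∀ (F : Fin d → Fin d → Sp d → ℝ) (B : ℝ≥0∞),
      (∀ j k, AEStronglyMeasurable (F j k) volume) → (∀ j k, eLpNorm (F j k) 1 volume ≤ B) →
      eLpNorm (fun x => ∑ j, ∑ k, F j k x) 1 volume ≤ (d * d : ℝ≥0∞) * B := by
    intro F B hF hB
    have e : (fun x => ∑ j, ∑ k, F j k x) = ∑ j, ∑ k, F j k := by ext x; simp
    rw [e]
    refine (eLpNorm_sum_le (fun j _ => Finset.aestronglyMeasurable_sum _ fun k _ => hF j k)
      le_rfl).trans ?_
    refine (Finset.sum_le_sum fun j _ => (eLpNorm_sum_le (fun k _ => hF j k) le_rfl).trans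
      (Finset.sum_le_sum fun k _ => hB j k)).trans (le_of_eq ?_)
    simp [mul_assoc]
  have hz : ∀ (z : L2V d) j, eLpNorm (fun x => z x j) 2 ≤ ‖z‖ₑ := fun z j =>
    (eLpNorm_comp_le z _ _ j).trans (le_of_eq (Lp.enorm_def z).symm)
  refine ⟨(d * d : ℝ≥0∞) * (K * C) + (d * d : ℝ≥0∞) * K, ?_, fun U hU hUM z v hv => ?_⟩
  · have hdd : (d * d : ℝ≥0∞) ≠ ⊤ :=
      ENNReal.mul_ne_top (ENNReal.natCast_ne_top d) (ENNReal.natCast_ne_top d)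
    exact ENNReal.add_ne_top.2 ⟨ENNReal.mul_ne_top hdd (ENNReal.mul_ne_top hK hC),
      ENNReal.mul_ne_top hdd hK⟩
  · obtain ⟨hUI, hU4⟩ := h U hU hUM
    have mz := fun j => (memLp_comp (Lp.memLp z) j).1
    have mU := fun k => (memLp_comp (Lp.memLp U) k).1
    have mv := fun k => (memLp_comp (Lp.memLp v) k).1
    have mUd := fun j k => (memLp_comp (hU.2.1.memLp_weakPartial j) k).1
    have mvd := fun j k => (memLp_comp (hv.2.1.memLp_weakPartial j) k).1
    constructor
    · simp_rw [funext fun x => convIntegrand_eq_sum z U v x]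
      refine (sum_le _ (‖z‖ₑ * (K * (C * ENNReal.ofReal (√(gradForm Ω v v)))))
        (fun j k => (mz j).mul ((mUd j k).mul (mv k))) fun j k => ?_).trans ?_
      · exact (eLpNorm_mul_mul_le (p := 4) (q := 4) (mz j) (mUd j k) (mv k)).trans
          (mul_le_mul' (hz z j) (mul_le_mul' (hU4 j k) (hv4 v hv k)))
      · rw [add_mul]
        refine le_trans (le_of_eq ?_) le_self_add
        ring
    · simp_rw [funext fun x => convIntegrand_eq_sum z v U x]
      refine (sum_le _ (‖z‖ₑ * (ENNReal.ofReal (√(gradForm Ω v v)) * K))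
        (fun j k => (mz j).mul ((mvd j k).mul (mU k))) fun j k => ?_).trans ?_
      · exact (eLpNorm_mul_mul_le (p := 2) (q := ⊤) (mz j) (mvd j k) (mU k)).trans
          (mul_le_mul' (hz z j) (mul_le_mul'
            (hv.eLpNorm_weakPartial_le hΩ.measurableSet j k) (hUI k)))
      · rw [add_mul]
        refine le_trans (le_of_eq ?_) le_add_self
        ring

lemma aestronglyMeasurable_convIntegrand {u v w : L2V d} (hv : MemH1 v) :
    AEStronglyMeasurable (convIntegrand u v w) volume := by
  rw [funext fun x => convIntegrand_eq_sum u v w x]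
  exact Finset.aestronglyMeasurable_fun_sum _ fun j _ =>
    Finset.aestronglyMeasurable_fun_sum _ fun k _ =>
    (memLp_comp (Lp.memLp u) j).1.mul
      ((memLp_comp (hv.memLp_weakPartial j) k).1.mul (memLp_comp (Lp.memLp w) k).1)

/-- The convective integrands are integrable, and the trilinear form with a second argument of
bounded norm in `H²(Ω)` is bounded by the `L²` norm of the first argument and the `H¹` seminorm
of the third. -/
lemma exists_skewForm_bound (hd : d = 2 ∨ d = 3) {Ω : Set (Sp d)} (hΩ : IsOpen Ω)
    (hb : Bornology.IsBounded Ω) (α M : ℝ) : ∃ K : ℝ, 0 ≤ K ∧ ∀ U : L2V d, MemX α Ω U →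
      H2NormOnLE Ω U M → ∀ z v : L2V d, MemX α Ω v →
      Integrable (convIntegrand z U v) ∧ Integrable (convIntegrand z v U) ∧
      |skewForm Ω z U v| ≤ K * ‖z‖ * √(gradForm Ω v v) := by
  obtain ⟨K, hK, h⟩ := exists_eLpNorm_convIntegrand_le hd hΩ hb α M
  refine ⟨K.toReal, ENNReal.toReal_nonneg, fun U hU hUM z v hv => ?_⟩
  obtain ⟨h1, h2⟩ := h U hU hUM z v hv
  have hfin : K * (‖z‖ₑ * ENNReal.ofReal (√(gradForm Ω v v))) ≠ ⊤ :=
    ENNReal.mul_ne_top hK (ENNReal.mul_ne_top enorm_ne_top ENNReal.ofReal_ne_top)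
  have hreal : (K * (‖z‖ₑ * ENNReal.ofReal (√(gradForm Ω v v)))).toReal
      = K.toReal * ‖z‖ * √(gradForm Ω v v) := by
    rw [ENNReal.toReal_mul, ENNReal.toReal_mul, toReal_enorm,
      ENNReal.toReal_ofReal (Real.sqrt_nonneg _), mul_assoc]
  have bound : ∀ {F : Sp d → ℝ}, eLpNorm F 1 ≤ K * (‖z‖ₑ * ENNReal.ofReal (√(gradForm Ω v v))) →
      |∫ x in Ω, F x| ≤ K.toReal * ‖z‖ * √(gradForm Ω v v) := by
    intro F hF
    rw [← hreal, ← Real.norm_eq_abs, ← toReal_enorm]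
    refine ENNReal.toReal_mono hfin ((enorm_integral_le_lintegral_enorm _).trans ?_)
    rw [← eLpNorm_one_eq_lintegral_enorm]
    exact (eLpNorm_restrict_le _ _ _ _).trans hF
  refine ⟨memLp_one_iff_integrable.1 ⟨aestronglyMeasurable_convIntegrand hU.2.1,
    h1.trans_lt hfin.lt_top⟩, memLp_one_iff_integrable.1
    ⟨aestronglyMeasurable_convIntegrand hv.2.1, h2.trans_lt hfin.lt_top⟩, ?_⟩
  have b1 := abs_le.1 (bound h1)
  have b2 := abs_le.1 (bound h2)
  unfold skewForm
  rw [abs_le]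
  constructor <;> linarith [b1.1, b1.2, b2.1, b2.2]

lemma skewForm_sub_left {Ω : Set (Sp d)} {z z' U v : L2V d}
    (h1 : Integrable (convIntegrand z U v)) (h2 : Integrable (convIntegrand z v U))
    (h1' : Integrable (convIntegrand z' U v)) (h2' : Integrable (convIntegrand z' v U)) :
    skewForm Ω (z - z') U v = skewForm Ω z U v - skewForm Ω z' U v := by
  have key : ∀ a b : L2V d, (∫ x in Ω, convIntegrand (z - z') a b x)
      = ∫ x in Ω, (convIntegrand z a b x - convIntegrand z' a b x) := by
    intro a b
    apply integral_congr_ae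
    filter_upwards [ae_restrict_of_ae (Lp.coeFn_sub z z')] with x hx
    simp only [convIntegrand, hx, Pi.sub_apply, PiLp.sub_apply, sub_smul,
      Finset.sum_sub_distrib, inner_sub_left]
  unfold skewForm
  rw [key, key, integral_sub h1.restrict h1'.restrict, integral_sub h2.restrict h2'.restrict]
  ring

/-- Skew symmetry: the third argument can be subtracted from the second. The term that cancels
contains the integral of `(z · ∇)v · v`, which converges by the hypothesis on `w`. -/
lemma skewForm_sub_self {Ω : Set (Sp d)} {z U v w : L2V d} (hU : MemH1 U)
    (hw : v = U - w) (hwH : MemH1 w)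
    (h1 : Integrable (convIntegrand z U v)) (h2 : Integrable (convIntegrand z v U))
    (h3 : IntegrableOn (convIntegrand z w v) Ω) :
    skewForm Ω z w v = skewForm Ω z U v := by
  have e1 : ∀ᵐ x, convIntegrand z w v x = convIntegrand z U v x - convIntegrand z v v x := by
    have := (hU.sub hwH).2
    simp_rw [← hw] at this
    filter_upwards [ae_all_iff.2 this] with x hx
    simp only [convIntegrand, hx, smul_sub, Finset.sum_sub_distrib, inner_sub_left]
    ring
  have e2 : ∀ᵐ x, convIntegrand z v w x = convIntegrand z v U x - convIntegrand z v v x := by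
    have := Lp.coeFn_sub U w
    rw [← hw] at this
    filter_upwards [this] with x hx
    simp only [convIntegrand]
    rw [hx, Pi.sub_apply, inner_sub_right]
    ring
  have i3 : IntegrableOn (convIntegrand z v v) Ω := by
    refine (h1.restrict.sub h3).congr ?_
    filter_upwards [ae_restrict_of_ae e1] with x hx
    simp [hx]
  unfold skewForm
  rw [integral_congr_ae (ae_restrict_of_ae e1), integral_congr_ae (ae_restrict_of_ae e2),
    integral_sub h1.restrict i3, integral_sub h2.restrict i3]
  ring

/-! ### The variational form of the continuous problem -/

lemma setIntegral_inner_eq_sum {Ω : Set (Sp d)} {f g : Sp d → Sp d}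
    (hf : MemLp f 2 (volume.restrict Ω)) (hg : MemLp g 2 (volume.restrict Ω)) :
    ∫ x in Ω, ⟪f x, g x⟫ = ∑ k, ∫ x in Ω, g x k * f x k := by
  rw [← integral_finsetSum _ fun k _ =>
    integrable_mul_of_memLp_two (memLp_comp hg k) (memLp_comp hf k)]
  rfl

/-- Integration by parts on `Ω` against a field `v` of the velocity space: no boundary term
appears, since `v` and its weak gradient vanish off `Ω`. -/
lemma MemX.setIntegral_mul_partial {α : ℝ} {Ω : Set (Sp d)} (hb : Bornology.IsBounded Ω)
    {v : L2V d} (hv : MemX α Ω v) {f : Sp d → ℝ}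
    {g : Fin d → Sp d → ℝ} (h : IsH1 f g) (i k : Fin d) :
    ∫ x in Ω, v x k * g i x = - ∫ x in Ω, weakPartial univ i v x k * f x := by
  obtain ⟨R, hR⟩ := hb.subset_ball (0 : Sp d)
  rw [setIntegral_eq_integral_of_ae_compl_eq_zero, setIntegral_eq_integral_of_ae_compl_eq_zero]
  · refine (hv.2.1.isH1 k).integral_mul_partial h (R := R) ?_ i
    filter_upwards [hv.2.2] with x hx hxR
    rw [hx fun hxΩ => hxR (hR hxΩ)]
    rfl
  · filter_upwards [hv.ae_eq_zero] with x hx hxΩ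
    rw [(hx hxΩ).2]
    simp
  · filter_upwards [hv.ae_eq_zero] with x hx hxΩ
    rw [(hx hxΩ).1]
    simp

lemma MemX.memLp_restrict {α : ℝ} {Ω : Set (Sp d)} {v : L2V d} (hv : MemX α Ω v) (i : Fin d) :
    MemLp (weakPartial univ i v) 2 (volume.restrict Ω) :=
  (hv.2.1.memLp_weakPartial i).restrict Ω

lemma gradForm_eq_sum {Ω : Set (Sp d)} {v w : L2V d} (hv : MemH1 v) (hw : MemH1 w) :
    gradForm Ω v w = ∑ i, ∫ x in Ω, ⟪weakPartial univ i v x, weakPartial univ i w x⟫ := by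
  unfold gradForm
  rw [integral_finsetSum]
  exact fun i _ => (integrable_inner_of_memLp_two (hv.memLp_weakPartial i)
    (hw.memLp_weakPartial i)).restrict

/-- The Laplacian of a field in `H²(Ω)`, tested with a field of the velocity space. The derivatives
on `Ω` are replaced by those of an extension in `H²(ℝ^d)`, for which the integration by parts is
carried out on the whole space. -/
lemma integral_laplacian {α : ℝ} {Ω : Set (Sp d)} (hΩ : IsOpen Ω)
    (hb : Bornology.IsBounded Ω) {U v : L2V d} (hU : MemX α Ω U) (hH : MemH2On Ω U)
    (hv : MemX α Ω v) :
    MemLp (fun x => ∑ j, weakPartial Ω j (weakPartial Ω j U) x) 2 (volume.restrict Ω) ∧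
    ∫ x in Ω, ⟪∑ j, weakPartial Ω j (weakPartial Ω j U) x, v x⟫ = - gradForm Ω U v := by
  obtain ⟨M, V, D, D2, hUV, hVD, hDD, -⟩ := hH
  have hr : ∀ w : L2V d, MemLp w 2 (volume.restrict Ω) := fun w => (Lp.memLp w).restrict Ω
  have hUD : ∀ j, HasWeakPartial Ω j U (D j) := fun j =>
    ((hVD j).mono (subset_univ Ω)).congr hΩ hUV.symm (ae_eq_refl _)
  have h1 : ∀ j, weakPartial Ω j U =ᵐ[volume.restrict Ω] D j := fun j =>
    weakPartial_ae_eq hΩ (hr _) (hUD j)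
  have h1' : ∀ j, weakPartial univ j U =ᵐ[volume.restrict Ω] D j := fun j =>
    ((hU.2.1.hasWeakPartial j).mono (subset_univ Ω)).ae_unique hΩ (hUD j)
      (hU.memLp_restrict j) (hr _)
  have h2 : ∀ j, weakPartial Ω j (weakPartial Ω j U) =ᵐ[volume.restrict Ω] D2 j j := fun j =>
    weakPartial_ae_eq hΩ (hr _)
      (((hDD j j).mono (subset_univ Ω)).congr hΩ (h1 j).symm (ae_eq_refl _))
  have hm : ∀ j, MemLp (weakPartial Ω j (weakPartial Ω j U)) 2 (volume.restrict Ω) :=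
    fun j => (hr (D2 j j)).ae_eq (h2 j).symm
  refine ⟨memLp_finsetSum _ fun j _ => hm j, ?_⟩
  simp_rw [sum_inner]
  rw [integral_finsetSum _ fun j _ => integrable_inner_of_memLp_two (hm j) (hr v),
    gradForm_eq_sum hU.2.1 hv.2.1, ← Finset.sum_neg_distrib]
  refine Finset.sum_congr rfl fun j _ => ?_
  have a1 : ∫ x in Ω, ⟪weakPartial Ω j (weakPartial Ω j U) x, v x⟫
      = ∫ x in Ω, ⟪D2 j j x, v x⟫ := by
    apply integral_congr_ae
    filter_upwards [h2 j] with x hx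
    rw [hx]
  have a2 : ∫ x in Ω, ⟪weakPartial univ j U x, weakPartial univ j v x⟫
      = ∫ x in Ω, ⟪D j x, weakPartial univ j v x⟫ := by
    apply integral_congr_ae
    filter_upwards [h1' j] with x hx
    rw [hx]
  rw [a1, a2, setIntegral_inner_eq_sum (hr _) (hr v),
    setIntegral_inner_eq_sum (hr _) (hv.memLp_restrict j), ← Finset.sum_neg_distrib]
  refine Finset.sum_congr rfl fun k _ => ?_
  exact hv.setIntegral_mul_partial hb (isH1_comp (Lp.memLp (D j))
    (fun i => Lp.memLp (D2 j i)) (hDD j) k) j k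

/-- The pressure gradient is orthogonal to divergence free fields of the velocity space. -/
lemma integral_pressure {α : ℝ} {Ω : Set (Sp d)} (hΩ : IsOpen Ω)
    (hb : Bornology.IsBounded Ω) {v : L2V d} (hv : MemX α Ω v) {p : L2On Ω} (hp : MemH1On Ω p)
    (hdiv : ∀ᵐ x ∂(volume.restrict Ω), divergence v x = 0) :
    MemLp (fun x => ∑ j, weakPartial Ω j p x • (EuclideanSpace.single j (1 : ℝ) : Sp d)) 2
      (volume.restrict Ω) ∧
    ∫ x in Ω, ⟪∑ j, weakPartial Ω j p x • (EuclideanSpace.single j (1 : ℝ) : Sp d), v x⟫ = 0 := by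
  obtain ⟨P, D, hpP, hPD⟩ := hp
  have hr : ∀ w : Lp ℝ 2 (volume : Measure (Sp d)), MemLp w 2 (volume.restrict Ω) :=
    fun w => (Lp.memLp w).restrict Ω
  have hvr : MemLp v 2 (volume.restrict Ω) := (Lp.memLp v).restrict Ω
  have h2 : ∀ j, weakPartial Ω j p =ᵐ[volume.restrict Ω] D j := fun j =>
    weakPartial_ae_eq hΩ (hr _)
      (((hPD j).mono (subset_univ Ω)).congr hΩ hpP.symm (ae_eq_refl _))
  have hm : ∀ j, MemLp (weakPartial Ω j p) 2 (volume.restrict Ω) :=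
    fun j => (hr (D j)).ae_eq (h2 j).symm
  have hP : IsH1 P fun j => D j := ⟨Lp.memLp P, fun j => Lp.memLp (D j), hPD⟩
  constructor
  · refine memLp_finsetSum _ fun j _ => ?_
    refine MemLp.of_le (hm j) ((hm j).1.smul aestronglyMeasurable_const)
      (Eventually.of_forall fun x => ?_)
    rw [norm_smul]
    simp
  · simp_rw [sum_inner, real_inner_smul_left, EuclideanSpace.inner_single_left]
    have i1 : ∀ j, Integrable (fun x => v x j * D j x) (volume.restrict Ω) := fun j =>
      integrable_mul_of_memLp_two (memLp_comp hvr j) (hr _)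
    have i2 : ∀ j, Integrable (fun x => weakPartial univ j v x j * P x) (volume.restrict Ω) :=
      fun j => integrable_mul_of_memLp_two (memLp_comp (hv.memLp_restrict j) j) (hr _)
    calc ∫ x in Ω, ∑ j, weakPartial Ω j p x * ((starRingEnd ℝ) 1 * v x j)
        = ∫ x in Ω, ∑ j, v x j * D j x := by
          apply integral_congr_ae
          filter_upwards [ae_all_iff.2 h2] with x hx
          refine Finset.sum_congr rfl fun j _ => ?_
          rw [hx]
          simp [mul_comm]
      _ = ∑ j, ∫ x in Ω, v x j * D j x := integral_finsetSum _ fun j _ => i1 j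
      _ = ∑ j, - ∫ x in Ω, weakPartial univ j v x j * P x :=
          Finset.sum_congr rfl fun j _ => hv.setIntegral_mul_partial hb hP j j
      _ = - ∫ x in Ω, divergence v x * P x := by
          rw [Finset.sum_neg_distrib, ← integral_finsetSum _ fun j _ => i2 j]
          simp only [divergence, Finset.sum_mul]
      _ = 0 := by
          rw [neg_eq_zero]
          apply integral_eq_zero_of_ae
          filter_upwards [hdiv] with x hx
          simp [hx]

/-- For a bounded divergence free field `U` the skew symmetric form is the convective form: the sum
of the two convective integrals is `∫ (U · ∇)(U · v) = - ∫ (U · v) (∇ · U) = 0`. -/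
lemma skewForm_eq_of_divergence_eq_zero {α : ℝ} {Ω : Set (Sp d)}
    (hb : Bornology.IsBounded Ω) {U v : L2V d} (hU : MemX α Ω U) (hv : MemX α Ω v)
    (hUI : ∀ k, MemLp (fun x => U x k) ⊤) (hU4 : ∀ j k, MemLp (fun x => weakPartial univ j U x k) 4)
    (hv4 : ∀ k, MemLp (fun x => v x k) 4)
    (h1 : Integrable (convIntegrand U U v)) (h2 : Integrable (convIntegrand U v U))
    (hdiv : ∀ᵐ x ∂(volume.restrict Ω), divergence U x = 0) :
    skewForm Ω U U v = ∫ x in Ω, convIntegrand U U v x := by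
  have hUk := hU.2.1.isH1
  have hvk := hv.2.1.isH1
  have hprod := fun k => (hUk k).mul (hvk k) ((hvk k).memLp.mul' (hUI k))
    (fun i => (((hvk k).memLp_partial i).mul' (hUI k)).add ((hv4 k).mul' (hU4 i k)))
  obtain ⟨R, hR⟩ := hb.subset_ball (0 : Sp d)
  have hibp : ∀ j k, ∫ x, U x k * v x k * weakPartial univ j U x j
      = - ∫ x, (U x k * weakPartial univ j v x k + weakPartial univ j U x k * v x k) * U x j :=
    fun j k => (hprod k).integral_mul_partial (hUk j) (R := R) (by
      filter_upwards [hv.2.2] with x hx hxR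
      rw [hx fun hxΩ => hxR (hR hxΩ)]
      simp) j
  have i1 : ∀ j k, Integrable fun x => U x k * v x k * weakPartial univ j U x j := fun j k =>
    integrable_mul_of_memLp_two (hprod k).memLp ((hUk j).memLp_partial j)
  have i2 : ∀ j k, Integrable fun x =>
      (U x k * weakPartial univ j v x k + weakPartial univ j U x k * v x k) * U x j := fun j k =>
    integrable_mul_of_memLp_two ((hprod k).memLp_partial j) (hUk j).memLp
  have hsum : (∫ x in Ω, convIntegrand U U v x) + ∫ x in Ω, convIntegrand U v U x = 0 := by
    rw [← integral_add h1.restrict h2.restrict, setIntegral_eq_integral_of_ae_compl_eq_zero]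
    · calc ∫ x, (convIntegrand U U v x + convIntegrand U v U x)
          = ∫ x, ∑ j, ∑ k,
            (U x k * weakPartial univ j v x k + weakPartial univ j U x k * v x k) * U x j := by
            congr 1
            ext x
            rw [convIntegrand_eq_sum, convIntegrand_eq_sum, ← Finset.sum_add_distrib]
            refine Finset.sum_congr rfl fun j _ => ?_
            rw [← Finset.sum_add_distrib]
            refine Finset.sum_congr rfl fun k _ => ?_
            ring
        _ = ∑ j, ∑ k, - ∫ x, U x k * v x k * weakPartial univ j U x j := by
            rw [integral_finsetSum _ fun j _ => integrable_finsetSum _ fun k _ => i2 j k]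
            refine Finset.sum_congr rfl fun j _ => ?_
            rw [integral_finsetSum _ fun k _ => i2 j k]
            refine Finset.sum_congr rfl fun k _ => ?_
            rw [hibp, neg_neg]
        _ = - ∫ x, ∑ j, ∑ k, U x k * v x k * weakPartial univ j U x j := by
            rw [integral_finsetSum _ fun j _ => integrable_finsetSum _ fun k _ => i1 j k,
              ← Finset.sum_neg_distrib]
            refine Finset.sum_congr rfl fun j _ => ?_
            rw [integral_finsetSum _ fun k _ => i1 j k, ← Finset.sum_neg_distrib]
        _ = - ∫ x, (∑ k, U x k * v x k) * divergence U x := by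
            congr 2
            ext x
            simp only [divergence, Finset.sum_mul_sum]
            rw [Finset.sum_comm]
        _ = 0 := by
            rw [neg_eq_zero]
            rw [← setIntegral_eq_integral_of_ae_compl_eq_zero (s := Ω)]
            · apply integral_eq_zero_of_ae
              filter_upwards [hdiv] with x hx
              simp [hx]
            · filter_upwards [hv.2.2] with x hx hxΩ
              simp [hx hxΩ]
    · filter_upwards [hv.ae_eq_zero] with x hx hxΩ
      simp [convIntegrand, (hx hxΩ).1, (hx hxΩ).2]
  unfold skewForm
  linarith

/-- The variational form of the momentum equation at a fixed time. -/
lemma variational_of_momentum (hd : d = 2 ∨ d = 3) {ν γ α : ℝ} {Ω : Set (Sp d)} (hΩ : IsOpen Ω)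
    (hb : Bornology.IsBounded Ω) {U a A v : L2V d} {f : L2VOn Ω} {p : L2On Ω}
    (hU : MemX α Ω U) (hH : MemH2On Ω U) (hp : MemH1On Ω p)
    (hdiv : ∀ᵐ x ∂(volume.restrict Ω), divergence U x = 0)
    (hmom : ∀ᵐ x ∂(volume.restrict Ω),
      a x + ∑ j, (U x j) • weakPartial Ω j U x - ν • ∑ j, weakPartial Ω j (weakPartial Ω j U) x
      + γ • A x + ∑ j, weakPartial Ω j p x • EuclideanSpace.single j (1 : ℝ) = f x)
    (hv : MemX α Ω v) (hdv : ∀ᵐ x ∂(volume.restrict Ω), divergence v x = 0) :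
    (∫ x in Ω, ⟪a x, v x⟫) + skewForm Ω U U v + ν * gradForm Ω U v + γ * (∫ x in Ω, ⟪A x, v x⟫)
      = ∫ x in Ω, ⟪f x, v x⟫ := by
  obtain ⟨M, hM⟩ := hH
  obtain ⟨K, hK, hKU⟩ := exists_MemX_bound hd hΩ hb α M
  obtain ⟨hUI, hU4⟩ := hKU U hU hM
  obtain ⟨C, hC, hC4⟩ := exists_MemX_eLpNorm_four_le hd hΩ hb α
  obtain ⟨K', -, hK'⟩ := exists_skewForm_bound hd hΩ hb α M
  obtain ⟨i1, i2, -⟩ := hK' U hU hM U v hv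
  rw [skewForm_eq_of_divergence_eq_zero hb hU hv
    (fun k => ⟨(memLp_comp (Lp.memLp U) k).1, (hUI k).trans_lt hK.lt_top⟩)
    (fun j k => ⟨(memLp_comp (hU.2.1.memLp_weakPartial j) k).1, (hU4 j k).trans_lt hK.lt_top⟩)
    (fun k => ⟨(memLp_comp (Lp.memLp v) k).1, (hC4 v hv k).trans_lt
      (ENNReal.mul_lt_top hC.lt_top ENNReal.ofReal_lt_top)⟩) i1 i2 hdiv]
  obtain ⟨mL, eL⟩ := integral_laplacian hΩ hb hU ⟨M, hM⟩ hv
  obtain ⟨mP, eP⟩ := integral_pressure hΩ hb hv hp hdv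
  have hr : ∀ w : L2V d, MemLp w 2 (volume.restrict Ω) := fun w => (Lp.memLp w).restrict Ω
  have hwp : ∀ j, weakPartial Ω j U =ᵐ[volume.restrict Ω] weakPartial univ j U := fun j =>
    weakPartial_ae_eq hΩ (hU.memLp_restrict j)
      ((hU.2.1.hasWeakPartial j).mono (subset_univ Ω))
  have j1 := integrable_inner_of_memLp_two (hr a) (hr v)
  have j2 := integrable_inner_of_memLp_two (hr A) (hr v)
  have j3 := integrable_inner_of_memLp_two mL (hr v)
  have j4 := integrable_inner_of_memLp_two mP (hr v)
  have key : ∫ x in Ω, ⟪f x, v x⟫ = ∫ x in Ω, (⟪a x, v x⟫ + convIntegrand U U v x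
      - ν * ⟪∑ j, weakPartial Ω j (weakPartial Ω j U) x, v x⟫ + γ * ⟪A x, v x⟫
      + ⟪∑ j, weakPartial Ω j p x • (EuclideanSpace.single j (1 : ℝ) : Sp d), v x⟫) := by
    apply integral_congr_ae
    filter_upwards [hmom, ae_all_iff.2 hwp] with x hx hwx
    rw [← hx]
    simp only [inner_add_left, inner_sub_left, real_inner_smul_left, convIntegrand, hwx]
  rw [key, integral_add, integral_add, integral_sub, integral_add, integral_const_mul,
    integral_const_mul, eL, eP]
  · ring
  · exact j1
  · exact i1.restrict
  · exact j1.add i1.restrict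
  · exact j3.const_mul ν
  · exact (j1.add i1.restrict).sub (j3.const_mul ν)
  · exact j2.const_mul γ
  · exact ((j1.add i1.restrict).sub (j3.const_mul ν)).add (j2.const_mul γ)
  · exact j4

/-! ### Algebra of the Gagliardo form -/

/-- The difference quotient `(u(x) - u(y)) / |x - y|^{(d + 2α) / 2}`, as a function of `(x, y)`.
The Gagliardo form is the `L²(ℝ^d × ℝ^d)` inner product of difference quotients. -/
noncomputable def diffQuot (α : ℝ) (u : Sp d → Sp d) (z : Sp d × Sp d) : Sp d :=
  (√(‖z.1 - z.2‖ ^ ((d : ℝ) + 2 * α)))⁻¹ • (u z.1 - u z.2)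

lemma inner_diffQuot (α : ℝ) (u v : Sp d → Sp d) (z : Sp d × Sp d) :
    ⟪diffQuot α u z, diffQuot α v z⟫
      = ⟪u z.1 - u z.2, v z.1 - v z.2⟫ / ‖z.1 - z.2‖ ^ ((d : ℝ) + 2 * α) := by
  rw [diffQuot, diffQuot, real_inner_smul_left, real_inner_smul_right, ← mul_assoc, ← mul_inv,
    Real.mul_self_sqrt (by positivity), inv_mul_eq_div]

lemma aestronglyMeasurable_diffQuot (α : ℝ) (u : L2V d) :
    AEStronglyMeasurable (diffQuot α u) volume := by
  have h : Measurable fun z : Sp d × Sp d => (√(‖z.1 - z.2‖ ^ ((d : ℝ) + 2 * α)))⁻¹ :=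
    ((measurable_fst.sub measurable_snd).norm.pow_const _).sqrt.inv
  exact h.aestronglyMeasurable.smul
    ((Lp.aestronglyMeasurable u).comp_fst.sub (Lp.aestronglyMeasurable u).comp_snd)

lemma memHalpha_iff {α : ℝ} {u : L2V d} : MemHalpha α u ↔ MemLp (diffQuot α u) 2 volume := by
  rw [memLp_two_iff_integrable_sq_norm (aestronglyMeasurable_diffQuot α u), MemHalpha]
  simp_rw [← real_inner_self_eq_norm_sq, inner_diffQuot]

lemma gagliardoForm_eq (α : ℝ) (u v : L2V d) :
    gagliardoForm α u v = ∫ z, ⟪diffQuot α u z, diffQuot α v z⟫ := by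
  simp_rw [inner_diffQuot]
  rfl

lemma diffQuot_add (α : ℝ) (u v : L2V d) :
    diffQuot α (u + v : L2V d) =ᵐ[volume] diffQuot α u + diffQuot α v := by
  have h := Lp.coeFn_add u v
  filter_upwards [Measure.quasiMeasurePreserving_fst.ae h,
    Measure.quasiMeasurePreserving_snd.ae h] with z h1 h2
  simp only [Pi.add_apply] at h1 h2 ⊢
  rw [diffQuot, h1, h2, diffQuot, diffQuot, ← smul_add]
  congr 1
  abel

lemma diffQuot_sub (α : ℝ) (u v : L2V d) :
    diffQuot α (u - v : L2V d) =ᵐ[volume] diffQuot α u - diffQuot α v := by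
  have h := Lp.coeFn_sub u v
  filter_upwards [Measure.quasiMeasurePreserving_fst.ae h,
    Measure.quasiMeasurePreserving_snd.ae h] with z h1 h2
  simp only [Pi.sub_apply] at h1 h2 ⊢
  rw [diffQuot, h1, h2, diffQuot, diffQuot, ← smul_sub]
  congr 1
  abel

lemma MemHalpha.add {α : ℝ} {u v : L2V d} (hu : MemHalpha α u) (hv : MemHalpha α v) :
    MemHalpha α (u + v) := by
  rw [memHalpha_iff] at *
  exact (memLp_congr_ae (diffQuot_add α u v)).2 (hu.add hv)

lemma MemHalpha.sub {α : ℝ} {u v : L2V d} (hu : MemHalpha α u) (hv : MemHalpha α v) :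
    MemHalpha α (u - v) := by
  rw [memHalpha_iff] at *
  exact (memLp_congr_ae (diffQuot_sub α u v)).2 (hu.sub hv)

lemma integrable_inner_diffQuot {α : ℝ} {u v : L2V d} (hu : MemHalpha α u)
    (hv : MemHalpha α v) : Integrable fun z => ⟪diffQuot α u z, diffQuot α v z⟫ := by
  rw [memHalpha_iff] at hu hv
  exact (hu.norm.integrable_mul hv.norm).mono' (hu.1.inner hv.1)
    (Eventually.of_forall fun z => norm_inner_le_norm (diffQuot α u z) (diffQuot α v z))

lemma gagliardoForm_comm (α : ℝ) (u v : L2V d) : gagliardoForm α u v = gagliardoForm α v u := by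
  simp_rw [gagliardoForm_eq, real_inner_comm]

lemma gagliardoSq_nonneg (α : ℝ) (u : L2V d) : 0 ≤ gagliardoSq α u := by
  rw [gagliardoSq, gagliardoForm_eq]
  exact integral_nonneg fun _ => real_inner_self_nonneg

lemma gagliardoForm_add_left {α : ℝ} {u v w : L2V d} (hu : MemHalpha α u) (hv : MemHalpha α v)
    (hw : MemHalpha α w) :
    gagliardoForm α (u + v) w = gagliardoForm α u w + gagliardoForm α v w := by
  simp_rw [gagliardoForm_eq]
  rw [← integral_add (integrable_inner_diffQuot hu hw) (integrable_inner_diffQuot hv hw)]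
  refine integral_congr_ae ?_
  filter_upwards [diffQuot_add α u v] with z hz
  rw [hz, Pi.add_apply, inner_add_left]

lemma gagliardoForm_sub_left {α : ℝ} {u v w : L2V d} (hu : MemHalpha α u) (hv : MemHalpha α v)
    (hw : MemHalpha α w) :
    gagliardoForm α (u - v) w = gagliardoForm α u w - gagliardoForm α v w := by
  simp_rw [gagliardoForm_eq]
  rw [← integral_sub (integrable_inner_diffQuot hu hw) (integrable_inner_diffQuot hv hw)]
  refine integral_congr_ae ?_
  filter_upwards [diffQuot_sub α u v] with z hz
  rw [hz, Pi.sub_apply, inner_sub_left]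

lemma gagliardoSq_add {α : ℝ} {u v : L2V d} (hu : MemHalpha α u) (hv : MemHalpha α v) :
    gagliardoSq α (u + v) = gagliardoSq α u + 2 * gagliardoForm α u v + gagliardoSq α v := by
  simp only [gagliardoSq]
  rw [gagliardoForm_add_left hu hv (hu.add hv), gagliardoForm_comm α u (u + v),
    gagliardoForm_comm α v (u + v), gagliardoForm_add_left hu hv hu,
    gagliardoForm_add_left hu hv hv, gagliardoForm_comm α v u]
  ring

lemma gagliardoSq_sub {α : ℝ} {u v : L2V d} (hu : MemHalpha α u) (hv : MemHalpha α v) :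
    gagliardoSq α (u - v) = gagliardoSq α u - 2 * gagliardoForm α u v + gagliardoSq α v := by
  simp only [gagliardoSq]
  rw [gagliardoForm_sub_left hu hv (hu.sub hv), gagliardoForm_comm α u (u - v),
    gagliardoForm_comm α v (u - v), gagliardoForm_sub_left hu hv hu,
    gagliardoForm_sub_left hu hv hv, gagliardoForm_comm α v u]
  ring

lemma fracConst_nonneg (d : ℕ) {α : ℝ} (h0 : 0 < α) (h1 : α < 1) : 0 ≤ fracConst d α := by
  have h2 : 0 < Real.Gamma (((d : ℝ) + 2 * α) / 2) := Real.Gamma_pos_of_pos (by positivity)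
  have h3 : 0 < Real.Gamma (1 - α) := Real.Gamma_pos_of_pos (by linarith)
  unfold fracConst
  positivity

/-! ### Linear structure of the spaces of fields on `Ω` -/

lemma VanishesOff.sub {Ω : Set (Sp d)} {u v : L2V d} (hu : VanishesOff Ω u)
    (hv : VanishesOff Ω v) : VanishesOff Ω (u - v) := by
  unfold VanishesOff at *
  filter_upwards [hu, hv, Lp.coeFn_sub u v] with x h1 h2 h3 hx
  rw [h3, Pi.sub_apply, h1 hx, h2 hx, sub_zero]

lemma MemHalphaOff.sub {α : ℝ} {Ω : Set (Sp d)} {u v : L2V d} (hu : MemHalphaOff α Ω u)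
    (hv : MemHalphaOff α Ω v) : MemHalphaOff α Ω (u - v) :=
  ⟨hu.1.sub hv.1, hu.2.sub hv.2⟩

lemma MemX.memHalphaOff {α : ℝ} {Ω : Set (Sp d)} {v : L2V d} (h : MemX α Ω v) :
    MemHalphaOff α Ω v :=
  ⟨h.1, h.2.2⟩

lemma MemX.sub {α : ℝ} {Ω : Set (Sp d)} {u v : L2V d} (hu : MemX α Ω u) (hv : MemX α Ω v) :
    MemX α Ω (u - v) :=
  ⟨hu.1.sub hv.1, (hu.2.1.sub hv.2.1).1, hu.2.2.sub hv.2.2⟩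

lemma divergence_sub {u v : L2V d} (hu : MemH1 u) (hv : MemH1 v) :
    ∀ᵐ x, divergence (u - v) x = divergence u x - divergence v x := by
  filter_upwards [ae_all_iff.2 (hu.sub hv).2] with x hx
  simp only [divergence, hx, PiLp.sub_apply, Finset.sum_sub_distrib]

lemma gradForm_sub_left {Ω : Set (Sp d)} {u v w : L2V d} (hu : MemH1 u) (hv : MemH1 v)
    (hw : MemH1 w) : gradForm Ω (u - v) w = gradForm Ω u w - gradForm Ω v w := by
  unfold gradForm
  rw [← integral_sub (gradForm_integrable hu hw) (gradForm_integrable hv hw)]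
  refine integral_congr_ae (ae_restrict_of_ae ?_)
  filter_upwards [ae_all_iff.2 (hu.sub hv).2] with x hx
  simp only [hx, inner_sub_left, Finset.sum_sub_distrib]

lemma VanishesOff.setIntegral_inner {Ω : Set (Sp d)} {v : L2V d}
    (hv : VanishesOff Ω v) (g : L2V d) : ∫ x in Ω, ⟪g x, v x⟫ = ⟪g, v⟫ := by
  rw [L2.inner_def]
  refine setIntegral_eq_integral_of_ae_compl_eq_zero ?_
  filter_upwards [hv] with x hx hxΩ
  rw [hx hxΩ, inner_zero_right]

lemma VanishesOff.setIntegral_inner_sub {Ω : Set (Sp d)} {v : L2V d} (hv : VanishesOff Ω v)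
    (g h : L2V d) : ∫ x in Ω, ⟪g x - h x, v x⟫ = ⟪g - h, v⟫ := by
  rw [← hv.setIntegral_inner]
  refine integral_congr_ae (ae_restrict_of_ae ?_)
  filter_upwards [Lp.coeFn_sub g h] with x hx
  rw [hx, Pi.sub_apply]

lemma l2Sq_le (Ω : Set (Sp d)) (v : L2V d) : l2Sq Ω v ≤ ‖v‖ ^ 2 := by
  rw [← real_inner_self_eq_norm_sq, L2.inner_def]
  simp_rw [real_inner_self_eq_norm_sq]
  exact setIntegral_le_integral ((Lp.memLp v).integrable_norm_pow two_ne_zero)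
    (Eventually.of_forall fun x => by positivity)

/-- The identity `g = (-Δ)^α u` on the whole space, tested with fields that vanish off `Ω`. -/
lemma IsFracLapOn.gagliardoForm_eq_inner {α : ℝ} {Ω : Set (Sp d)} {u g v : L2V d}
    (h : IsFracLapOn α univ u g) (hv : MemHalphaOff α Ω v) :
    fracConst d α / 2 * gagliardoForm α u v = ⟪g, v⟫ := by
  rw [h.2.2 v ⟨hv.1, Eventually.of_forall fun x hx => absurd (mem_univ x) hx⟩, L2.inner_def,
    setIntegral_univ]

/-! ### Time increments of functions of class `H¹` in time -/

section Time

variable {B : Type*} [NormedAddCommGroup B]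

/-- The Cauchy–Schwarz inequality in time. -/
lemma sq_norm_intervalIntegral_le {v : ℝ → B} {s t : ℝ} (hst : s ≤ t)
    (hv : MemLp v 2 (volume.restrict (Ioc s t))) :
    (∫ r in s..t, ‖v r‖) ^ 2 ≤ (t - s) * ∫ r in s..t, ‖v r‖ ^ 2 := by
  have hi : Integrable (fun r => ‖v r‖) (volume.restrict (Ioc s t)) :=
    (hv.integrable (by norm_num)).norm
  have hi2 : Integrable (fun r => ‖v r‖ ^ 2) (volume.restrict (Ioc s t)) :=
    hv.integrable_norm_pow two_ne_zero
  rw [intervalIntegral.integral_of_le hst, intervalIntegral.integral_of_le hst]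
  set I := ∫ r in Ioc s t, ‖v r‖
  set J := ∫ r in Ioc s t, ‖v r‖ ^ 2
  -- the polynomial `c ↦ ∫ (‖v‖ - c)²` is nonnegative, so its discriminant is nonpositive
  have key : ∀ c : ℝ, 0 ≤ (t - s) * (c * c) + (-2 * I) * c + J := by
    intro c
    have h0 : 0 ≤ ∫ r in Ioc s t, (‖v r‖ - c) ^ 2 := integral_nonneg fun r => sq_nonneg _
    have h1 : ∫ r in Ioc s t, (‖v r‖ - c) ^ 2
        = J - (2 * c) * I + (t - s) * (c * c) := by
      have : ∀ r, (‖v r‖ - c) ^ 2 = ‖v r‖ ^ 2 - (2 * c) * ‖v r‖ + c * c := fun r => by ring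
      simp_rw [this]
      have i1 : Integrable (fun r => ‖v r‖ ^ 2 - 2 * c * ‖v r‖) (volume.restrict (Ioc s t)) :=
        hi2.sub (hi.const_mul _)
      rw [integral_add i1 (integrable_const _), integral_sub hi2 (hi.const_mul _),
        integral_const_mul, integral_const]
      simp [hst, I, J]
    linarith
  have := discrim_le_zero key
  unfold discrim at this
  linarith

lemma intervalIntegrable_sq_norm {T : ℝ} {v : ℝ → B}
    (hv : MemLp v 2 (volume.restrict (Ioc 0 T))) {s t : ℝ}
    (hs : 0 ≤ s) (hst : s ≤ t) (ht : t ≤ T) :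
    IntervalIntegrable (fun r => ‖v r‖ ^ 2) volume s t := by
  rw [intervalIntegrable_iff_integrableOn_Ioc_of_le hst]
  exact (hv.mono_measure (Measure.restrict_mono (Ioc_subset_Ioc hs ht) le_rfl)).integrable_norm_pow
    two_ne_zero

/-- The integrals over the time steps add up to at most the integral over `[0, T]`. -/
lemma sum_intervalIntegral_sq_norm_le {T : ℝ} {v : ℝ → B}
    (hv : MemLp v 2 (volume.restrict (Ioc 0 T))) {k : ℝ} (hk : 0 ≤ k) {N : ℕ}
    (hN : (N : ℝ) * k ≤ T) :
    ∑ n ∈ Finset.range N, (∫ r in ((n : ℝ) * k)..(((n + 1 : ℕ) : ℝ) * k), ‖v r‖ ^ 2)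
      ≤ ∫ r in (0 : ℝ)..T, ‖v r‖ ^ 2 := by
  have h0 : (0 : ℝ) ≤ N * k := by positivity
  rw [intervalIntegral.sum_integral_adjacent_intervals (a := fun n : ℕ => (n : ℝ) * k)]
  · rw [Nat.cast_zero, zero_mul, intervalIntegral.integral_of_le h0,
      intervalIntegral.integral_of_le (h0.trans hN)]
    refine setIntegral_mono_set ?_ (Eventually.of_forall fun _ => by positivity)
        (LE.le.eventuallyLE (Ioc_subset_Ioc_right hN))
    exact hv.integrable_norm_pow two_ne_zero
  · intro n hn
    refine intervalIntegrable_sq_norm hv (by positivity) (by gcongr; simp) (le_trans ?_ hN)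
    gcongr
    exact hn

variable [NormedSpace ℝ B]

lemma IsTimeDeriv.sub_eq_integral {T : ℝ} {u v : ℝ → B} (h : IsTimeDeriv T u v) {s t : ℝ}
    (hs : 0 ≤ s) (hst : s ≤ t) (ht : t ≤ T) : u t - u s = ∫ r in s..t, v r := by
  have hT : (0 : ℝ) ≤ T := hs.trans (hst.trans ht)
  have i : ∀ {a}, 0 ≤ a → a ≤ T → IntervalIntegrable v volume 0 a := fun h0 h1 =>
    h.1.mono_set (by rw [uIcc_of_le h0, uIcc_of_le hT]; exact Icc_subset_Icc_right h1)
  rw [h.2 t ⟨hs.trans hst, ht⟩, h.2 s ⟨hs, hst.trans ht⟩, add_sub_add_left_eq_sub,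
    intervalIntegral.integral_interval_sub_left (i (hs.trans hst) ht) (i hs (hst.trans ht))]

lemma IsTimeDeriv.sq_norm_sub_le {T : ℝ} {u v : ℝ → B} (h : IsTimeDeriv T u v)
    (hv : MemLp v 2 (volume.restrict (Ioc 0 T))) {s t : ℝ}
    (hs : 0 ≤ s) (hst : s ≤ t) (ht : t ≤ T) :
    ‖u t - u s‖ ^ 2 ≤ (t - s) * ∫ r in s..t, ‖v r‖ ^ 2 := by
  refine le_trans ?_ (sq_norm_intervalIntegral_le hst
    (hv.mono_measure (Measure.restrict_mono (Ioc_subset_Ioc hs ht) le_rfl)))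
  rw [h.sub_eq_integral hs hst ht]
  gcongr
  exact intervalIntegral.norm_integral_le_integral_norm hst

/-- The consistency error of the backward Euler quotient: it is the mean of `v r - v t` over
`[s, t]`. -/
lemma sq_norm_quotient_sub_deriv_le [CompleteSpace B] {T : ℝ} {u v a : ℝ → B}
    (h : IsTimeDeriv T u v) (h' : IsTimeDeriv T v a)
    (ha : MemLp a 2 (volume.restrict (Ioc 0 T))) {s t : ℝ}
    (hs : 0 ≤ s) (hst : s < t) (ht : t ≤ T) :
    ‖(1 / (t - s)) • (u t - u s) - v t‖ ^ 2 ≤ (t - s) * ∫ r in s..t, ‖a r‖ ^ 2 := by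
  have hpos : 0 < t - s := sub_pos.2 hst
  set J := ∫ r in s..t, ‖a r‖ ^ 2 with hJ
  have hJ0 : 0 ≤ J := intervalIntegral.integral_nonneg hst.le fun _ _ => by positivity
  have hvi : IntervalIntegrable v volume s t :=
    h.1.mono_set (by
      rw [uIcc_of_le hst.le, uIcc_of_le (hs.trans (hst.le.trans ht))]
      exact Icc_subset_Icc hs ht)
  have e : (1 / (t - s)) • (u t - u s) - v t = (1 / (t - s)) • ∫ r in s..t, (v r - v t) := by
    rw [intervalIntegral.integral_sub hvi intervalIntegrable_const,
      ← h.sub_eq_integral hs hst.le ht, intervalIntegral.integral_const, smul_sub _ (u t - u s),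
      smul_smul, one_div_mul_cancel hpos.ne', one_smul]
  have bound : ∀ r ∈ uIoc s t, ‖v r - v t‖ ≤ √((t - s) * J) := by
    intro r hr
    rw [uIoc_of_le hst.le] at hr
    refine Real.le_sqrt_of_sq_le ?_
    rw [norm_sub_rev]
    refine (h'.sq_norm_sub_le ha (hs.trans hr.1.le) hr.2 ht).trans ?_
    have h1 : ∫ x in r..t, ‖a x‖ ^ 2 ≤ J := by
      rw [hJ, intervalIntegral.integral_of_le hr.2, intervalIntegral.integral_of_le hst.le]
      refine setIntegral_mono_set ?_ (Eventually.of_forall fun _ => by positivity)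
        (LE.le.eventuallyLE (Ioc_subset_Ioc_left hr.1.le))
      exact (intervalIntegrable_iff_integrableOn_Ioc_of_le hst.le).1
        (intervalIntegrable_sq_norm ha hs hst.le ht)
    have h2 : 0 ≤ ∫ x in r..t, ‖a x‖ ^ 2 :=
      intervalIntegral.integral_nonneg hr.2 fun _ _ => by positivity
    exact mul_le_mul (by linarith [hr.1]) h1 h2 hpos.le
  have := intervalIntegral.norm_integral_le_of_norm_le_const bound
  rw [abs_of_pos hpos] at this
  have hle : ‖(1 / (t - s)) • (u t - u s) - v t‖ ≤ √((t - s) * J) := by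
    rw [e, norm_smul, Real.norm_of_nonneg (by positivity), one_div, inv_mul_le_iff₀ hpos]
    linarith
  calc _ ≤ (√((t - s) * J)) ^ 2 := by gcongr
    _ = _ := Real.sq_sqrt (by positivity)

lemma MemTimeH1.memLp {T : ℝ} (hT : 0 ≤ T) {u : ℝ → B} (h : MemTimeH1 T u) :
    MemLp u 2 (volume.restrict (Ioc 0 T)) := by
  obtain ⟨v, hv, -⟩ := h
  have hc := hv.continuousOn hT
  obtain ⟨C, hC⟩ := isCompact_Icc.exists_bound_of_continuousOn hc
  refine MemLp.of_bound ((hc.mono Ioc_subset_Icc_self).aestronglyMeasurable measurableSet_Ioc) C ?_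
  filter_upwards [ae_restrict_mem measurableSet_Ioc] with t ht using hC t (Ioc_subset_Icc_self ht)

end Time

/-! ### The energy inequality of one time step -/

/-- The discrete Gronwall inequality with dissipation terms `D n`. -/
lemma discrete_gronwall {E D r : ℕ → ℝ} {q : ℝ} (hq : 1 ≤ q) {N : ℕ} (h0 : E 0 = 0)
    (hD : ∀ n < N, 0 ≤ D n)
    (hr : ∀ n < N, 0 ≤ r n) (h : ∀ n < N, E (n + 1) + D n ≤ q * E n + r n) :
    E N + ∑ n ∈ Finset.range N, D n ≤ q ^ N * ∑ n ∈ Finset.range N, r n := by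
  induction N with
  | zero => simp [h0]
  | succ N ih =>
    have ih := ih (fun n hn => hD n (by omega)) (fun n hn => hr n (by omega))
      fun n hn => h n (by omega)
    rw [Finset.sum_range_succ, Finset.sum_range_succ]
    have hs : 0 ≤ ∑ n ∈ Finset.range N, D n := Finset.sum_nonneg fun n hn =>
      hD n (by have := Finset.mem_range.1 hn; omega)
    have h1 := h N (by omega)
    have h2 : 1 ≤ q ^ (N + 1) := one_le_pow₀ hq
    have h3 : r N ≤ q ^ (N + 1) * r N := le_mul_of_one_le_left (hr N (by omega)) h2
    have h4 := mul_le_mul_of_nonneg_left ih (zero_le_one.trans hq)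
    have h5 : ∑ n ∈ Finset.range N, D n ≤ q * ∑ n ∈ Finset.range N, D n :=
      le_mul_of_one_le_left hs hq
    rw [pow_succ] at h3 ⊢
    nlinarith

/-- The scalar part of the energy argument of one time step: the identities `q1`, `q2`, `q3` are
added, and the products of data terms and error terms are split by Young's inequality. The
variables `x, y, r` stand for `‖e‖, ‖b - e‖, ‖e' - b‖`, the variables `Δ, θ, ζ` for the norms of
the data, the variables `β, β', ρ` for `‖B‖, ‖B'‖, ‖B' - B‖`, and `i₁, …, i₅` for inner
products. -/
lemma energy_step_real {x y r Δ θ ζ β β' ρ x' b s s' c G S k ν γ κ i₁ i₂ i₃ i₄ i₅ : ℝ}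
    (hk : 0 < k) (hk1 : k ≤ 1) (hκ : 0 ≤ κ)
    (q1 : b ^ 2 - x ^ 2 + y ^ 2 + 2 * k * S + 2 * k * (ν * G)
      + 2 * k * γ * i₁ + 2 * k * γ * i₂ = 2 * k * i₃)
    (q2 : x' ^ 2 - b ^ 2 + r ^ 2 + 4 * k * γ * (s' - c) = 4 * k * γ * i₄)
    (q3 : i₁ = c + k * γ * (β' ^ 2 - β ^ 2 - ρ ^ 2) - 2 * k * γ * i₅)
    (c1 : i₅ ≤ β * Δ) (c2 : i₄ ≤ Δ * (x + y + r)) (c3 : -i₂ ≤ Δ * (x + y))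
    (c4 : i₃ ≤ θ * (x + y)) (hγ : 0 < γ)
    (hSG : -(2 * S) ≤ ν * G + κ * (ζ ^ 2 + x ^ 2))
    (hB : 2 * k ^ 2 * γ ^ 2 * ρ ^ 2 ≤ 3 / 4 * r ^ 2 + 6 * k ^ 2 * γ ^ 2 * Δ ^ 2) :
    x' ^ 2 + 2 * k * γ * s' + 2 * k ^ 2 * γ ^ 2 * β' ^ 2
      + (1 / 8 * y ^ 2 + 1 / 8 * r ^ 2 + k * (ν * G)
        + k * γ * (3 / 2 * (s' - 2 * c + s)) + k * γ * (1 / 2 * (s' + 2 * c + s)))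
    ≤ (x ^ 2 + 2 * k * γ * s + 2 * k ^ 2 * γ ^ 2 * β ^ 2)
      + k * (3 + κ) * (x ^ 2 + 2 * k ^ 2 * γ ^ 2 * β ^ 2)
      + k * (85 * γ ^ 2 + 9 + κ) * (Δ ^ 2 + θ ^ 2 + ζ ^ 2) := by
  have hkk0 : 0 ≤ k - k ^ 2 := by nlinarith
  have y1 : 4 * k ^ 2 * γ ^ 2 * (β * Δ)
      ≤ k * (2 * k ^ 2 * γ ^ 2 * β ^ 2) + 2 * k * γ ^ 2 * Δ ^ 2 := by
    linarith [mul_nonneg hk.le (sq_nonneg (γ * (k * β - Δ)))]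
  have y2 : 4 * k * γ * (Δ * (x + y + r)) ≤ k * x ^ 2 + 4 * k * γ ^ 2 * Δ ^ 2
      + 1 / 8 * y ^ 2 + 1 / 8 * r ^ 2 + 64 * k ^ 2 * γ ^ 2 * Δ ^ 2 := by
    linarith [mul_nonneg hk.le (sq_nonneg (x - 2 * γ * Δ)), sq_nonneg (y - 16 * k * γ * Δ),
      sq_nonneg (r - 16 * k * γ * Δ)]
  have y3 : 2 * k * γ * (Δ * (x + y)) ≤ k * x ^ 2 + k * γ ^ 2 * Δ ^ 2
      + 1 / 8 * y ^ 2 + 8 * k ^ 2 * γ ^ 2 * Δ ^ 2 := by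
    linarith [mul_nonneg hk.le (sq_nonneg (x - γ * Δ)), sq_nonneg (y - 8 * k * γ * Δ)]
  have y4 : 2 * k * (θ * (x + y))
      ≤ k * x ^ 2 + k * θ ^ 2 + 1 / 8 * y ^ 2 + 8 * k ^ 2 * θ ^ 2 := by
    linarith [mul_nonneg hk.le (sq_nonneg (x - θ)), sq_nonneg (y - 8 * k * θ)]
  have d1 := mul_le_mul_of_nonneg_left c1 (show 0 ≤ 4 * k ^ 2 * γ ^ 2 by positivity)
  have d2 := mul_le_mul_of_nonneg_left c2 (show 0 ≤ 4 * k * γ by positivity)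
  have d3 := mul_le_mul_of_nonneg_left c3 (show 0 ≤ 2 * k * γ by positivity)
  have d4 := mul_le_mul_of_nonneg_left c4 (show 0 ≤ 2 * k by positivity)
  have d5 := mul_le_mul_of_nonneg_left hSG hk.le
  rw [q3] at q1
  have m1 : 0 ≤ (k - k ^ 2) * (γ ^ 2 * Δ ^ 2) := by positivity
  have m2 : 0 ≤ (k - k ^ 2) * θ ^ 2 := by positivity
  have m3 : 0 ≤ k * κ * Δ ^ 2 := by positivity
  have m4 : 0 ≤ k * κ * θ ^ 2 := by positivity
  have m5 : 0 ≤ k * (γ ^ 2 * θ ^ 2) := by positivity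
  have m6 : 0 ≤ k * (γ ^ 2 * ζ ^ 2) := by positivity
  have m7 : 0 ≤ k * ζ ^ 2 := by positivity
  have m8 : 0 ≤ k * Δ ^ 2 := by positivity
  have m9 : 0 ≤ k * κ * (2 * k ^ 2 * γ ^ 2 * β ^ 2) := by positivity
  have m10 : 0 ≤ k * (2 * k ^ 2 * γ ^ 2 * β ^ 2) := by positivity
  have m11 : 0 ≤ y ^ 2 := by positivity
  have m12 : 0 ≤ k * (γ ^ 2 * Δ ^ 2) := by positivity
  linarith

/-- One step of the energy argument in a Hilbert space. Here `e, e'` are the errors of the second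
stage at the old and the new time, `b` is the error of the first stage at the new time, `B, B'`
represent the fractional Laplacian of `e, e'`, and `s, s', c` stand for `a(e, e)`, `a(e', e')`
and `a(e, e')` with the bilinear form `a` of the fractional Laplacian. The remaining data are the
time lag `δ` of the explicit fractional term, the consistency error `τ`, the increment `z` of the
exact solution, the convection term `S`, and `G = ‖∇b‖²`. -/
lemma energy_step {H : Type*} [NormedAddCommGroup H] [InnerProductSpace ℝ H]
    {e e' b B B' δ τ z : H} {s s' c G S K k ν γ : ℝ} (hk : 0 < k) (hk1 : k ≤ 1) (hν : 0 < ν)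
    (hγ : 0 < γ) (hG : 0 ≤ G) (hS : |S| ≤ K * (‖z‖ + ‖e‖) * √G)
    (h1 : 1 / k * ⟪b - e, b⟫ + S + ν * G + γ * ⟪B, b⟫ + γ * ⟪δ, b⟫ = ⟪τ, b⟫)
    (h2 : b = e' + (2 * k * γ) • (B' - B) - (2 * k * γ) • δ)
    (h3 : ⟪B, e'⟫ = c) (h4 : ⟪B', e'⟫ = s') :
    ‖e'‖ ^ 2 + 2 * k * γ * s' + 2 * k ^ 2 * γ ^ 2 * ‖B'‖ ^ 2
      + (1 / 8 * ‖b - e‖ ^ 2 + 1 / 8 * ‖e' - b‖ ^ 2 + k * (ν * G)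
        + k * γ * (3 / 2 * (s' - 2 * c + s)) + k * γ * (1 / 2 * (s' + 2 * c + s)))
    ≤ (‖e‖ ^ 2 + 2 * k * γ * s + 2 * k ^ 2 * γ ^ 2 * ‖B‖ ^ 2)
      + k * (3 + 2 * K ^ 2 / ν) * (‖e‖ ^ 2 + 2 * k ^ 2 * γ ^ 2 * ‖B‖ ^ 2)
      + k * (85 * γ ^ 2 + 9 + 2 * K ^ 2 / ν) * (‖δ‖ ^ 2 + ‖τ‖ ^ 2 + ‖z‖ ^ 2) := by
  -- the energy identity of the first stage
  have p1 : ⟪b - e, b⟫ = (‖b‖ ^ 2 - ‖e‖ ^ 2 + ‖b - e‖ ^ 2) / 2 := by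
    rw [norm_sub_sq_real, inner_sub_left, real_inner_self_eq_norm_sq, real_inner_comm e b]
    ring
  have q1 : ‖b‖ ^ 2 - ‖e‖ ^ 2 + ‖b - e‖ ^ 2 + 2 * k * S + 2 * k * (ν * G)
      + 2 * k * γ * ⟪B, b⟫ + 2 * k * γ * ⟪δ, b⟫ = 2 * k * ⟪τ, b⟫ := by
    rw [p1] at h1
    field_simp at h1
    linarith
  -- the energy identity of the second stage
  have q2 : ‖e'‖ ^ 2 - ‖b‖ ^ 2 + ‖e' - b‖ ^ 2 + 4 * k * γ * (s' - c) = 4 * k * γ * ⟪δ, e'⟫ := by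
    have : e' - b = (2 * k * γ) • δ - (2 * k * γ) • (B' - B) := by rw [h2]; abel
    have h5 : ⟪e' - b, e'⟫ = 2 * k * γ * ⟪δ, e'⟫ - 2 * k * γ * (s' - c) := by
      rw [this, inner_sub_left, real_inner_smul_left, real_inner_smul_left, inner_sub_left, h3, h4]
    have h6 : ⟪e' - b, e'⟫ = (‖e'‖ ^ 2 - ‖b‖ ^ 2 + ‖e' - b‖ ^ 2) / 2 := by
      rw [norm_sub_sq_real, inner_sub_left, real_inner_self_eq_norm_sq, real_inner_comm e' b]
      ring
    linarith
  have q3 : ⟪B, b⟫ = c + k * γ * (‖B'‖ ^ 2 - ‖B‖ ^ 2 - ‖B' - B‖ ^ 2) - 2 * k * γ * ⟪B, δ⟫ := by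
    rw [h2, inner_sub_right, inner_add_right, real_inner_smul_right, real_inner_smul_right, h3,
      norm_sub_sq_real, inner_sub_right, real_inner_self_eq_norm_sq, real_inner_comm B B']
    ring
  -- `2 kγ (B' - B)` equals `(b - e') + 2 kγ δ`
  have q4 : 2 * k * γ * ‖B' - B‖ ≤ ‖e' - b‖ + 2 * k * γ * ‖δ‖ := by
    have : (2 * k * γ) • (B' - B) = (2 * k * γ) • δ - (e' - b) := by rw [h2]; abel
    calc 2 * k * γ * ‖B' - B‖ = ‖(2 * k * γ) • (B' - B)‖ := by
          rw [norm_smul, Real.norm_of_nonneg (by positivity)]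
      _ ≤ ‖(2 * k * γ) • δ‖ + ‖e' - b‖ := by rw [this]; exact norm_sub_le _ _
      _ = _ := by rw [norm_smul, Real.norm_of_nonneg (by positivity)]; ring
  have n1 : ‖b‖ ≤ ‖e‖ + ‖b - e‖ := by
    calc ‖b‖ = ‖e + (b - e)‖ := by congr 1; abel
      _ ≤ _ := norm_add_le _ _
  have n2 : ‖e'‖ ≤ ‖e‖ + ‖b - e‖ + ‖e' - b‖ := by
    calc ‖e'‖ = ‖b + (e' - b)‖ := by congr 1; abel
      _ ≤ _ := (norm_add_le _ _).trans (by linarith)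
  have c1 : ⟪B, δ⟫ ≤ ‖B‖ * ‖δ‖ := real_inner_le_norm _ _
  have c2 : ⟪δ, e'⟫ ≤ ‖δ‖ * (‖e‖ + ‖b - e‖ + ‖e' - b‖) :=
    (real_inner_le_norm _ _).trans (by gcongr)
  have c3 : -⟪δ, b⟫ ≤ ‖δ‖ * (‖e‖ + ‖b - e‖) :=
    (neg_le_abs _).trans ((abs_real_inner_le_norm _ _).trans (by gcongr))
  have c4 : ⟪τ, b⟫ ≤ ‖τ‖ * (‖e‖ + ‖b - e‖) := (real_inner_le_norm _ _).trans (by gcongr)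
  have hSG : -(2 * S) ≤ ν * G + 2 * K ^ 2 / ν * (‖z‖ ^ 2 + ‖e‖ ^ 2) := by
    have hs := Real.sq_sqrt hG
    have h5 : -S ≤ K * (‖z‖ + ‖e‖) * √G := (neg_le_abs S).trans hS
    have h6 : 2 * (K * (‖z‖ + ‖e‖) * √G) ≤ ν * √G ^ 2 + (K * (‖z‖ + ‖e‖)) ^ 2 / ν := by
      have : 0 ≤ (ν * √G - K * (‖z‖ + ‖e‖)) ^ 2 / ν := by positivity
      have e1 : (ν * √G - K * (‖z‖ + ‖e‖)) ^ 2 / ν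
        = ν * √G ^ 2 + (K * (‖z‖ + ‖e‖)) ^ 2 / ν - 2 * (K * (‖z‖ + ‖e‖) * √G) := by
        field_simp
        ring
      linarith
    have h7 : (K * (‖z‖ + ‖e‖)) ^ 2 / ν ≤ 2 * K ^ 2 / ν * (‖z‖ ^ 2 + ‖e‖ ^ 2) := by
      rw [div_mul_eq_mul_div]
      gcongr
      linarith [mul_nonneg (sq_nonneg K) (sq_nonneg (‖z‖ - ‖e‖))]
    rw [hs] at h6
    linarith
  have hB : 2 * k ^ 2 * γ ^ 2 * ‖B' - B‖ ^ 2
      ≤ 3 / 4 * ‖e' - b‖ ^ 2 + 6 * k ^ 2 * γ ^ 2 * ‖δ‖ ^ 2 := by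
    have h5 : (2 * k * γ * ‖B' - B‖) ^ 2 ≤ (‖e' - b‖ + 2 * k * γ * ‖δ‖) ^ 2 := by gcongr
    linarith [sq_nonneg (1 / 2 * ‖e' - b‖ - 2 * k * γ * ‖δ‖)]
  exact energy_step_real hk hk1 (by positivity) q1 q2 q3 c1 c2 c3 c4 hγ hSG hB

/-! ### The error equations -/

/-- The error of the first stage satisfies the scheme, up to the consistency error
`(U₁ - U₀) / k - a` of the time derivative and the time lag `A₁ - A₀` of the fractional Laplacian.
The convection terms reduce to the single term `S`, because the trilinear form is skew. -/
lemma stage1_error {Ω : Set (Sp d)} {ν γ α k K M : ℝ} (hK0 : 0 ≤ K)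
    (hK : ∀ U : L2V d, MemX α Ω U → H2NormOnLE Ω U M → ∀ z v : L2V d, MemX α Ω v →
      Integrable (convIntegrand z U v) ∧ Integrable (convIntegrand z v U) ∧
      |skewForm Ω z U v| ≤ K * ‖z‖ * √(gradForm Ω v v))
    {U₀ U₁ A₀ A₁ a un w B : L2V d} {f : L2VOn Ω} {p : L2On Ω}
    (hU₀ : MemX α Ω U₀) (hA₀ : IsFracLapOn α univ U₀ A₀)
    (hU₁ : MemX α Ω U₁) (hM : H2NormOnLE Ω U₁ M)
    (hdiv : ∀ᵐ x ∂(volume.restrict Ω), divergence U₁ x = 0)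
    (hexact : ∀ v : L2V d, MemX α Ω v → (∀ᵐ x ∂(volume.restrict Ω), divergence v x = 0) →
      (∫ x in Ω, ⟪a x, v x⟫) + skewForm Ω U₁ U₁ v + ν * gradForm Ω U₁ v
        + γ * (∫ x in Ω, ⟪A₁ x, v x⟫) = ∫ x in Ω, ⟪f x, v x⟫)
    (hun : MemHalphaOff α Ω un) (hw : MemX α Ω w)
    (hdw : ∀ᵐ x ∂(volume.restrict Ω), divergence w x = 0)
    (hconv : ∀ v : L2V d, MemX α Ω v → IntegrableOn (convIntegrand un w v) Ω)
    (hstage : ∀ v : L2V d, MemX α Ω v →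
      1 / k * (∫ x in Ω, ⟪w x - un x, v x⟫) + skewForm Ω un w v + ν * gradForm Ω w v
        - (∫ x in Ω, p x * divergence v x)
      = (∫ x in Ω, ⟪f x, v x⟫) - γ * (fracConst d α / 2 * gagliardoForm α un v))
    (hB : ∀ v : L2V d, MemHalphaOff α Ω v →
      fracConst d α / 2 * gagliardoForm α (U₀ - un) v = ⟪B, v⟫) {e b : L2V d}
    (he : e = U₀ - un) (hb : b = U₁ - w) :
    ∃ S : ℝ, |S| ≤ K * (‖U₁ - U₀‖ + ‖e‖) * √(gradForm Ω b b) ∧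
      1 / k * ⟪b - e, b⟫ + S + ν * gradForm Ω b b + γ * ⟪B, b⟫ + γ * ⟪A₁ - A₀, b⟫
        = ⟪(1 / k) • (U₁ - U₀) - a, b⟫ := by
  have hbX : MemX α Ω b := hb ▸ hU₁.sub hw
  have hbH := hbX.memHalphaOff
  have hbdiv : ∀ᵐ x ∂(volume.restrict Ω), divergence b x = 0 := by
    rw [hb]
    filter_upwards [hdiv, hdw, ae_restrict_of_ae (divergence_sub hU₁.2.1 hw.2.1)] with x h1 h2 h3
    rw [h3, h1, h2, sub_zero]
  obtain ⟨i1, i2, -⟩ := hK U₁ hU₁ hM U₁ b hbX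
  obtain ⟨j1, j2, -⟩ := hK U₁ hU₁ hM un b hbX
  refine ⟨skewForm Ω (U₁ - un) U₁ b, ?_, ?_⟩
  · refine (hK U₁ hU₁ hM (U₁ - un) b hbX).2.2.trans ?_
    gcongr
    calc ‖U₁ - un‖ = ‖(U₁ - U₀) + e‖ := by rw [he]; congr 1; abel
      _ ≤ _ := norm_add_le _ _
  · have hp : ∫ x in Ω, p x * divergence b x = 0 := by
      rw [integral_congr_ae (g := fun _ => (0 : ℝ)) (by
        filter_upwards [hbdiv] with x hx
        rw [hx, mul_zero])]
      simp
    have h1 := hexact b hbX hbdiv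
    have h2 := hstage b hbX
    have h3 := hB b hbH
    rw [gagliardoForm_sub_left hU₀.1 hun.1 hbH.1] at h3
    have h4 := hA₀.gagliardoForm_eq_inner hbH
    have h5 := gradForm_sub_left (Ω := Ω) hU₁.2.1 hw.2.1 hbX.2.1
    rw [← hb] at h5
    rw [skewForm_sub_left i1 i2 j1 j2]
    rw [skewForm_sub_self hU₁.2.1 hb hw.2.1 j1 j2 (hconv b hbX), hp,
      hbX.2.2.setIntegral_inner_sub] at h2
    rw [hbX.2.2.setIntegral_inner, hbX.2.2.setIntegral_inner] at h1
    have h6 : b - e = (U₁ - U₀) - (w - un) := by rw [hb, he]; abel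
    rw [h6, h5, inner_sub_left (U₁ - U₀), inner_sub_left _ a, real_inner_smul_left,
      inner_sub_left A₁]
    linear_combination h1 - h2 - γ * h3 + γ * h4

/-- The second stage, rewritten for the error. -/
lemma stage2_error {Ω : Set (Sp d)} {γ α k : ℝ} {U₀ U₁ A₀ A₁ un un' w : L2V d}
    (hA₀ : IsFracLapOn α univ U₀ A₀) (hA₁ : IsFracLapOn α univ U₁ A₁)
    (hun : MemHalphaOff α Ω un) (hun' : MemHalphaOff α Ω un')
    (hstage : ∀ v : L2V d, MemHalphaOff α Ω v →
      2 * k * γ * (fracConst d α / 2 * gagliardoForm α (un' - un) v)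
        + (∫ x in Ω, ⟪un' x - w x, v x⟫) = 0) {v : L2V d} (hv : MemHalphaOff α Ω v) :
    2 * k * γ * (fracConst d α / 2 * gagliardoForm α (U₁ - un') v
        - fracConst d α / 2 * gagliardoForm α (U₀ - un) v)
      = 2 * k * γ * ⟪A₁ - A₀, v⟫ - ⟪(U₁ - un') - (U₁ - w), v⟫ := by
  have h1 := hstage v hv
  rw [hv.2.setIntegral_inner_sub, gagliardoForm_sub_left hun'.1 hun.1 hv.1] at h1
  rw [gagliardoForm_sub_left hA₁.1 hun'.1 hv.1, gagliardoForm_sub_left hA₀.1 hun.1 hv.1,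
    inner_sub_left A₁]
  have h2 := hA₁.gagliardoForm_eq_inner hv
  have h3 := hA₀.gagliardoForm_eq_inner hv
  have h4 : (U₁ - un') - (U₁ - w) = -(un' - w) := by abel
  rw [h4, inner_neg_left]
  linear_combination -h1 + 2 * k * γ * h2 - 2 * k * γ * h3

/-- The second stage determines the fractional Laplacian of the error recursively: if the
functional `a n` represents the error at time `n`, then the increments of `a` are represented in
the Hilbert space, and so is `a n` itself since it vanishes at time zero. -/
lemma exists_representation {H : Type*} [NormedAddCommGroup H] [InnerProductSpace ℝ H]
    {k γ : ℝ} (hk : 0 < k) (hγ : 0 < γ) {N : ℕ} {P : H → Prop} {a : ℕ → H → ℝ}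
    {e b δ : ℕ → H} (h0 : ∀ v, P v → a 0 v = 0)
    (h : ∀ n < N, ∀ v, P v →
      2 * k * γ * (a (n + 1) v - a n v) = 2 * k * γ * ⟪δ n, v⟫ - ⟪e (n + 1) - b (n + 1), v⟫) :
    ∃ B : ℕ → H, B 0 = 0 ∧
      (∀ n, b (n + 1) = e (n + 1) + (2 * k * γ) • (B (n + 1) - B n) - (2 * k * γ) • δ n) ∧
      ∀ n ≤ N, ∀ v, P v → a n v = ⟪B n, v⟫ := by
  have hkγ : 2 * k * γ ≠ 0 := by positivity
  let B : ℕ → H := fun n =>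
    n.rec 0 fun n Bn => Bn + (δ n - (2 * k * γ)⁻¹ • (e (n + 1) - b (n + 1)))
  have hB : ∀ n, B (n + 1) = B n + (δ n - (2 * k * γ)⁻¹ • (e (n + 1) - b (n + 1))) := fun n => rfl
  refine ⟨B, rfl, fun n => ?_, fun n => ?_⟩
  · rw [hB, add_sub_cancel_left, smul_sub, smul_smul, mul_inv_cancel₀ hkγ, one_smul]
    abel
  · induction n with
    | zero => intro _ v hv; rw [h0 v hv]; exact (inner_zero_left v).symm
    | succ n ih =>
      intro hn v hv
      have h1 := h n (by omega) v hv
      rw [hB, inner_add_left, ← ih (by omega) v hv, inner_sub_left, real_inner_smul_left]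
      field_simp
      linarith

/-- The errors of consecutive stages in the order in which the algorithm does not compare them:
`e (n + 1) - b n` is split along `b (n + 1)`, `e n`, `b n`. -/
lemma sum_sq_norm_sub_le {H : Type*} [NormedAddCommGroup H] {e b : ℕ → H} (h0 : e 0 = b 0)
    (N : ℕ) : ∑ n ∈ Finset.range N, ‖e (n + 1) - b n‖ ^ 2
      ≤ 6 * ∑ n ∈ Finset.range N, ‖e (n + 1) - b (n + 1)‖ ^ 2
        + 3 * ∑ n ∈ Finset.range N, ‖b (n + 1) - e n‖ ^ 2 := by
  have h1 : ∀ n, ‖e (n + 1) - b n‖ ^ 2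
      ≤ 3 * ‖e (n + 1) - b (n + 1)‖ ^ 2 + 3 * ‖b (n + 1) - e n‖ ^ 2 + 3 * ‖e n - b n‖ ^ 2 := by
    intro n
    have : ‖e (n + 1) - b n‖
        ≤ ‖e (n + 1) - b (n + 1)‖ + ‖b (n + 1) - e n‖ + ‖e n - b n‖ := by
      calc ‖e (n + 1) - b n‖
          = ‖(e (n + 1) - b (n + 1)) + (b (n + 1) - e n) + (e n - b n)‖ := by congr 1; abel
        _ ≤ _ := norm_add₃_le
    have h2 := pow_le_pow_left₀ (norm_nonneg _) this 2
    linarith [sq_nonneg (‖e (n + 1) - b (n + 1)‖ - ‖b (n + 1) - e n‖),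
      sq_nonneg (‖e (n + 1) - b (n + 1)‖ - ‖e n - b n‖),
      sq_nonneg (‖b (n + 1) - e n‖ - ‖e n - b n‖)]
  have h2 : ∑ n ∈ Finset.range N, ‖e n - b n‖ ^ 2
      ≤ ∑ n ∈ Finset.range N, ‖e (n + 1) - b (n + 1)‖ ^ 2 := by
    have h3 := Finset.sum_range_succ (fun n => ‖e n - b n‖ ^ 2) N
    rw [Finset.sum_range_succ', h0, sub_self, norm_zero] at h3
    have : 0 ≤ ‖e N - b N‖ ^ 2 := by positivity
    linarith
  have h3 := Finset.sum_le_sum fun n (_ : n ∈ Finset.range N) => h1 n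
  simp only [Finset.sum_add_distrib, ← Finset.mul_sum] at h3
  linarith

/-! ### The error estimate -/

lemma gradForm_nonneg_mul {ν : ℝ} (hν : 0 < ν) (Ω : Set (Sp d)) (v : L2V d) :
    0 ≤ ν * gradForm Ω v v :=
  mul_nonneg hν.le (gradForm_self_nonneg Ω v)

/-- The error estimate for given errors `e` and `b` of the two stages, from the energy inequality
of each step; `R n` bounds the data of the step from `n` to `n + 1`. -/
lemma error_bound_of_step {Ω : Set (Sp d)} {ν γ α k L M₀ T : ℝ} (hν : 0 < ν) (hγ : 0 < γ)
    (hC : 0 ≤ fracConst d α) (hk : 0 < k) (hL : 0 ≤ L) (hM₀ : 0 ≤ M₀) {N : ℕ} (hNT : N * k ≤ T)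
    {e b B : ℕ → L2V d} (h0 : e 0 = 0) (hb0 : b 0 = 0) (hB0 : B 0 = 0)
    (hmem : ∀ n ≤ N, MemHalpha α (e n)) {R : ℕ → ℝ} (hR : ∀ n < N, 0 ≤ R n)
    (hstep : ∀ n < N,
      ‖e (n + 1)‖ ^ 2 + 2 * k * γ * (fracConst d α / 2 * gagliardoSq α (e (n + 1)))
        + 2 * k ^ 2 * γ ^ 2 * ‖B (n + 1)‖ ^ 2
      + (1 / 8 * ‖b (n + 1) - e n‖ ^ 2 + 1 / 8 * ‖e (n + 1) - b (n + 1)‖ ^ 2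
        + k * (ν * gradForm Ω (b (n + 1)) (b (n + 1)))
        + k * γ * (3 / 2 * (fracConst d α / 2 * gagliardoSq α (e (n + 1))
          - 2 * (fracConst d α / 2 * gagliardoForm α (e n) (e (n + 1)))
          + fracConst d α / 2 * gagliardoSq α (e n)))
        + k * γ * (1 / 2 * (fracConst d α / 2 * gagliardoSq α (e (n + 1))
          + 2 * (fracConst d α / 2 * gagliardoForm α (e n) (e (n + 1)))
          + fracConst d α / 2 * gagliardoSq α (e n))))
      ≤ (‖e n‖ ^ 2 + 2 * k * γ * (fracConst d α / 2 * gagliardoSq α (e n))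
          + 2 * k ^ 2 * γ ^ 2 * ‖B n‖ ^ 2)
        + k * L * (‖e n‖ ^ 2 + 2 * k ^ 2 * γ ^ 2 * ‖B n‖ ^ 2) + k * M₀ * R n) :
    l2Sq Ω (e N)
      + ∑ n ∈ Finset.range N, l2Sq Ω (b (n + 1) - e n : L2V d)
      + ∑ n ∈ Finset.range N, l2Sq Ω (e (n + 1) - b n : L2V d)
      + k * ∑ n ∈ Finset.range N, ν * gradForm Ω (b (n + 1)) (b (n + 1))
      + k * γ * fracConst d α * gagliardoSq α (e N)
      + k * ∑ n ∈ Finset.range N, γ * (3 * fracConst d α / 4) * gagliardoSq α (e (n + 1) - e n)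
      + k * ∑ n ∈ Finset.range N, γ * (fracConst d α / 4) * gagliardoSq α (e (n + 1) + e n)
      + 2 * k ^ 2 * γ ^ 2 * l2Sq Ω (B N)
    ≤ 48 * (Real.exp (L * T) * (M₀ * (k * ∑ n ∈ Finset.range N, R n))) := by
  set c := fracConst d α
  set E : ℕ → ℝ := fun n => ‖e n‖ ^ 2 + k * γ * c * gagliardoSq α (e n)
    + 2 * k ^ 2 * γ ^ 2 * ‖B n‖ ^ 2 with hE
  set D : ℕ → ℝ := fun n => 1 / 8 * ‖b (n + 1) - e n‖ ^ 2 + 1 / 8 * ‖e (n + 1) - b (n + 1)‖ ^ 2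
    + k * (ν * gradForm Ω (b (n + 1)) (b (n + 1)))
    + k * (γ * (3 * c / 4) * gagliardoSq α (e (n + 1) - e n))
    + k * (γ * (c / 4) * gagliardoSq α (e (n + 1) + e n)) with hD
  have hD0 : ∀ n, 0 ≤ D n := by
    intro n
    have h1 := gradForm_nonneg_mul hν Ω (b (n + 1))
    have h2 := gagliardoSq_nonneg α (e (n + 1) - e n)
    have h3 := gagliardoSq_nonneg α (e (n + 1) + e n)
    positivity
  have hkL : 0 ≤ k * L := by positivity
  have hgron : E N + ∑ n ∈ Finset.range N, D n
      ≤ (1 + k * L) ^ N * ∑ n ∈ Finset.range N, k * M₀ * R n := by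
    refine discrete_gronwall (by linarith) ?_ (fun n _ => hD0 n)
      (fun n hn => mul_nonneg (by positivity) (hR n hn)) fun n hn => ?_
    · have h1 : gagliardoSq α (0 : L2V d) = 0 := by
        have : MemHalpha α (0 : L2V d) := h0 ▸ hmem 0 (Nat.zero_le _)
        have h2 := gagliardoSq_sub this this
        rw [sub_zero, gagliardoSq] at h2
        rw [gagliardoSq]
        linarith
      simp [hE, h0, hB0, h1]
    · have h1 := hstep n hn
      have h2 := gagliardoSq_sub (hmem (n + 1) hn) (hmem n hn.le)
      have h3 := gagliardoSq_add (hmem (n + 1) hn) (hmem n hn.le)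
      rw [gagliardoForm_comm] at h2 h3
      have h4 : 0 ≤ k * L * (k * γ * c * gagliardoSq α (e n)) := by
        have := gagliardoSq_nonneg α (e n)
        positivity
      simp only [hE, hD, h2, h3]
      linarith
  have hexp : (1 + k * L) ^ N ≤ Real.exp (L * T) := by
    calc (1 + k * L) ^ N ≤ Real.exp (k * L) ^ N := by
          gcongr
          linarith [Real.add_one_le_exp (k * L)]
      _ = Real.exp (N * k * L) := by rw [← Real.exp_nat_mul, mul_assoc]
      _ ≤ Real.exp (L * T) := by
          rw [mul_comm L]
          gcongr
  have hRs : 0 ≤ ∑ n ∈ Finset.range N, k * M₀ * R n :=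
    Finset.sum_nonneg fun n hn => mul_nonneg (by positivity) (hR n (Finset.mem_range.1 hn))
  have hmain : E N + ∑ n ∈ Finset.range N, D n
      ≤ Real.exp (L * T) * (M₀ * (k * ∑ n ∈ Finset.range N, R n)) := by
    refine (hgron.trans (mul_le_mul_of_nonneg_right hexp hRs)).trans_eq ?_
    rw [← Finset.mul_sum]
    ring
  refine le_trans ?_ (mul_le_mul_of_nonneg_left hmain (by norm_num))
  have s1 : ∑ n ∈ Finset.range N, l2Sq Ω (b (n + 1) - e n : L2V d)
      ≤ ∑ n ∈ Finset.range N, ‖b (n + 1) - e n‖ ^ 2 := Finset.sum_le_sum fun n _ => l2Sq_le Ω _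
  have s2 : ∑ n ∈ Finset.range N, l2Sq Ω (e (n + 1) - b n : L2V d)
      ≤ ∑ n ∈ Finset.range N, ‖e (n + 1) - b n‖ ^ 2 := Finset.sum_le_sum fun n _ => l2Sq_le Ω _
  -- the coefficients `1 / 8` of the dissipation and `6` of `sum_sq_norm_sub_le` give `48`
  have s3 := sum_sq_norm_sub_le (h0.trans hb0.symm) N
  have s4 := l2Sq_le Ω (e N)
  have s5 : 2 * k ^ 2 * γ ^ 2 * l2Sq Ω (B N) ≤ 2 * k ^ 2 * γ ^ 2 * ‖B N‖ ^ 2 := by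
    gcongr
    exact l2Sq_le Ω (B N)
  have s6 : 0 ≤ 2 * k ^ 2 * γ ^ 2 * ‖B N‖ ^ 2 := by positivity
  have s7 : 0 ≤ k * γ * c * gagliardoSq α (e N) := by
    have := gagliardoSq_nonneg α (e N)
    positivity
  have s8 : 0 ≤ k * ∑ n ∈ Finset.range N, ν * gradForm Ω (b (n + 1)) (b (n + 1)) :=
    mul_nonneg hk.le (Finset.sum_nonneg fun n _ => gradForm_nonneg_mul hν Ω _)
  have s9 : 0 ≤ k * ∑ n ∈ Finset.range N, γ * (3 * c / 4) * gagliardoSq α (e (n + 1) - e n) :=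
    mul_nonneg hk.le (Finset.sum_nonneg fun n _ =>
      mul_nonneg (by positivity) (gagliardoSq_nonneg α _))
  have s10 : 0 ≤ k * ∑ n ∈ Finset.range N, γ * (c / 4) * gagliardoSq α (e (n + 1) + e n) :=
    mul_nonneg hk.le (Finset.sum_nonneg fun n _ =>
      mul_nonneg (by positivity) (gagliardoSq_nonneg α _))
  have s11 : 0 ≤ ∑ n ∈ Finset.range N, ‖b (n + 1) - e n‖ ^ 2 :=
    Finset.sum_nonneg fun n _ => by positivity
  have s12 : 0 ≤ ‖e N‖ ^ 2 := by positivity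
  simp only [hD, Finset.sum_add_distrib, ← Finset.mul_sum, hE]
  simp only [← Finset.mul_sum] at s8 s9 s10
  linarith

end FracNS

open FracNS
theorem mainTheorem2 (d : ℕ) (hd : d = 2 ∨ d = 3)
    (Ω : Set (Sp d)) (hΩ_open : IsOpen Ω) (hΩ_bdd : Bornology.IsBounded Ω)
    (ν γ α T : ℝ) (hν : 0 < ν) (hγ : 0 < γ) (hα₀ : 0 < α) (hα₁ : α < 1) (hT : 0 < T)
    (f : ℝ → L2VOn Ω) (u₀ : L2V d) (u ut Au : ℝ → L2V d) (p : ℝ → L2On Ω)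
    (hsol : IsExactSolution Ω ν γ α T f u₀ u ut Au p)
    (hreg : HasRegularity Ω α T f u ut Au p) :
    ∃ C : ℝ, 0 < C ∧
      ∀ Δt : ℝ, 0 < Δt → Δt ≤ 1 → ∀ N : ℕ, (N : ℝ) * Δt ≤ T →
      ∀ (un wn : ℕ → L2V d) (pn : ℕ → L2On Ω),
      IsModularSolution Ω ν γ α Δt f u₀ N un wn pn →
      ∀ e ebar : ℕ → L2V d,
      (∀ n, e n = u ((n : ℝ) * Δt) - un n) →
      (∀ n, ebar n = u ((n : ℝ) * Δt) - wn n) →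
      ∃ AeN : Sp d → Sp d, IsFracLapOn α Ω (e N) AeN ∧
        l2Sq Ω (e N)
          + ∑ n ∈ Finset.range N, l2Sq Ω (ebar (n + 1) - e n : L2V d)
          + ∑ n ∈ Finset.range N, l2Sq Ω (e (n + 1) - ebar n : L2V d)
          + Δt * ∑ n ∈ Finset.range N, ν * gradForm Ω (ebar (n + 1)) (ebar (n + 1))
          + Δt * γ * fracConst d α * gagliardoSq α (e N)
          + Δt * ∑ n ∈ Finset.range N,
              γ * (3 * fracConst d α / 4) * gagliardoSq α (e (n + 1) - e n)
          + Δt * ∑ n ∈ Finset.range N,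
              γ * (fracConst d α / 4) * gagliardoSq α (e (n + 1) + e n)
          + 2 * Δt ^ 2 * γ ^ 2 * l2Sq Ω AeN
        ≤ C * Δt ^ 2 := by
  obtain ⟨M, hM⟩ := hreg.u_Linfty_H2.exists_bound hΩ_open.measurableSet hT
    (hsol.time_deriv.continuousOn hT.le)
  obtain ⟨K, hK0, hK⟩ := exists_skewForm_bound hd hΩ_open hΩ_bdd α M
  have hut2 := hreg.u_H2_L2.memLp hT.le
  obtain ⟨utt, hutt, hutt2⟩ := hreg.u_H2_L2
  obtain ⟨-, Aut, hAut, hAut2, -, -⟩ := hreg.fracLap_H1_Halpha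
  have hc := fracConst_nonneg d hα₀ hα₁
  set I₁ := ∫ r in (0 : ℝ)..T, ‖Aut r‖ ^ 2 with hI₁
  set I₂ := ∫ r in (0 : ℝ)..T, ‖utt r‖ ^ 2 with hI₂
  set I₃ := ∫ r in (0 : ℝ)..T, ‖ut r‖ ^ 2 with hI₃
  have hI₁0 : 0 ≤ I₁ := intervalIntegral.integral_nonneg hT.le fun _ _ => by positivity
  have hI₂0 : 0 ≤ I₂ := intervalIntegral.integral_nonneg hT.le fun _ _ => by positivity
  have hI₃0 : 0 ≤ I₃ := intervalIntegral.integral_nonneg hT.le fun _ _ => by positivity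
  set L := 3 + 2 * K ^ 2 / ν with hL
  set M₀ := 85 * γ ^ 2 + 9 + 2 * K ^ 2 / ν with hM₀
  have hL0 : 0 ≤ L := by positivity
  have hM₀0 : 0 ≤ M₀ := by positivity
  refine ⟨48 * (Real.exp (L * T) * (M₀ * (I₁ + I₂ + I₃))) + 1, by positivity, ?_⟩
  intro k hk hk1 N hNT un wn pn hmod e ebar he hebar
  have ht0 : ∀ n : ℕ, 0 ≤ (n : ℝ) * k := fun n => by positivity
  have htT : ∀ n ≤ N, (n : ℝ) * k ≤ T := fun n hn => le_trans (by gcongr) hNT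
  have htpos : ∀ n : ℕ, 0 < ((n + 1 : ℕ) : ℝ) * k := fun n => by positivity
  have htlt : ∀ n : ℕ, (n : ℝ) * k < ((n + 1 : ℕ) : ℝ) * k := fun n => by gcongr; simp
  have htk : ∀ n : ℕ, ((n + 1 : ℕ) : ℝ) * k - (n : ℝ) * k = k := fun n => by push_cast; ring
  have hX : ∀ n ≤ N, MemX α Ω (u (n * k)) := fun n hn => hsol.mem_X _ ⟨ht0 n, htT n hn⟩
  have hA : ∀ n ≤ N, IsFracLapOn α univ (u (n * k)) (Au (n * k)) :=
    fun n hn => hsol.frac_lap _ ⟨ht0 n, htT n hn⟩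
  have heH : ∀ n ≤ N, MemHalphaOff α Ω (e n) := fun n hn => by
    rw [he]
    exact (hX n hn).memHalphaOff.sub (hmod.mem_u n hn)
  have he0 : e 0 = 0 := by rw [he, Nat.cast_zero, zero_mul, hsol.initial, hmod.u_zero, sub_self]
  have hebar0 : ebar 0 = 0 := by
    rw [hebar, Nat.cast_zero, zero_mul, hsol.initial, hmod.w_zero, sub_self]
  -- the fields `B n` that represent the fractional Laplacian of the errors
  obtain ⟨B, hB0, hB1, hB2⟩ := exists_representation (N := N) (P := MemHalphaOff α Ω)
    (a := fun n v => fracConst d α / 2 * gagliardoForm α (e n) v) (e := e) (b := ebar)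
    (δ := fun n => Au (((n + 1 : ℕ) : ℝ) * k) - Au (n * k)) hk hγ
    (fun v hv => by
      have := gagliardoForm_sub_left (heH 0 (Nat.zero_le _)).1 (heH 0 (Nat.zero_le _)).1 hv.1
      rw [sub_self, sub_self, ← he0] at this
      simp only [this, mul_zero])
    (fun n hn v hv => by
      simp only [he, hebar]
      exact stage2_error (hA n hn.le) (hA (n + 1) hn) (hmod.mem_u n hn.le)
        (hmod.mem_u (n + 1) hn) (hmod.stage2 n hn) hv)
  refine ⟨B N, ⟨(heH N le_rfl).1, (Lp.memLp (B N)).restrict Ω, fun v hv => ?_⟩, ?_⟩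
  · rw [hv.2.setIntegral_inner]
    exact hB2 N le_rfl v hv
  set R : ℕ → ℝ := fun n => ‖Au (((n + 1 : ℕ) : ℝ) * k) - Au (n * k)‖ ^ 2
    + ‖(1 / k) • (u (((n + 1 : ℕ) : ℝ) * k) - u (n * k)) - ut (((n + 1 : ℕ) : ℝ) * k)‖ ^ 2
    + ‖u (((n + 1 : ℕ) : ℝ) * k) - u (n * k)‖ ^ 2 with hR
  have hRle : k * ∑ n ∈ Finset.range N, R n ≤ k ^ 2 * (I₁ + I₂ + I₃) := by
    have hn : ∀ n ∈ Finset.range N, R n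
        ≤ k * (∫ r in ((n : ℝ) * k)..(((n + 1 : ℕ) : ℝ) * k), ‖Aut r‖ ^ 2)
          + k * (∫ r in ((n : ℝ) * k)..(((n + 1 : ℕ) : ℝ) * k), ‖utt r‖ ^ 2)
          + k * (∫ r in ((n : ℝ) * k)..(((n + 1 : ℕ) : ℝ) * k), ‖ut r‖ ^ 2) := by
      intro n hn
      have hn' := htT (n + 1) (Finset.mem_range.1 hn)
      have h1 := hAut.sq_norm_sub_le hAut2 (ht0 n) (htlt n).le hn'
      have h2 := sq_norm_quotient_sub_deriv_le hsol.time_deriv hutt hutt2 (ht0 n) (htlt n) hn'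
      have h3 := hsol.time_deriv.sq_norm_sub_le hut2 (ht0 n) (htlt n).le hn'
      rw [htk] at h1 h2 h3
      exact add_le_add (add_le_add h1 h2) h3
    have h1 := Finset.sum_le_sum hn
    simp only [Finset.sum_add_distrib, ← Finset.mul_sum] at h1
    have h2 := sum_intervalIntegral_sq_norm_le hAut2 hk.le hNT
    have h3 := sum_intervalIntegral_sq_norm_le hutt2 hk.le hNT
    have h4 := sum_intervalIntegral_sq_norm_le hut2 hk.le hNT
    calc k * ∑ n ∈ Finset.range N, R n ≤ k * (k * I₁ + k * I₂ + k * I₃) := by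
          refine mul_le_mul_of_nonneg_left (h1.trans ?_) hk.le
          gcongr
      _ = _ := by ring
  refine (error_bound_of_step (L := L) (M₀ := M₀) hν hγ hc hk hL0 hM₀0 hNT he0 hebar0 hB0
    (fun n hn => (heH n hn).1) (R := R) (fun n _ => by positivity) fun n hn => ?_).trans ?_
  · have ht : ((n + 1 : ℕ) : ℝ) * k ∈ Ioc 0 T := ⟨htpos n, htT (n + 1) hn⟩
    obtain ⟨S, hS, h1⟩ := stage1_error hK0 hK (hX n hn.le) (hA n hn.le) (hX (n + 1) hn)
      (hM _ ⟨ht.1.le, ht.2⟩) (hsol.incompressible _ ht)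
      (fun v hv hdv => variational_of_momentum hd hΩ_open hΩ_bdd (hX (n + 1) hn)
        (hsol.mem_H2 _ ht) (hsol.mem_H1 _ ht) (hsol.incompressible _ ht) (hsol.momentum _ ht)
        hv hdv)
      (hmod.mem_u n hn.le) (hmod.mem_w n hn) (hmod.stage1_div n hn)
      (fun v hv => (hmod.conv_integrable n hn v hv).1) (hmod.stage1 n hn)
      (fun v hv => by rw [← he]; exact hB2 n hn.le v hv) (he n) (hebar (n + 1))
    exact energy_step hk hk1 hν hγ (gradForm_self_nonneg Ω _) hS h1 (hB1 n)
      (hB2 n hn.le _ (heH (n + 1) hn)).symm (hB2 (n + 1) hn _ (heH (n + 1) hn)).symm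
  · have : 48 * (Real.exp (L * T) * (M₀ * (k * ∑ n ∈ Finset.range N, R n)))
        ≤ 48 * (Real.exp (L * T) * (M₀ * (k ^ 2 * (I₁ + I₂ + I₃)))) := by
      gcongr
    linarith [sq_nonneg k]
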